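/- **Conventions.** Let $F_2=\langle a,b\rangle$ be the free group on two generators and let $X$ be the Cantor set. All actions are by homeomorphisms, homeomorphisms are identified with the $\mathbb Z$-actions they generate, and $M_\alpha(Y)$ denotes the set of Borel probability measures on $Y$ invariant under an action $\alpha$ of a group $G$ on $Y$. The action is *strictly ergodic* if it is minimal and $M_\alpha(Y)$ is a singleton; *topologically free* if the points with trivial stabilizer are dense; *topologically weakly mixing* if for all nonempty open $U_1,U_2,V_1,V_2\subseteq Y$ there is $s\in G$ with $sU_1\cap U_2\neq\emptyset\neq sV_1\cap V_2$. A homeomorphism $T$ of $Y$ is *spectrally aperiodic* if there are no clopen $A\subseteq Y$ and $n\ge 1$ such that $A,TA,\dots,T^nA$ partition $Y$. A probability-measure-preserving action $G\curvearrowright(Z,\zeta)$ is *weakly mixing* if for every finite collection $\Omega$ of measurable sets and $\varepsilon>0$ there is $s\in G$ with $|\zeta(sA\cap B)-\zeta(A)\zeta(B)|<\varepsilon$ for all $A,B\in\Omega$. A sequence of such actions on $(Z_n,\zeta_n)$ is *disjoint* if $\prod_n\zeta_n$ is the only probability measure on $\prod_n Z_n$ which is invariant under the diagonal action and has marginals $\zeta_n$.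 $\mathrm{WA}(F_2,Y)$ is the set of minimal, topologically free, topologically weakly mixing actions $\alpha$ of $F_2$ on $Y$ with $M_\alpha(Y)\ne\emptyset$. $\mathcal A^*(F_2,Y)$ is the set of topologically free actions $\alpha$ of $F_2$ on $Y$ with $M_\alpha(Y)\neq\emptyset$ for which $\alpha_a$ and $\alpha_b$ are each strictly ergodic and spectrally aperiodic. A *tower permutation* of a minimal homeomorphism $T$ of $X$ is a homeomorphism $S$ of $X$ for which there are nonempty clopen sets $B_1,\dots,B_k$ and integers $n_1,\dots,n_k\ge1$ such that the sets $T^jB_i$ ($1\le i\le k$, $0\le j<n_i$) partition $X$, and for each $i$ a permutation $\pi_i$ of $\{0,\dots,n_i-1\}$, consisting of a single cycle of length $n_i$, with $\pi_i(n_i-1)=0$, such that $S=T^{\pi_i(j)-j}$ on $T^jB_i$ for $0\le j\le n_i-2$ and $S=T$ on $T^{n_i-1}B_i$. *Square divisibility.* Let $G\curvearrowright Y$ be an action on a compact metrizable space. For $A\subseteq Y$ closed and $B\subseteq Y$ open write $A\prec B$ if there are open sets $U_1,\dots,U_n$ covering $A$ and $s_1,\dots,s_n\in G$ such that $s_1U_1,\dots,s_nU_n$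 are pairwise disjoint subsets of $B$. Sets $V_1,\dots,V_M$ are *pairwise equivalent* if there are finitely many Borel sets $C_k$ and $s_{k,m}\in G$ with $s_{k,1}=e$, $V_m=\bigsqcup_k s_{k,m}C_k$ for all $m$, and the sets $s_{k,m}C_k$ (over all $k,m$) having pairwise disjoint closures; they are *pairwise $E$-disjoint*, for $E\subseteq G$, if the sets $E\,\overline{V_m}$ are pairwise disjoint. For open $O_1,O_2\subseteq Y$ and finite $E\subseteq G$ with $e\in E$, the action is *$(O_1,O_2,E)$-squarely divisible* if there are $n\ge1$, pairwise equivalent and pairwise $E$-disjoint open sets $V_{i,j}$ ($1\le i,j\le n$) and, with $V=\bigsqcup_{i,j}V_{i,j}$, an open set $U\supseteq\partial V$ such that, with $V_1=\bigsqcup_iV_{i,1}$, $R=Y\setminus V$ and $B=\overline V\setminus\bigcap_{s\in E}s^{-1}(V\setminus\overline U)$: (i) $\overline{V_{i,1}}\prec \big(O_1\cap\bigsqcup_{j\ge2}V_{i,j}\big)\setminus B$ for all $i$; (ii) $R\prec (O_2\cap V)\setminus(V_1\cup B)$; (iii) $B\cup(\overline U\cap R)\prec O_2\setminus\overline{V\cup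 U}$. The action is *squarely divisible* if for every nonempty open $O\subseteq Y$ there are nonempty open sets $O_0\subseteq O$ and $O_1,O_2\subseteq Y$ with pairwise disjoint closures such that $\overline{O_1}\sqcup\overline{O_2}\prec O_0$ and the action is $(O_1,O_2,E)$-squarely divisible for every finite $E\subseteq G$ containing $e$. **Proposition.** Let $(T_n)_{n\in\mathbb N}$ be a sequence of strictly ergodic homeomorphisms of the Cantor set $X$ such that, writing $\mu_n$ for the unique measure in $M_{T_n}(X)$, the transformations $T_n\curvearrowright(X,\mu_n)$ are weakly mixing and form a disjoint family. For homeomorphisms $S_n$ of $X$ let $\alpha_n$ be the action of $F_2$ on $X$ given by $a\mapsto T_n$, $b\mapsto S_n$. (A) There are tower permutations $S_n$ of $T_n$ ($n\in\mathbb N$) such that $$\lim_{n\to\infty}\mu_n(\{x\in X:\alpha_{n,s}x=x\})=0\quad\text{for every } s\in F_2\setminus\{e\}.\qquad(*)$$ (B) Whenever $S_n$ is a tower permutation of $T_n$ for every $n$ and $(*)$ holds, one has: 1. $M_{\alpha_n}(X)=M_{T_n}(X)=M_{S_n}(X)$ for every $n$; 2. the diagonal action $F_2\curvearrowright X^{\mathbb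 N}$, given by $a\mapsto\prod_nT_n$ and $b\mapsto\prod_nS_n$, is topologically free, topologically weakly mixing and strictly ergodic; 3. the homeomorphisms $\prod_nT_n$ and $\prod_nS_n$ of $X^{\mathbb N}$ are strictly ergodic and topologically weakly mixing; 4. the diagonal action $F_2\curvearrowright X^{\mathbb N}$ is squarely divisible; 5. for every space $Y$ homeomorphic to $X^{\mathbb N}$ (in particular $Y=X$), every conjugate $F_2\curvearrowright Y$ of the diagonal action by a homeomorphism $X^{\mathbb N}\to Y$ belongs to both $\mathrm{WA}(F_2,Y)$ and $\mathcal A^*(F_2,Y)$ and is squarely divisible. -/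

import Mathlib

open MeasureTheory Set Filter Topology

noncomputable section

namespace SqDiv

/-! Actions by homeomorphisms. -/

/-- An action of a (discrete) group `G` on a space `X` by homeomorphisms. -/
abbrev Act (G X : Type*) [Group G] [TopologicalSpace X] := G →* (X ≃ₜ X)

/-- The action of `ℤ` (written multiplicatively) generated by a homeomorphism. -/
abbrev zAct {X : Type*} [TopologicalSpace X] (T : X ≃ₜ X) : Act (Multiplicative ℤ) X :=
  zpowersHom (X ≃ₜ X) T

/-- The action of the free group on `a, b` (the generators `0, 1`) given by `a ↦ T`, `b ↦ S`. -/
def f2Act {X : Type*} [TopologicalSpace X] (T S : X ≃ₜ X) : Act (FreeGroup (Fin 2)) X :=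
  FreeGroup.lift ![T, S]

/-- The diagonal action on a product: `s (x i)_i = (s (x i))_i`. -/
def diagAct {ι G : Type*} {Z : ι → Type*} [Group G] [∀ i, TopologicalSpace (Z i)]
    (α : ∀ i, Act G (Z i)) : Act G (∀ i, Z i) where
  toFun s := Homeomorph.piCongrRight fun i => α i s
  map_one' := by ext x i; simp [Homeomorph.piCongrRight]
  map_mul' s t := by ext x i; simp [Homeomorph.piCongrRight]

/-- The conjugate `s ↦ h ∘ α s ∘ h⁻¹` of an action by a homeomorphism `h : X → Y`. -/
def conjAct {G X Y : Type*} [Group G] [TopologicalSpace X] [TopologicalSpace Y]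
    (h : X ≃ₜ Y) (α : Act G X) : Act G Y where
  toFun s := (h.symm.trans (α s)).trans h
  map_one' := by ext y; simp
  map_mul' s t := by ext y; simp

section Topological

variable {G X : Type*} [Group G] [TopologicalSpace X]

/-- Minimality: the only closed invariant sets are `∅` and the whole space. -/
def IsMinimalAct (α : Act G X) : Prop :=
  ∀ C : Set X, IsClosed C → (∀ s, α s '' C ⊆ C) → C = ∅ ∨ C = univ

/-- The points with trivial stabilizer are dense. -/
def TopFree (α : Act G X) : Prop :=
  Dense {x : X | ∀ s, α s x = x → s = 1}

/-- Topological weak mixing. -/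
def TopWeaklyMixing (α : Act G X) : Prop :=
  ∀ U₁ U₂ V₁ V₂ : Set X, IsOpen U₁ → IsOpen U₂ → IsOpen V₁ → IsOpen V₂ →
    U₁.Nonempty → U₂.Nonempty → V₁.Nonempty → V₂.Nonempty →
    ∃ s, (α s '' U₁ ∩ U₂).Nonempty ∧ (α s '' V₁ ∩ V₂).Nonempty

/-- No clopen set `A` and `n ≥ 1` are such that `A, T A, …, T ^ n A` partition the space. -/
def SpectrallyAperiodic (T : X ≃ₜ X) : Prop :=
  ¬ ∃ (A : Set X) (n : ℕ), IsClopen A ∧ 1 ≤ n ∧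
    Pairwise (fun i j : Fin (n + 1) =>
      Disjoint ((T ^ (i : ℕ)) '' A) ((T ^ (j : ℕ)) '' A)) ∧
    (⋃ i : Fin (n + 1), (T ^ (i : ℕ)) '' A) = univ

/-- `S` is a tower permutation of `T`: there is a clopen castle for `T` partitioning `X`, with
bases `B i` and heights `h i + 1`, and for every `i` a cyclic permutation `π i` of
`{0, …, h i}` (a single cycle of full length) with `π i (h i) = 0`, such that
`S = T ^ (π i j - j)` on `T ^ j (B i)` for `j < h i` and `S = T` on `T ^ (h i) (B i)`. -/
def IsTowerPermutation (T S : X ≃ₜ X) : Prop :=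
  ∃ (k : ℕ) (B : Fin k → Set X) (h : Fin k → ℕ) (π : ∀ i, Equiv.Perm (Fin (h i + 1))),
    (∀ i, IsClopen (B i) ∧ (B i).Nonempty) ∧
    Pairwise (fun p q : (i : Fin k) × Fin (h i + 1) =>
      Disjoint ((T ^ (p.2 : ℕ)) '' B p.1) ((T ^ (q.2 : ℕ)) '' B q.1)) ∧
    (⋃ p : (i : Fin k) × Fin (h i + 1), (T ^ (p.2 : ℕ)) '' B p.1) = univ ∧
    (∀ i, (π i).IsCycleOn univ ∧ π i (Fin.last (h i)) = 0) ∧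
    (∀ i, ∀ j : Fin (h i + 1), j ≠ Fin.last (h i) →
      ∀ x ∈ (T ^ (j : ℕ)) '' B i, S x = (T ^ (((π i j : ℕ) : ℤ) - ((j : ℕ) : ℤ))) x) ∧
    (∀ i, ∀ x ∈ (T ^ h i) '' B i, S x = T x)

/-! Square divisibility. -/

/-- Dynamical subequivalence `A ≺ B` (used for `A` closed and `B` open). -/
def Subequiv (α : Act G X) (A B : Set X) : Prop :=
  ∃ (n : ℕ) (U : Fin n → Set X) (s : Fin n → G),
    (∀ i, IsOpen (U i)) ∧ A ⊆ ⋃ i, U i ∧ (∀ i, α (s i) '' U i ⊆ B) ∧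
    Pairwise (fun i j => Disjoint (α (s i) '' U i) (α (s j) '' U j))

/-- Pairwise equivalence of a family of sets, in which `m₀` is the first index. -/
def PairwiseEquivalent {ι : Type*} (α : Act G X) (m₀ : ι) (V : ι → Set X) : Prop :=
  ∃ (K : ℕ) (C : Fin K → Set X) (s : Fin K → ι → G),
    (∀ k, MeasurableSet[borel X] (C k)) ∧ (∀ k, s k m₀ = 1) ∧
    V m₀ = ⋃ k, C k ∧
    (∀ m, V m = ⋃ k, α (s k m) '' C k) ∧
    Pairwise (fun p q : Fin K × ι =>
      Disjoint (closure (α (s p.1 p.2) '' C p.1)) (closure (α (s q.1 q.2) '' C q.1)))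

/-- The members of the family `V` are pairwise `E`-disjoint: the sets `E · closure (V m)` are
pairwise disjoint. -/
def PairwiseDisjointBy {ι : Type*} (α : Act G X) (E : Finset G) (V : ι → Set X) : Prop :=
  Pairwise (fun m m' : ι =>
    Disjoint (⋃ s ∈ E, α s '' closure (V m)) (⋃ s ∈ E, α s '' closure (V m')))

/-- `W ^ E = ⋂ s ∈ E, s⁻¹ W`. -/
def core (α : Act G X) (E : Finset G) (W : Set X) : Set X :=
  ⋂ s ∈ E, α s ⁻¹' W

/-- `(O₁, O₂, E)`-square divisibility (for `O₁, O₂` open and `1 ∈ E`). The side length of the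
square array is `m + 1 ≥ 1`, and the first column is the column with index `0`. -/
def SquarelyDivisibleBy (α : Act G X) (O₁ O₂ : Set X) (E : Finset G) : Prop :=
  ∃ (m : ℕ) (V' : Fin (m + 1) → Fin (m + 1) → Set X) (U : Set X),
    (∀ i j, IsOpen (V' i j)) ∧
    PairwiseEquivalent α ((0, 0) : Fin (m + 1) × Fin (m + 1)) (fun p => V' p.1 p.2) ∧
    PairwiseDisjointBy α E (fun p : Fin (m + 1) × Fin (m + 1) => V' p.1 p.2) ∧
    let V : Set X := ⋃ i, ⋃ j, V' i j
    let V₁ : Set X := ⋃ i, V' i 0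
    let R : Set X := Vᶜ
    let B : Set X := closure V ∩ (core α E (V ∩ (closure U)ᶜ))ᶜ
    IsOpen U ∧ frontier V ⊆ U ∧
    (∀ i, Subequiv α (closure (V' i 0)) (O₁ ∩ (⋃ j ∈ {j | j ≠ 0}, V' i j) ∩ Bᶜ)) ∧
    Subequiv α R (O₂ ∩ V ∩ (V₁ ∪ B)ᶜ) ∧
    Subequiv α (B ∪ (closure U ∩ R)) (O₂ ∩ (closure (V ∪ U))ᶜ)

/-- `O`-square divisibility, for a nonempty open set `O`. -/
def SquarelyDivisibleIn (α : Act G X) (O : Set X) : Prop :=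
  ∃ O₀ O₁ O₂ : Set X,
    (IsOpen O₀ ∧ IsOpen O₁ ∧ IsOpen O₂) ∧
    (O₀.Nonempty ∧ O₁.Nonempty ∧ O₂.Nonempty) ∧
    O₀ ⊆ O ∧
    (Disjoint (closure O₀) (closure O₁) ∧ Disjoint (closure O₀) (closure O₂) ∧
      Disjoint (closure O₁) (closure O₂)) ∧
    Subequiv α (closure O₁ ∪ closure O₂) O₀ ∧
    ∀ E : Finset G, 1 ∈ E → SquarelyDivisibleBy α O₁ O₂ E

/-- Square divisibility of an action. -/
def SquarelyDivisible (α : Act G X) : Prop :=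
  ∀ O : Set X, IsOpen O → O.Nonempty → SquarelyDivisibleIn α O

end Topological

/-! Invariant measures. On a topological space the `σ`-algebra is meant to be the Borel one. -/

section Measured

variable {G X : Type*} [Group G] [TopologicalSpace X] [MeasurableSpace X]

/-- The set of invariant (Borel) probability measures of an action. -/
def invMeasures (α : Act G X) : Set (Measure X) :=
  {μ | IsProbabilityMeasure μ ∧ ∀ s, MeasurePreserving (α s) μ μ}

/-- Strict ergodicity: minimality and exactly one invariant Borel probability measure. -/
def StrictlyErgodic (α : Act G X) : Prop :=
  IsMinimalAct α ∧ ∃! μ : Measure X, μ ∈ invMeasures α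

/-- Weak mixing of a probability-measure-preserving action. -/
def MeasureWeaklyMixing (α : Act G X) (μ : Measure X) : Prop :=
  ∀ Ω : Set (Set X), Ω.Finite → (∀ A ∈ Ω, MeasurableSet A) → ∀ ε : ℝ, 0 < ε →
    ∃ s, ∀ A ∈ Ω, ∀ B ∈ Ω, |μ.real (α s '' A ∩ B) - μ.real A * μ.real B| < ε

/-- Disjointness of a (countable) family of probability-measure-preserving actions: the product
measure is the only invariant probability measure of the diagonal action with the given
marginals. -/
def DisjointFamily {ι : Type*} {Z : ι → Type*} [∀ i, TopologicalSpace (Z i)]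
    [∀ i, MeasurableSpace (Z i)] (α : ∀ i, Act G (Z i)) (ζ : ∀ i, Measure (Z i))
    [∀ i, IsProbabilityMeasure (ζ i)] : Prop :=
  ∀ ν : Measure (∀ i, Z i), ν ∈ invMeasures (diagAct α) →
    (∀ i, ν.map (fun x => x i) = ζ i) → ν = Measure.infinitePi ζ

variable (G X) in
/-- The minimal, topologically free, (topologically) weakly mixing actions of `G` on `X` with an
invariant Borel probability measure. -/
def WA : Set (Act G X) :=
  {α | IsMinimalAct α ∧ TopFree α ∧ TopWeaklyMixing α ∧ (invMeasures α).Nonempty}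

variable (X) in
/-- The topologically free actions of the free group of rank `d` with an invariant Borel
probability measure that are strictly ergodic and spectrally aperiodic on each standard
generator. -/
def Astar (d : ℕ) : Set (Act (FreeGroup (Fin d)) X) :=
  {α | TopFree α ∧ (invMeasures α).Nonempty ∧
    ∀ i : Fin d, StrictlyErgodic (zAct (α (FreeGroup.of i))) ∧
      SpectrallyAperiodic (α (FreeGroup.of i))}

/-- For every `s ≠ e` in the free group on `a, b`, the `μ n`-measure of the set of fixed points
of `s` under the action `a ↦ T n`, `b ↦ S n` tends to `0`. -/
def AsymptoticallyFree (T S : ℕ → X ≃ₜ X) (μ : ℕ → Measure X) : Prop :=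
  ∀ s : FreeGroup (Fin 2), s ≠ 1 →
    Tendsto (fun n => μ n {x : X | f2Act (T n) (S n) s x = x}) atTop (𝓝 0)

end Measured

end SqDiv

end

open SqDiv

noncomputable section

namespace SqDiv

section Basics

variable {X : Type*} [TopologicalSpace X]

theorem zpow_add_apply (T : X ≃ₜ X) (m n : ℤ) (x : X) : (T ^ (m + n)) x = (T ^ m) ((T ^ n) x) := by
  rw [zpow_add]; rfl

theorem mem_image_pow_iff (T : X ≃ₜ X) (j : ℕ) (B : Set X) (x : X) :
    x ∈ (T ^ j) '' B ↔ (T ^ (-(j : ℤ))) x ∈ B := by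
  constructor
  · rintro ⟨y, hy, rfl⟩
    rw [← zpow_natCast, ← zpow_add_apply]
    simpa using hy
  · intro h
    refine ⟨_, h, ?_⟩
    rw [← zpow_natCast, ← zpow_add_apply]
    simp

theorem zAct_apply (T : X ≃ₜ X) (k : Multiplicative ℤ) : zAct T k = T ^ k.toAdd := rfl

/-- A map that is locally given by powers of `T` is continuous. -/
theorem continuous_zpow_apply (T : X ≃ₜ X) {c : X → ℤ} (hc : IsLocallyConstant c) :
    Continuous fun x => (T ^ c x) x := by
  rw [continuous_iff_continuousAt]
  intro x
  have h := (T ^ c x).continuous.continuousAt (x := x)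
  refine h.congr ?_
  filter_upwards [(IsLocallyConstant.iff_eventually_eq c).1 hc x] with y hy
  rw [hy]

/-- The topological full group of a homeomorphism. -/
def fullGroup (T : X ≃ₜ X) : Subgroup (X ≃ₜ X) where
  carrier := {g | ∃ c : X → ℤ, IsLocallyConstant c ∧ ∀ x, g x = (T ^ c x) x}
  one_mem' := ⟨fun _ => 0, IsLocallyConstant.const 0, fun x => by simp⟩
  mul_mem' := by
    rintro f g ⟨c, hc, hf⟩ ⟨d, hd, hg⟩
    refine ⟨fun x => c (g x) + d x, (hc.comp_continuous g.continuous).add hd, fun x => ?_⟩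
    rw [Homeomorph.mul_apply, hf, zpow_add_apply, ← hg]
  inv_mem' := by
    rintro f ⟨c, hc, hf⟩
    refine ⟨fun x => -c (f.symm x), (hc.comp_continuous f.symm.continuous).neg, fun x => ?_⟩
    have h := hf (f.symm x)
    rw [Homeomorph.apply_symm_apply] at h
    have h' : (T ^ (-c (f.symm x))) x = (T ^ (-c (f.symm x))) ((T ^ c (f.symm x)) (f.symm x)) := by
      rw [← h]
    rw [h', ← zpow_add_apply, neg_add_cancel, zpow_zero]
    rfl

theorem mem_fullGroup {T g : X ≃ₜ X} :
    g ∈ fullGroup T ↔ ∃ c : X → ℤ, IsLocallyConstant c ∧ ∀ x, g x = (T ^ c x) x := Iff.rfl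

theorem self_mem_fullGroup (T : X ≃ₜ X) : T ∈ fullGroup T :=
  ⟨fun _ => 1, IsLocallyConstant.const 1, fun x => by simp⟩

theorem map_mem_of_generators {K : Type*} [Group K] (f : FreeGroup (Fin 2) →* K) (H : Subgroup K)
    (h₀ : f (FreeGroup.of 0) ∈ H) (h₁ : f (FreeGroup.of 1) ∈ H) (s : FreeGroup (Fin 2)) :
    f s ∈ H := by
  induction s using FreeGroup.induction_on with
  | C1 => simp
  | of i => fin_cases i <;> assumption
  | inv_of i hi => rw [map_inv]; exact H.inv_mem hi
  | mul x y hx hy => rw [map_mul]; exact H.mul_mem hx hy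

@[simp] theorem f2Act_of_zero (T S : X ≃ₜ X) : f2Act T S (FreeGroup.of 0) = T := by
  simp [f2Act]

@[simp] theorem f2Act_of_one (T S : X ≃ₜ X) : f2Act T S (FreeGroup.of 1) = S := by
  simp [f2Act]

end Basics

section Minimal

variable {X : Type*} [TopologicalSpace X] {T : X ≃ₜ X}

theorem isMinimalAct_zAct_iff : IsMinimalAct (zAct T) ↔
    ∀ U : Set X, IsOpen U → U.Nonempty → ∀ x, ∃ k : ℤ, (T ^ k) x ∈ U := by
  constructor
  · intro h U hU hne x
    have hC : IsClosed (⋃ k : ℤ, (T ^ k) ⁻¹' U)ᶜ :=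
      (isOpen_iUnion fun k => hU.preimage (T ^ k).continuous).isClosed_compl
    have key := h _ hC ?_
    · rcases key with h0 | h1
      · have : x ∈ ⋃ k : ℤ, (T ^ k) ⁻¹' U := by rw [compl_empty_iff.1 h0]; trivial
        simpa using this
      · obtain ⟨y, hy⟩ := hne
        have : y ∈ (⋃ k : ℤ, (T ^ k) ⁻¹' U)ᶜ := by rw [h1]; trivial
        exact absurd (mem_iUnion.2 ⟨0, by simpa using hy⟩) this
    · rintro s _ ⟨y, hy, rfl⟩ hmem
      obtain ⟨k, hk⟩ := mem_iUnion.1 hmem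
      refine hy (mem_iUnion.2 ⟨k + s.toAdd, ?_⟩)
      rw [mem_preimage, zpow_add_apply]
      exact hk
  · intro h C hC hinv
    by_contra hcon
    push Not at hcon
    obtain ⟨x, hx⟩ := hcon.1
    obtain ⟨k, hk⟩ := h Cᶜ hC.isOpen_compl (nonempty_compl.2 hcon.2) x
    exact hk (hinv (Multiplicative.ofAdd k) ⟨x, hx, rfl⟩)

/-- In a minimal system the return times to an open set are bounded, forwards and backwards. -/
theorem exists_return_bound [CompactSpace X] (hT : IsMinimalAct (zAct T)) {U : Set X}
    (hU : IsOpen U) (hne : U.Nonempty) :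
    ∃ K : ℕ, ∀ x, (∃ j < K, (T ^ (j : ℤ)) x ∈ U) ∧ ∃ j < K, (T ^ (-(j : ℤ))) x ∈ U := by
  have hcov : (univ : Set X) ⊆ ⋃ k : ℤ, (T ^ k) ⁻¹' U := fun x _ =>
    mem_iUnion.2 (isMinimalAct_zAct_iff.1 hT U hU hne x)
  obtain ⟨t, ht⟩ := isCompact_univ.elim_finite_subcover _
    (fun k : ℤ => hU.preimage (T ^ k).continuous) hcov
  obtain ⟨b, hb⟩ : ∃ b : ℕ, ∀ k ∈ t, k.natAbs ≤ b :=
    ⟨t.sup Int.natAbs, fun k hk => Finset.le_sup (f := Int.natAbs) hk⟩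
  have key : ∀ x, ∃ k : ℤ, k.natAbs ≤ b ∧ (T ^ k) x ∈ U := fun x => by
    obtain ⟨k, hk, hkx⟩ := mem_iUnion₂.1 (ht (mem_univ x))
    exact ⟨k, hb k hk, hkx⟩
  refine ⟨2 * b + 1, fun x => ⟨?_, ?_⟩⟩
  · obtain ⟨k, hk, hkx⟩ := key ((T ^ (b : ℤ)) x)
    refine ⟨(k + b).toNat, by omega, ?_⟩
    rw [← zpow_add_apply] at hkx
    rwa [Int.toNat_of_nonneg (by omega)]
  · obtain ⟨k, hk, hkx⟩ := key ((T ^ (-(b : ℤ))) x)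
    refine ⟨(-(k + -b)).toNat, by omega, ?_⟩
    rw [← zpow_add_apply] at hkx
    rwa [Int.toNat_of_nonneg (by omega), neg_neg]

/-- A minimal homeomorphism of an infinite compact `T₁` space has no periodic points. -/
theorem zpow_apply_ne [T1Space X] [Infinite X] (hT : IsMinimalAct (zAct T)) (x : X)
    {k : ℤ} (hk : k ≠ 0) : (T ^ k) x ≠ x := by
  intro hx
  have hper : ∀ n : ℤ, (T ^ (k * n)) x = x := by
    intro n
    induction n using Int.induction_on with
    | zero => simp
    | succ n ih => rw [mul_add, zpow_add_apply, mul_one, hx, ih]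
    | pred n ih =>
      rw [mul_sub, sub_eq_add_neg, zpow_add_apply, mul_one]
      have : (T ^ (-k)) x = x := by
        conv_lhs => rw [← hx]
        rw [← zpow_add_apply]; simp
      rw [this, ih]
  have hfin : (range fun n : ℤ => (T ^ n) x).Finite := by
    refine (((Finset.Ico 0 |k|).finite_toSet).image fun n : ℤ => (T ^ n) x).subset ?_
    rintro _ ⟨n, rfl⟩
    refine ⟨n % k, ?_, ?_⟩
    · simp [Int.emod_nonneg n hk, Int.emod_lt_abs n hk]
    · show (T ^ (n % k)) x = (T ^ n) x
      conv_rhs => rw [← Int.emod_add_mul_ediv n k, zpow_add_apply, hper]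
  obtain ⟨y, hy⟩ := hfin.infinite_compl.nonempty
  obtain ⟨n, hn⟩ := isMinimalAct_zAct_iff.1 hT _ hfin.isClosed.isOpen_compl ⟨y, hy⟩ x
  exact hn ⟨n, rfl⟩

end Minimal

section Measures

variable {X : Type*} [TopologicalSpace X] [MeasurableSpace X] [BorelSpace X]

theorem measurePreserving_inv {g : X ≃ₜ X} {μ : Measure X} (h : MeasurePreserving g μ μ) :
    MeasurePreserving (g⁻¹ : X ≃ₜ X) μ μ :=
  MeasurePreserving.symm g.toMeasurableEquiv h

/-- The group of homeomorphisms preserving a measure. -/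
def preservingGroup (μ : Measure X) : Subgroup (X ≃ₜ X) where
  carrier := {g | MeasurePreserving g μ μ}
  one_mem' := MeasurePreserving.id μ
  mul_mem' {f g} (hf : MeasurePreserving f μ μ) (hg : MeasurePreserving g μ μ) := hf.comp hg
  inv_mem' {g} (h : MeasurePreserving g μ μ) := measurePreserving_inv h

theorem mem_preservingGroup {μ : Measure X} {g : X ≃ₜ X} :
    g ∈ preservingGroup μ ↔ MeasurePreserving g μ μ := Iff.rfl

theorem measurePreserving_zpow {T : X ≃ₜ X} {μ : Measure X} (h : MeasurePreserving T μ μ) (k : ℤ) :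
    MeasurePreserving (T ^ k : X ≃ₜ X) μ μ :=
  mem_preservingGroup.1 ((preservingGroup μ).zpow_mem (mem_preservingGroup.2 h) k)

theorem mem_invMeasures_zAct {T : X ≃ₜ X} {μ : Measure X} :
    μ ∈ invMeasures (zAct T) ↔ IsProbabilityMeasure μ ∧ MeasurePreserving T μ μ := by
  refine and_congr_right fun _ => ⟨fun h => ?_, fun h k => ?_⟩
  · simpa [zAct_apply] using h (Multiplicative.ofAdd 1)
  · exact measurePreserving_zpow h k.toAdd

theorem mem_invMeasures_f2 {α : Act (FreeGroup (Fin 2)) X} {μ : Measure X} :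
    μ ∈ invMeasures α ↔ IsProbabilityMeasure μ ∧ MeasurePreserving (α (FreeGroup.of 0)) μ μ ∧
      MeasurePreserving (α (FreeGroup.of 1)) μ μ := by
  refine and_congr_right fun _ => ⟨fun h => ⟨h _, h _⟩, fun h k => ?_⟩
  exact mem_preservingGroup.1 (map_mem_of_generators α (preservingGroup μ)
      (mem_preservingGroup.2 h.1) (mem_preservingGroup.2 h.2) k)

theorem measure_image_eq {g : X ≃ₜ X} {μ : Measure X} (h : MeasurePreserving g μ μ)
    (A : Set X) : μ (g '' A) = μ A := by
  have := (measurePreserving_inv h).measure_preimage_equiv (f := g.symm.toMeasurableEquiv) A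
  rw [← this]
  congr 1
  exact (g.toEquiv.image_eq_preimage_symm A)

theorem measurePreserving_of_mem_fullGroup {T g : X ≃ₜ X} {μ : Measure X}
    (hT : MeasurePreserving T μ μ) (hg : g ∈ fullGroup T) : MeasurePreserving g μ μ := by
  obtain ⟨c, hc, hgc⟩ := hg
  refine ⟨g.continuous.measurable, ?_⟩
  ext A hA
  rw [Measure.map_apply g.continuous.measurable hA]
  have hpow : ∀ k : ℤ, MeasurePreserving (T ^ k : X ≃ₜ X) μ μ :=
    measurePreserving_zpow hT
  have hmeas : ∀ k : ℤ, MeasurableSet (c ⁻¹' {k}) := fun k => (hc {k}).measurableSet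
  have e₁ : g ⁻¹' A = ⋃ k : ℤ, (c ⁻¹' {k} ∩ (T ^ k) ⁻¹' A) := by
    ext x; simp [hgc]
  have e₂ : A = ⋃ k : ℤ, (T ^ k) '' (c ⁻¹' {k} ∩ (T ^ k) ⁻¹' A) := by
    ext y
    simp only [mem_iUnion]
    constructor
    · intro hy
      refine ⟨c (g.symm y), g.symm y, ⟨rfl, ?_⟩, ?_⟩
      · rw [mem_preimage, ← hgc]; simpa using hy
      · rw [← hgc]; simp
    · rintro ⟨k, x, ⟨-, hx⟩, rfl⟩
      exact hx
  have hm : ∀ k : ℤ, MeasurableSet (c ⁻¹' {k} ∩ (T ^ k) ⁻¹' A) := fun k =>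
    (hmeas k).inter ((T ^ k).continuous.measurable hA)
  rw [e₁, measure_iUnion _ hm]
  · conv_rhs => rw [e₂]
    rw [measure_iUnion]
    · exact tsum_congr fun k => (measure_image_eq (hpow k) _).symm
    · intro k l hkl
      refine disjoint_left.2 ?_
      rintro _ ⟨x, ⟨hx, -⟩, rfl⟩ ⟨y, ⟨hy, -⟩, hxy⟩
      have h₁ : (T ^ k) x = g x := by rw [hgc, hx]
      have h₂ : (T ^ l) y = g y := by rw [hgc, hy]
      rw [h₁, h₂] at hxy
      have := g.injective hxy
      subst this
      exact hkl (hx.symm.trans hy)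
    · intro k
      exact (T ^ k).toMeasurableEquiv.measurableSet_image.2 (hm k)
  · intro k l hkl
    refine disjoint_left.2 ?_
    rintro x ⟨hx, -⟩ ⟨hy, -⟩
    exact hkl (hx.symm.trans hy)

/-- The support of an invariant measure of a minimal homeomorphism is the whole space. -/
theorem measure_pos_of_minimal [CompactSpace X] {T : X ≃ₜ X} (hT : IsMinimalAct (zAct T))
    {μ : Measure X} [IsProbabilityMeasure μ] (hμ : MeasurePreserving T μ μ) {U : Set X}
    (hU : IsOpen U) (hne : U.Nonempty) : 0 < μ U := by
  rw [pos_iff_ne_zero]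
  intro h0
  have hcov : (univ : Set X) ⊆ ⋃ k : ℤ, (T ^ k) ⁻¹' U := fun x _ =>
    mem_iUnion.2 (isMinimalAct_zAct_iff.1 hT U hU hne x)
  have : μ univ = 0 := measure_mono_null hcov <| measure_iUnion_null fun k => by
    rw [(measurePreserving_zpow hμ k).measure_preimage hU.measurableSet.nullMeasurableSet]
    exact h0
  simp at this

end Measures

section Empirical

variable {X : Type*} [TopologicalSpace X] [MeasurableSpace X] [BorelSpace X]

/-- The empirical measure of the orbit segment `x, T x, …, T ^ n x`. -/
def empirical (T : X ≃ₜ X) (n : ℕ) (x : X) : Measure X :=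
  ((n + 1 : ℕ) : ENNReal)⁻¹ • ∑ j ∈ Finset.range (n + 1), Measure.dirac ((T ^ (j : ℤ)) x)

instance (T : X ≃ₜ X) (n : ℕ) (x : X) : IsProbabilityMeasure (empirical T n x) where
  measure_univ := by
    simp only [empirical, Measure.smul_apply, Measure.coe_finsetSum, Finset.sum_apply,
      measure_univ, Finset.sum_const, Finset.card_range, smul_eq_mul, nsmul_eq_mul, mul_one]
    exact ENNReal.inv_mul_cancel (by simp) (by simp)

open Classical in
/-- The number of visits to `A` of the orbit segment `x, …, T ^ (n - 1) x`. -/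
def visits (T : X ≃ₜ X) (A : Set X) (n : ℕ) (x : X) : ℕ :=
  ((Finset.range n).filter fun j : ℕ => (T ^ (j : ℤ)) x ∈ A).card

omit [BorelSpace X] in
theorem empirical_real (T : X ≃ₜ X) (n : ℕ) (x : X) {A : Set X} (hA : MeasurableSet A) :
    (empirical T n x).real A = visits T A (n + 1) x / (n + 1) := by
  classical
  simp only [empirical, measureReal_def, Measure.smul_apply, Measure.coe_finsetSum,
    Finset.sum_apply, smul_eq_mul, Measure.dirac_apply' _ hA, visits, Finset.card_filter]
  rw [ENNReal.toReal_mul, ENNReal.toReal_sum (fun j _ => by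
    by_cases h : (T ^ (j : ℤ)) x ∈ A
    · rw [indicator_of_mem h]; simp
    · rw [indicator_of_notMem h]; simp)]
  rw [ENNReal.toReal_inv, ENNReal.toReal_natCast, div_eq_inv_mul]
  rw [Nat.cast_sum, Nat.cast_succ]
  congr 1
  refine Finset.sum_congr rfl fun j _ => ?_
  by_cases h : (T ^ (j : ℤ)) x ∈ A
  · rw [indicator_of_mem h, if_pos h]; simp
  · rw [indicator_of_notMem h, if_neg h]; simp

theorem integral_empirical (T : X ≃ₜ X) (n : ℕ) (x : X) {f : X → ℝ} (hf : Continuous f) :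
    ∫ y, f y ∂empirical T n x =
      ((n : ℝ) + 1)⁻¹ * ∑ j ∈ Finset.range (n + 1), f ((T ^ (j : ℤ)) x) := by
  rw [empirical, integral_smul_measure, integral_finsetSum_measure]
  · simp only [smul_eq_mul]
    congr 1
    · rw [ENNReal.toReal_inv, ENNReal.toReal_natCast]; push_cast; rfl
    · exact Finset.sum_congr rfl fun j _ => integral_dirac' _ _ hf.stronglyMeasurable
  · intro j _
    exact integrable_dirac' hf.stronglyMeasurable enorm_lt_top

/-- Krylov–Bogoliubov: limits of empirical measures are invariant. -/
theorem exists_limit_of_empirical [CompactSpace X] [TopologicalSpace.MetrizableSpace X]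
    (T : X ≃ₜ X) (x : ℕ → X) (n : ℕ → ℕ) (hn : Tendsto n atTop atTop) :
    ∃ (F : Filter ℕ) (ν : Measure X), F.NeBot ∧ F ≤ atTop ∧ IsProbabilityMeasure ν ∧
      MeasurePreserving T ν ν ∧ ∀ A, IsClopen A →
        Tendsto (fun k => (visits T A (n k + 1) (x k) : ℝ) / (n k + 1)) F (𝓝 (ν.real A)) := by
  let _ := TopologicalSpace.metrizableSpaceMetric X
  let P : ℕ → ProbabilityMeasure X := fun k => ⟨empirical T (n k) (x k), inferInstance⟩
  obtain ⟨ν, -, hν⟩ := isCompact_univ.ultrafilter_le_nhds (Ultrafilter.map P (hyperfilter ℕ))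
    (by simp)
  have hlim : Tendsto P (hyperfilter ℕ) (𝓝 ν) := hν
  have hF : (hyperfilter ℕ : Filter ℕ) ≤ atTop := Nat.hyperfilter_le_atTop
  refine ⟨hyperfilter ℕ, ν, inferInstance, hF, inferInstance, ⟨T.continuous.measurable, ?_⟩, ?_⟩
  · have := Measure.isProbabilityMeasure_map (μ := (ν : Measure X))
      T.continuous.measurable.aemeasurable
    refine ext_of_forall_integral_eq_of_IsFiniteMeasure fun f => ?_
    rw [integral_map T.continuous.measurable.aemeasurable
      f.continuous.stronglyMeasurable.aestronglyMeasurable]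
    have h := ProbabilityMeasure.tendsto_iff_forall_integral_tendsto.1 hlim
    have h₁ := h f
    have h₂ := h (f.compContinuous ⟨T, T.continuous⟩)
    have h₃ := h₂.sub h₁
    refine sub_eq_zero.1 (tendsto_nhds_unique h₃ ?_)
    have hdiff : ∀ k, (∫ y, f.compContinuous ⟨T, T.continuous⟩ y ∂(P k : Measure X)) -
        ∫ y, f y ∂(P k : Measure X) =
        ((n k : ℝ) + 1)⁻¹ * (f ((T ^ ((n k + 1 : ℕ) : ℤ)) (x k)) - f (x k)) := by
      intro k
      show (∫ y, f.compContinuous ⟨T, T.continuous⟩ y ∂(empirical T (n k) (x k))) -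
        ∫ y, f y ∂(empirical T (n k) (x k)) = _
      rw [integral_empirical _ _ _ f.continuous, integral_empirical _ _ _
        (f.compContinuous ⟨T, T.continuous⟩).continuous, ← mul_sub, ← Finset.sum_sub_distrib]
      have hs := Finset.sum_range_sub (fun j : ℕ => f ((T ^ (j : ℤ)) (x k))) (n k + 1)
      simp only [Nat.cast_zero, zpow_zero, Homeomorph.one_apply] at hs
      rw [← hs]
      congr 1
      refine Finset.sum_congr rfl fun j _ => ?_
      rw [BoundedContinuousFunction.compContinuous_apply, Nat.cast_succ, add_comm (j : ℤ),
        zpow_add_apply, zpow_one]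
      rfl
    simp only [hdiff]
    have hbd : ∀ k, ‖((n k : ℝ) + 1)⁻¹ * (f ((T ^ ((n k + 1 : ℕ) : ℤ)) (x k)) - f (x k))‖ ≤
        ((n k : ℝ) + 1)⁻¹ * (2 * ‖f‖) := by
      intro k
      rw [norm_mul, Real.norm_of_nonneg (by positivity)]
      gcongr
      exact (f.dist_le_two_norm _ _)
    refine squeeze_zero_norm hbd ?_
    have : Tendsto (fun k => ((n k : ℝ) + 1)⁻¹ * (2 * ‖f‖)) atTop (𝓝 (0 * (2 * ‖f‖))) := by
      refine Tendsto.mul_const _ (tendsto_inv_atTop_zero.comp ?_)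
      exact tendsto_atTop_add_const_right _ _ (tendsto_natCast_atTop_atTop.comp hn)
    rw [zero_mul] at this
    exact this.mono_left hF
  · intro A hA
    have h := ProbabilityMeasure.tendsto_measure_of_isClopen_of_tendsto hlim hA
    have h' := (NNReal.continuous_coe.tendsto _).comp h
    refine h'.congr fun k => ?_
    exact empirical_real T (n k) (x k) hA.isOpen.measurableSet

end Empirical

section CastleSection

variable {X : Type*} [TopologicalSpace X]

/-- A clopen castle for `T`: finitely many towers with clopen bases, whose levels partition the
space. The tower over `base i` has the levels `T ^ j (base i)`, `0 ≤ j ≤ ht i`. -/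
structure Castle (T : X ≃ₜ X) where
  ι : Type
  fintype : Fintype ι
  base : ι → Set X
  ht : ι → ℕ
  isClopen_base : ∀ i, IsClopen (base i)
  existsUnique : ∀ x, ∃! p : (i : ι) × Fin (ht i + 1), (T ^ (-((p.2 : ℕ) : ℤ))) x ∈ base p.1

namespace Castle

variable {T : X ≃ₜ X} (C : Castle T)

instance : Fintype C.ι := C.fintype

/-- The level of the castle that contains a point. -/
def loc (x : X) : (i : C.ι) × Fin (C.ht i + 1) := (C.existsUnique x).choose

theorem loc_mem (x : X) : (T ^ (-(((C.loc x).2 : ℕ) : ℤ))) x ∈ C.base (C.loc x).1 :=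
  (C.existsUnique x).choose_spec.1

theorem loc_eq {x : X} {p : (i : C.ι) × Fin (C.ht i + 1)}
    (h : (T ^ (-((p.2 : ℕ) : ℤ))) x ∈ C.base p.1) : C.loc x = p :=
  (C.existsUnique x).unique (C.loc_mem x) h

theorem loc_eq_iff {x : X} {p : (i : C.ι) × Fin (C.ht i + 1)} :
    C.loc x = p ↔ (T ^ (-((p.2 : ℕ) : ℤ))) x ∈ C.base p.1 :=
  ⟨fun h => h ▸ C.loc_mem x, C.loc_eq⟩

theorem loc_eq_iff_mem_image {x : X} {p : (i : C.ι) × Fin (C.ht i + 1)} :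
    C.loc x = p ↔ x ∈ (T ^ (p.2 : ℕ)) '' C.base p.1 := by
  rw [loc_eq_iff, mem_image_pow_iff]

theorem isLocallyConstant_loc : IsLocallyConstant C.loc := by
  refine IsLocallyConstant.iff_eventually_eq _ |>.2 fun x => ?_
  have hopen : IsOpen ((T ^ (-(((C.loc x).2 : ℕ) : ℤ))) ⁻¹' C.base (C.loc x).1) :=
    (C.isClopen_base _).isOpen.preimage (Homeomorph.continuous _)
  filter_upwards [hopen.mem_nhds (C.loc_mem x)] with y hy
  exact C.loc_eq hy

theorem loc_zpow {x : X} {j : Fin (C.ht (C.loc x).1 + 1)} :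
    C.loc ((T ^ (((j : ℕ) : ℤ) - ((C.loc x).2 : ℕ))) x) = ⟨(C.loc x).1, j⟩ := by
  refine C.loc_eq ?_
  rw [← zpow_add_apply]
  have : -((j : ℕ) : ℤ) + (((j : ℕ) : ℤ) - ((C.loc x).2 : ℕ)) = -(((C.loc x).2 : ℕ) : ℤ) := by
    ring
  simp only [this]
  exact C.loc_mem x

/-- The map permuting the levels of every tower. -/
def permFun (ρ : ∀ i, Equiv.Perm (Fin (C.ht i + 1))) (x : X) : X :=
  (T ^ (((ρ (C.loc x).1 (C.loc x).2 : ℕ) : ℤ) - ((C.loc x).2 : ℕ))) x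

theorem loc_permFun (ρ : ∀ i, Equiv.Perm (Fin (C.ht i + 1))) (x : X) :
    C.loc (C.permFun ρ x) = ⟨(C.loc x).1, ρ (C.loc x).1 (C.loc x).2⟩ := C.loc_zpow

theorem permFun_mul (ρ σ : ∀ i, Equiv.Perm (Fin (C.ht i + 1))) (x : X) :
    C.permFun (ρ * σ) x = C.permFun ρ (C.permFun σ x) := by
  conv_rhs => rw [permFun, loc_permFun]
  rw [permFun, permFun, ← zpow_add_apply]
  congr 2
  simp

theorem permFun_one (x : X) : C.permFun 1 x = x := by simp [permFun]

theorem isLocallyConstant_shift (ρ : ∀ i, Equiv.Perm (Fin (C.ht i + 1))) :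
    IsLocallyConstant fun x => ((ρ (C.loc x).1 (C.loc x).2 : ℕ) : ℤ) - ((C.loc x).2 : ℕ) :=
  C.isLocallyConstant_loc.comp fun p => ((ρ p.1 p.2 : ℕ) : ℤ) - (p.2 : ℕ)

/-- The homomorphism from level permutations to homeomorphisms. -/
def permHom : (∀ i, Equiv.Perm (Fin (C.ht i + 1))) →* (X ≃ₜ X) where
  toFun ρ :=
    { toFun := C.permFun ρ
      invFun := C.permFun ρ⁻¹
      left_inv := fun x => by rw [← permFun_mul, inv_mul_cancel, permFun_one]
      right_inv := fun x => by rw [← permFun_mul, mul_inv_cancel, permFun_one]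
      continuous_toFun := continuous_zpow_apply T (C.isLocallyConstant_shift ρ)
      continuous_invFun := continuous_zpow_apply T (C.isLocallyConstant_shift ρ⁻¹) }
  map_one' := by ext x; exact C.permFun_one x
  map_mul' ρ σ := by ext x; exact C.permFun_mul ρ σ x

theorem permHom_apply (ρ : ∀ i, Equiv.Perm (Fin (C.ht i + 1))) (x : X) :
    C.permHom ρ x = (T ^ (((ρ (C.loc x).1 (C.loc x).2 : ℕ) : ℤ) - ((C.loc x).2 : ℕ))) x := rfl

theorem loc_permHom (ρ : ∀ i, Equiv.Perm (Fin (C.ht i + 1))) (x : X) :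
    C.loc (C.permHom ρ x) = ⟨(C.loc x).1, ρ (C.loc x).1 (C.loc x).2⟩ := C.loc_permFun ρ x

theorem permHom_mem_fullGroup (ρ : ∀ i, Equiv.Perm (Fin (C.ht i + 1))) :
    C.permHom ρ ∈ fullGroup T :=
  ⟨_, C.isLocallyConstant_shift ρ, C.permHom_apply ρ⟩

theorem isClopen_loc (P : Set ((i : C.ι) × Fin (C.ht i + 1))) : IsClopen {x | C.loc x ∈ P} :=
  ⟨⟨C.isLocallyConstant_loc Pᶜ⟩, C.isLocallyConstant_loc P⟩

/-- The refinement of a castle according to the itinerary under a finite partition. -/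
def refine {κ : Type} [Fintype κ] {f : X → κ} (hf : IsLocallyConstant f) : Castle T where
  ι := (i : C.ι) × (Fin (C.ht i + 1) → κ)
  fintype := by classical infer_instance
  base p := C.base p.1 ∩ {x | ∀ j : Fin (C.ht p.1 + 1), f ((T ^ ((j : ℕ) : ℤ)) x) = p.2 j}
  ht p := C.ht p.1
  isClopen_base p := by
    have : {x | ∀ j : Fin (C.ht p.1 + 1), f ((T ^ ((j : ℕ) : ℤ)) x) = p.2 j} =
        ⋂ j : Fin (C.ht p.1 + 1), (T ^ ((j : ℕ) : ℤ)) ⁻¹' (f ⁻¹' {p.2 j}) := by ext; simp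
    rw [this]
    exact (C.isClopen_base _).inter (isClopen_iInter_of_finite fun j =>
      (hf.isClopen_fiber _).preimage (Homeomorph.continuous _))
  existsUnique x := by
    refine ⟨⟨⟨(C.loc x).1, fun j => f ((T ^ (((j : ℕ) : ℤ) - ((C.loc x).2 : ℕ))) x)⟩,
      (C.loc x).2⟩, ⟨C.loc_mem x, fun j => ?_⟩, ?_⟩
    · rw [← zpow_add_apply]
      show _ = f _
      rw [sub_eq_add_neg]
    · rintro ⟨⟨i, τ⟩, j⟩ ⟨h₁, h₂⟩
      have := C.loc_eq (p := ⟨i, j⟩) h₁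
      have e : (fun l : Fin (C.ht i + 1) => f ((T ^ (((l : ℕ) : ℤ) - (j : ℕ))) x)) = τ := by
        funext l
        refine Eq.trans ?_ (h₂ l)
        rw [← zpow_add_apply, sub_eq_add_neg]
      rw [← e]
      have key : ∀ q : (i : C.ι) × Fin (C.ht i + 1), C.loc x = q →
          (⟨⟨q.1, fun l : Fin (C.ht q.1 + 1) => f ((T ^ (((l : ℕ) : ℤ) - (q.2 : ℕ))) x)⟩, q.2⟩ :
            (p : (i : C.ι) × (Fin (C.ht i + 1) → κ)) × Fin (C.ht p.1 + 1)) =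
          ⟨⟨(C.loc x).1, fun j => f ((T ^ (((j : ℕ) : ℤ) - ((C.loc x).2 : ℕ))) x)⟩,
            (C.loc x).2⟩ := by
        rintro q rfl; rfl
      exact key ⟨i, j⟩ this

theorem refine_apply {κ : Type} [Fintype κ] {f : X → κ} (hf : IsLocallyConstant f) (x : X) :
    f x = ((C.refine hf).loc x).1.2 ((C.refine hf).loc x).2 := by
  have h := ((C.refine hf).loc_mem x).2 ((C.refine hf).loc x).2
  rw [← h, ← zpow_add_apply, add_neg_cancel]
  simp

section Measure

variable [MeasurableSpace X] [BorelSpace X] {μ : Measure X} [IsProbabilityMeasure μ]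

omit [IsProbabilityMeasure μ] in
theorem measureReal_loc_eq (hμ : MeasurePreserving T μ μ) (p : (i : C.ι) × Fin (C.ht i + 1)) :
    μ.real {x | C.loc x = p} = μ.real (C.base p.1) := by
  have : {x | C.loc x = p} = (T ^ (-((p.2 : ℕ) : ℤ))) ⁻¹' C.base p.1 := by
    ext x; exact C.loc_eq_iff
  rw [this, (measurePreserving_zpow hμ _).measureReal_preimage
    (C.isClopen_base _).isOpen.measurableSet.nullMeasurableSet]

theorem measureReal_levels (hμ : MeasurePreserving T μ μ)
    (P : ∀ i, Finset (Fin (C.ht i + 1))) :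
    μ.real {x | (C.loc x).2 ∈ P (C.loc x).1} = ∑ i, (P i).card * μ.real (C.base i) := by
  have : {x | (C.loc x).2 ∈ P (C.loc x).1} =
      ⋃ p ∈ (Finset.univ.sigma P : Finset ((i : C.ι) × Fin (C.ht i + 1))), {x | C.loc x = p} := by
    ext x; simp
  rw [this, measureReal_biUnion_finset]
  · simp only [C.measureReal_loc_eq hμ, Finset.sum_sigma, Finset.sum_const, nsmul_eq_mul]
  · intro p _ q _ hpq
    exact disjoint_left.2 fun x (hx : C.loc x = p) (hx' : C.loc x = q) => hpq (hx.symm.trans hx')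
  · intro p _
    exact (C.isClopen_loc {p}).isOpen.measurableSet

theorem sum_measureReal (hμ : MeasurePreserving T μ μ) :
    ∑ i, ((C.ht i : ℝ) + 1) * μ.real (C.base i) = 1 := by
  have h := C.measureReal_levels hμ fun i => Finset.univ
  simpa using h.symm

theorem measureReal_levels_le (hμ : MeasurePreserving T μ μ)
    (P : ∀ i, Finset (Fin (C.ht i + 1))) {ε : ℝ} (hP : ∀ i, ((P i).card : ℝ) ≤ ε * (C.ht i + 1)) :
    μ.real {x | (C.loc x).2 ∈ P (C.loc x).1} ≤ ε := by
  calc _ = ∑ i, (P i).card * μ.real (C.base i) := C.measureReal_levels hμ P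
    _ ≤ ∑ i, ε * (((C.ht i : ℝ) + 1) * μ.real (C.base i)) := by
      refine Finset.sum_le_sum fun i _ => ?_
      rw [← mul_assoc]
      exact mul_le_mul_of_nonneg_right (hP i) measureReal_nonneg
    _ = ε := by rw [← Finset.mul_sum, C.sum_measureReal hμ, mul_one]

end Measure

end Castle

/-- Every minimal homeomorphism of an infinite totally disconnected compact Hausdorff space has
a nonempty clopen set disjoint from many of its translates. -/
theorem exists_clopen_disjoint_translates [CompactSpace X] [T2Space X]
    [TotallyDisconnectedSpace X] [Infinite X] {T : X ≃ₜ X} (hT : IsMinimalAct (zAct T)) (H : ℕ) :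
    ∃ W : Set X, IsClopen W ∧ W.Nonempty ∧
      ∀ x ∈ W, ∀ j : ℕ, 0 < j → j < H → (T ^ (j : ℤ)) x ∉ W := by
  obtain ⟨x₀⟩ : Nonempty X := inferInstance
  have hfin : ((fun j : ℕ => (T ^ (j : ℤ)) x₀) '' (Finset.Ioo 0 H : Finset ℕ)).Finite :=
    Set.Finite.image _ (Finset.finite_toSet _)
  obtain ⟨U, hU, hx₀, hsub⟩ := compact_exists_isClopen_in_isOpen hfin.isClosed.isOpen_compl
    (x := x₀) (by
      rintro ⟨j, hj, hx⟩
      have hj' := Finset.mem_Ioo.1 (Finset.mem_coe.1 hj)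
      exact zpow_apply_ne hT x₀ (k := j) (by omega) hx)
  refine ⟨U ∩ ⋂ j ∈ Finset.Ioo 0 H, (T ^ (j : ℤ)) ⁻¹' Uᶜ, ?_, ⟨x₀, hx₀, ?_⟩, ?_⟩
  · refine hU.inter (isClopen_biInter_finset fun j _ => hU.compl.preimage (Homeomorph.continuous _))
  · refine mem_iInter₂.2 fun j hj hmem => hsub hmem ⟨j, hj, rfl⟩
  · rintro x ⟨hx, hx'⟩ j h0 hH ⟨hmem, -⟩
    exact mem_iInter₂.1 hx' j (Finset.mem_Ioo.2 ⟨h0, hH⟩) hmem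

/-- Existence of castles with high towers. -/
theorem exists_castle [CompactSpace X] [T2Space X]
    [TotallyDisconnectedSpace X] [Infinite X] {T : X ≃ₜ X} (hT : IsMinimalAct (zAct T)) (H : ℕ) :
    ∃ C : Castle T, (∀ i, (C.base i).Nonempty) ∧ ∀ i, H ≤ C.ht i + 1 := by
  classical
  obtain ⟨W, hW, hne, hdis⟩ := exists_clopen_disjoint_translates hT H
  obtain ⟨K, hK⟩ := exists_return_bound hT hW.isOpen hne
  -- points of `W` whose first return time is `r + 1`
  let R : ℕ → Set X := fun r =>
    W ∩ (T ^ ((r + 1 : ℕ) : ℤ)) ⁻¹' W ∩ ⋂ j ∈ Finset.Ioc 0 r, (T ^ (j : ℤ)) ⁻¹' Wᶜ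
  have hR : ∀ r x, x ∈ R r ↔ x ∈ W ∧ (T ^ ((r + 1 : ℕ) : ℤ)) x ∈ W ∧
      ∀ j : ℕ, 0 < j → j ≤ r → (T ^ (j : ℤ)) x ∉ W := by
    intro r x
    simp only [R, mem_inter_iff, mem_iInter, Finset.mem_Ioc, mem_preimage, mem_compl_iff,
      and_imp, and_assoc]
  have hRc : ∀ r, IsClopen (R r) := fun r =>
    (hW.inter (hW.preimage (Homeomorph.continuous _))).inter
      (isClopen_biInter_finset fun j _ => hW.compl.preimage (Homeomorph.continuous _))
  have hback : ∀ x, ∃ j : ℕ, (T ^ (-(j : ℤ))) x ∈ W := fun x =>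
    let ⟨j, _, h⟩ := (hK x).2; ⟨j, h⟩
  have hret : ∀ x, ∃ r : ℕ, (T ^ ((r + 1 : ℕ) : ℤ)) x ∈ W := fun x => by
    obtain ⟨j, -, h⟩ := (hK (T x)).1
    refine ⟨j, ?_⟩
    push_cast
    rw [zpow_add_apply, zpow_one]
    exact h
  have hretK : ∀ x, Nat.find (hret x) < K := fun x => by
    obtain ⟨j, hj, h⟩ := (hK (T x)).1
    refine (Nat.find_min' (hret x) ?_).trans_lt hj
    push_cast
    rw [zpow_add_apply, zpow_one]
    exact h
  refine ⟨⟨{r : Fin K // (R r).Nonempty}, inferInstance, fun r => R r.1, fun r => r.1,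
    fun r => hRc _, fun x => ?_⟩, fun r => r.2, ?_⟩
  · set j := Nat.find (hback x) with hj
    set w := (T ^ (-(j : ℤ))) x with hw
    have hwW : w ∈ W := Nat.find_spec (hback x)
    set r := Nat.find (hret w) with hr
    have hwR : w ∈ R r := by
      refine (hR r w).2 ⟨hwW, Nat.find_spec (hret w), fun i h0 hi hmem => ?_⟩
      refine Nat.find_min (hret w) (m := i - 1) (by omega) ?_
      rwa [Nat.sub_add_cancel h0]
    have hjr : j < r + 1 := by
      by_contra hcon
      refine Nat.find_min (hback x) (m := j - (r + 1)) (by omega) ?_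
      have h := Nat.find_spec (hret w)
      rw [← hr, hw, ← zpow_add_apply] at h
      have e : ((r + 1 : ℕ) : ℤ) + -(j : ℤ) = -((j - (r + 1) : ℕ) : ℤ) := by omega
      rwa [e] at h
    refine ⟨⟨⟨⟨r, hretK w⟩, ⟨w, hwR⟩⟩, ⟨j, hjr⟩⟩, hwR, ?_⟩
    rintro ⟨⟨⟨r', hr'⟩, hne'⟩, ⟨j', hj'⟩⟩ hmem
    have hmem : (T ^ (-(j' : ℤ))) x ∈ R r' := hmem
    simp only at hj'
    rw [hR] at hmem
    have hjj : j' = j := by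
      have hle : j ≤ j' := Nat.find_min' (hback x) hmem.1
      by_contra hcon
      refine hmem.2.2 (j' - j) (by omega) (by omega) ?_
      rw [← zpow_add_apply]
      have e : ((j' - j : ℕ) : ℤ) + -(j' : ℤ) = -(j : ℤ) := by omega
      rw [e]; exact hwW
    have hwR' := (hR r w).1 hwR
    have hrr : r' = r := by
      rw [hjj] at hmem
      rcases lt_trichotomy r' r with h | h | h
      · exact absurd hmem.2.1 (hwR'.2.2 _ (by omega) (by omega))
      · exact h
      · exact absurd hwR'.2.1 (hmem.2.2 _ (by omega) (by omega))
    subst hjj hrr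
    rfl
  · rintro ⟨r, ⟨x, hx⟩⟩
    have h := (hR _ x).1 hx
    by_contra hcon
    exact hdis x h.1 _ (Nat.succ_pos _) (by simpa using hcon) h.2.1

end CastleSection

theorem exists_perm_mapsTo {α : Type*} [Finite α] {P Q : Finset α} (h : P.card ≤ Q.card) :
    ∃ ρ : Equiv.Perm α, ∀ x ∈ P, ρ x ∈ Q := by
  classical
  obtain ⟨Q', hQ', hcard⟩ := Finset.exists_subset_card_eq h
  let e : {x // x ∈ P} ≃ {x // x ∈ Q'} := Finset.equivOfCardEq hcard.symm
  exact ⟨e.extendSubtype, fun x hx => hQ' (e.extendSubtype_mem x hx)⟩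

section Towers

variable {X : Type*} [TopologicalSpace X] {T : X ≃ₜ X}

/-- The union of the levels `T ^ j A`, `j ∈ J`. -/
def tower (T : X ≃ₜ X) (J : Finset ℕ) (A : Set X) : Set X :=
  {x | ∃ j ∈ J, (T ^ (-(j : ℤ))) x ∈ A}

/-- The sets `T ^ j W`, `j < H`, are pairwise disjoint. -/
def TowerBase (T : X ≃ₜ X) (H : ℕ) (W : Set X) : Prop :=
  ∀ x, ∀ j < H, ∀ k < H, (T ^ (-(j : ℤ))) x ∈ W → (T ^ (-(k : ℤ))) x ∈ W → j = k

theorem tower_eq_biUnion (J : Finset ℕ) (A : Set X) :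
    tower T J A = ⋃ j ∈ J, (T ^ (-(j : ℤ))) ⁻¹' A := by
  ext x; simp only [tower, mem_ofPred_eq, mem_iUnion, mem_preimage, exists_prop]

theorem isClopen_tower (J : Finset ℕ) {A : Set X} (hA : IsClopen A) : IsClopen (tower T J A) := by
  rw [tower_eq_biUnion]
  exact isClopen_biUnion_finset fun j _ => hA.preimage (Homeomorph.continuous _)

theorem TowerBase.mono {H : ℕ} {W A : Set X} (h : TowerBase T H W) (hA : A ⊆ W) :
    TowerBase T H A := fun x j hj k hk h₁ h₂ => h x j hj k hk (hA h₁) (hA h₂)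

theorem TowerBase.of_forall {H : ℕ} {W : Set X}
    (h : ∀ x ∈ W, ∀ j : ℕ, 0 < j → j < H → (T ^ (j : ℤ)) x ∉ W) : TowerBase T H W := by
  have key : ∀ x, ∀ j < H, ∀ k < H, j < k → (T ^ (-(j : ℤ))) x ∈ W →
      (T ^ (-(k : ℤ))) x ∉ W := by
    intro x j hj k hk hjk h₁ h₂
    refine h _ h₂ (k - j) (by omega) (by omega) ?_
    rw [← zpow_add_apply]
    have e : ((k - j : ℕ) : ℤ) + -(k : ℤ) = -(j : ℤ) := by omega
    rwa [e]
  intro x j hj k hk h₁ h₂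
  rcases lt_trichotomy j k with h' | h' | h'
  · exact absurd h₂ (key x j hj k hk h' h₁)
  · exact h'
  · exact absurd h₁ (key x k hk j hj h' h₂)

variable [MeasurableSpace X] [BorelSpace X] {μ : Measure X} [IsProbabilityMeasure μ]

theorem measureReal_tower_inter (hμ : MeasurePreserving T μ μ) {H : ℕ} {A O : Set X}
    (h : TowerBase T H A) (hA : IsClopen A) (hO : IsClopen O) {J : Finset ℕ}
    (hJ : ∀ j ∈ J, j < H) :
    μ.real (tower T J A ∩ O) = ∑ j ∈ J, μ.real (A ∩ (T ^ (j : ℤ)) ⁻¹' O) := by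
  have e : tower T J A ∩ O = ⋃ j ∈ J, (T ^ (-(j : ℤ))) ⁻¹' A ∩ O := by
    rw [tower_eq_biUnion, iUnion₂_inter]
  rw [e, measureReal_biUnion_finset]
  · refine Finset.sum_congr rfl fun j _ => ?_
    have e' : (T ^ (-(j : ℤ))) ⁻¹' A ∩ O =
        (T ^ (-(j : ℤ))) ⁻¹' (A ∩ (T ^ (j : ℤ)) ⁻¹' O) := by
      ext x
      simp only [mem_inter_iff, mem_preimage, ← zpow_add_apply, add_neg_cancel, zpow_zero,
        Homeomorph.one_apply]
    rw [e', (measurePreserving_zpow hμ _).measureReal_preimage]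
    exact (hA.inter (hO.preimage (Homeomorph.continuous _))).isOpen.measurableSet.nullMeasurableSet
  · intro j hj k hk hjk
    refine disjoint_left.2 ?_
    rintro x ⟨h₁, -⟩ ⟨h₂, -⟩
    exact hjk (h x j (hJ j hj) k (hJ k hk) h₁ h₂)
  · intro j _
    exact ((hA.preimage (Homeomorph.continuous _)).inter hO).isOpen.measurableSet

theorem measureReal_tower (hμ : MeasurePreserving T μ μ) {H : ℕ} {A : Set X}
    (h : TowerBase T H A) (hA : IsClopen A) {J : Finset ℕ} (hJ : ∀ j ∈ J, j < H) :
    μ.real (tower T J A) = J.card * μ.real A := by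
  have := measureReal_tower_inter hμ h hA isClopen_univ hJ
  simpa using this

theorem TowerBase.mul_measureReal_le (hμ : MeasurePreserving T μ μ) {H : ℕ} {A : Set X}
    (h : TowerBase T H A) (hA : IsClopen A) : H * μ.real A ≤ 1 := by
  have := measureReal_tower hμ h hA (J := Finset.range H) (fun j hj => Finset.mem_range.1 hj)
  rw [Finset.card_range] at this
  rw [← this]
  exact measureReal_le_one

/-- If every orbit segment of length `L` visits `O`, then `O` occupies a proportion of at least
`1 / L` of a tower whose height is a multiple of `L`. -/
theorem mul_measureReal_le_tower_inter (hμ : MeasurePreserving T μ μ) {H L M q : ℕ} {A O : Set X}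
    (h : TowerBase T H A) (hA : IsClopen A) (hO : IsClopen O)
    (hL : ∀ x, ∃ j < L, (T ^ (j : ℤ)) x ∈ O) (hH : M + L * q ≤ H) :
    q * μ.real A ≤ μ.real (tower T (Finset.Ico M (M + L * q)) A ∩ O) := by
  rw [measureReal_tower_inter hμ h hA hO (fun j hj => by have := Finset.mem_Ico.1 hj; omega),
    Finset.sum_Ico_eq_sum_range, add_tsub_cancel_left]
  clear hH
  induction q with
  | zero => simp
  | succ q ih =>
    rw [mul_add, mul_one, Finset.sum_range_add, Nat.cast_succ, add_mul, one_mul]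
    refine add_le_add ih ?_
    have hsub : A ⊆ ⋃ j ∈ Finset.range L, A ∩ (T ^ ((M + (L * q + j) : ℕ) : ℤ)) ⁻¹' O := by
      intro x hx
      obtain ⟨j, hj, hjO⟩ := hL ((T ^ ((M + L * q : ℕ) : ℤ)) x)
      refine mem_iUnion₂.2 ⟨j, Finset.mem_range.2 hj, hx, ?_⟩
      rw [← zpow_add_apply] at hjO
      have e : (j : ℤ) + ((M + L * q : ℕ) : ℤ) = ((M + (L * q + j) : ℕ) : ℤ) := by
        push_cast; ring
      rwa [e] at hjO
    exact (measureReal_mono hsub (measure_ne_top _ _)).trans (measureReal_biUnion_finset_le _ _)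

variable [CompactSpace X] [T2Space X] [TotallyDisconnectedSpace X] [Infinite X]

/-- A clopen Rokhlin lemma. -/
theorem exists_rokhlin (hT : IsMinimalAct (zAct T)) (hμ : MeasurePreserving T μ μ) {H : ℕ}
    (hH : 0 < H) {ε : ℝ} (hε : 0 < ε) :
    ∃ W : Set X, IsClopen W ∧ TowerBase T H W ∧ 1 - ε ≤ H * μ.real W := by
  obtain ⟨L, hL⟩ := exists_nat_gt (1 / ε)
  have hL0 : (0 : ℝ) < L := (by positivity : (0 : ℝ) < 1 / ε).trans hL
  obtain ⟨C, -, hC⟩ := exists_castle hT (H * L)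
  let P : Set ((i : C.ι) × Fin (C.ht i + 1)) :=
    {p | H ∣ (p.2 : ℕ) ∧ (p.2 : ℕ) + H ≤ C.ht p.1 + 1}
  have hW : IsClopen {x | C.loc x ∈ P} := C.isClopen_loc P
  -- the position in the castle of the levels of the tower over `W`
  have hloc : ∀ x, ∀ j < H, C.loc ((T ^ (-(j : ℤ))) x) ∈ P →
      ((C.loc ((T ^ (-(j : ℤ))) x)).2 : ℕ) + j = (C.loc x).2 := by
    intro x j hj hx
    obtain ⟨-, hx₂⟩ := hx
    set y := (T ^ (-(j : ℤ))) x with hy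
    have hxy : x = (T ^ (j : ℤ)) y := by rw [hy, ← zpow_add_apply]; simp
    have hlt : ((C.loc y).2 : ℕ) + j < C.ht (C.loc y).1 + 1 := by omega
    have := C.loc_zpow (x := y) (j := ⟨_, hlt⟩)
    have e : (((C.loc y).2 + j : ℕ) : ℤ) - ((C.loc y).2 : ℕ) = j := by push_cast; ring
    rw [e, ← hxy] at this
    rw [this]
  have hbase : TowerBase T H {x | C.loc x ∈ P} := by
    intro x j hj k hk h₁ h₂
    have e₁ := hloc x j hj h₁
    have e₂ := hloc x k hk h₂
    obtain ⟨⟨a, ha⟩, -⟩ := h₁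
    obtain ⟨⟨b, hb⟩, -⟩ := h₂
    rw [ha] at e₁
    rw [hb] at e₂
    have := congrArg (· % H) (e₁.trans e₂.symm)
    simpa [Nat.mul_add_mod, Nat.mod_eq_of_lt hj, Nat.mod_eq_of_lt hk] using this
  refine ⟨_, hW, hbase, ?_⟩
  have hm := measureReal_tower hμ hbase hW (J := Finset.range H) (fun j hj => Finset.mem_range.1 hj)
  rw [Finset.card_range] at hm
  rw [← hm]
  have hbad : μ.real (tower T (Finset.range H) {x | C.loc x ∈ P})ᶜ ≤ ε := by
    let Q : ∀ i, Finset (Fin (C.ht i + 1)) := fun i =>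
      Finset.univ.filter fun j => H * ((C.ht i + 1) / H) ≤ (j : ℕ)
    refine (measureReal_mono (s₂ := {x | (C.loc x).2 ∈ Q (C.loc x).1}) ?_
      (measure_ne_top _ _)).trans (C.measureReal_levels_le hμ Q fun i => ?_)
    · intro x hx
      simp only [Q, mem_ofPred_eq, Finset.mem_filter, Finset.mem_univ, true_and]
      by_contra hcon
      push Not at hcon
      refine hx ⟨(C.loc x).2 % H, Finset.mem_range.2 (Nat.mod_lt _ hH), ?_⟩
      set j : ℕ := (C.loc x).2.val with hj
      have hdm := Nat.div_add_mod j H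
      have hjlt : j < C.ht (C.loc x).1 + 1 := (C.loc x).2.2
      have hlt : H * (j / H) < C.ht (C.loc x).1 + 1 := by omega
      have := C.loc_zpow (x := x) (j := ⟨_, hlt⟩)
      have e : ((H * (j / H) : ℕ) : ℤ) - ((C.loc x).2 : ℕ) = -((j % H : ℕ) : ℤ) := by
        rw [← hj]; omega
      simp only [e] at this
      show C.loc _ ∈ P
      rw [this]
      refine ⟨Dvd.intro _ rfl, ?_⟩
      show H * (j / H) + H ≤ C.ht (C.loc x).1 + 1
      have h1 : j / H < (C.ht (C.loc x).1 + 1) / H :=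
        (Nat.div_lt_iff_lt_mul hH).2 (by rwa [mul_comm])
      calc H * (j / H) + H = H * (j / H + 1) := by ring
        _ ≤ H * ((C.ht (C.loc x).1 + 1) / H) := Nat.mul_le_mul_left _ h1
        _ ≤ _ := Nat.mul_div_le _ _
    · have hcard : (Q i).card ≤ H := by
        have : ((Q i).map Fin.valEmbedding) ⊆
            Finset.Ico (H * ((C.ht i + 1) / H)) (C.ht i + 1) := by
          intro j hj
          simp only [Q, Finset.mem_map, Finset.mem_filter, Finset.mem_univ, true_and,
            Fin.valEmbedding_apply] at hj
          obtain ⟨a, ha, rfl⟩ := hj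
          exact Finset.mem_Ico.2 ⟨ha, a.2⟩
        have h2 := Finset.card_le_card this
        rw [Finset.card_map, Nat.card_Ico] at h2
        have := Nat.div_add_mod (C.ht i + 1) H
        have := Nat.mod_lt (C.ht i + 1) hH
        omega
      have h3 : (H : ℝ) * L ≤ C.ht i + 1 := by exact_mod_cast hC i
      have h4 : 1 ≤ ε * L := by
        rw [div_lt_iff₀ hε] at hL; linarith
      calc ((Q i).card : ℝ) ≤ H * 1 := by rw [mul_one]; exact_mod_cast hcard
        _ ≤ H * (ε * L) := by gcongr
        _ = ε * (H * L) := by ring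
        _ ≤ _ := by gcongr
  have hc := probReal_compl_eq_one_sub (μ := μ)
    (isClopen_tower (T := T) (Finset.range H) hW).isOpen.measurableSet
  linarith

/-- Clopen subsets of a clopen set attain a dense set of measures. -/
theorem exists_clopen_subset_measureReal (hT : IsMinimalAct (zAct T))
    (hμ : MeasurePreserving T μ μ) {W : Set X} (hW : IsClopen W) {a b : ℝ} (ha : 0 ≤ a)
    (hab : a < b) (hb : b ≤ μ.real W) :
    ∃ A ⊆ W, IsClopen A ∧ a < μ.real A ∧ μ.real A < b := by
  classical
  obtain ⟨H, hH⟩ := exists_nat_gt (1 / (b - a))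
  have hH0 : (0 : ℝ) < H := (one_div_pos.2 (sub_pos.2 hab)).trans hH
  obtain ⟨W₀, hW₀, hne, hdis⟩ := exists_clopen_disjoint_translates hT H
  have hsmall : μ.real W₀ < b - a := by
    have h := (TowerBase.of_forall hdis).mul_measureReal_le hμ hW₀
    rw [div_lt_iff₀ (sub_pos.2 hab)] at hH
    by_contra hcon
    push Not at hcon
    nlinarith
  obtain ⟨K, hK⟩ := exists_return_bound hT hW₀.isOpen hne
  let A : ℕ → Set X := fun t => W ∩ tower T (Finset.range t) W₀
  have hA : ∀ t, IsClopen (A t) := fun t => hW.inter (isClopen_tower _ hW₀)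
  have hKW : A K = W := by
    refine inter_eq_left.2 fun x _ => ?_
    obtain ⟨j, hj, hx⟩ := (hK x).2
    exact ⟨j, Finset.mem_range.2 hj, hx⟩
  have hex : ∃ t, a < μ.real (A t) := ⟨K, by rw [hKW]; exact hab.trans_le hb⟩
  refine ⟨A (Nat.find hex), inter_subset_left, hA _, Nat.find_spec hex, ?_⟩
  have hpos : Nat.find hex ≠ 0 := by
    intro h0
    have := Nat.find_spec hex
    rw [h0] at this
    simp [A, tower] at this
    linarith
  obtain ⟨t, ht⟩ := Nat.exists_eq_succ_of_ne_zero hpos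
  have hprev : μ.real (A t) ≤ a := by
    by_contra hcon
    exact Nat.find_min hex (m := t) (by omega) (not_le.1 hcon)
  rw [ht]
  have hsub : A (t + 1) ⊆ A t ∪ (T ^ (-(t : ℤ))) ⁻¹' W₀ := by
    rintro x ⟨hx, j, hj, hjx⟩
    rcases (Nat.lt_succ_iff_lt_or_eq.1 (Finset.mem_range.1 hj)) with h | rfl
    · exact Or.inl ⟨hx, j, Finset.mem_range.2 h, hjx⟩
    · exact Or.inr hjx
  have h1 := (measureReal_mono (μ := μ) hsub).trans (measureReal_union_le _ _)
  rw [(measurePreserving_zpow hμ _).measureReal_preimage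
    hW₀.isOpen.measurableSet.nullMeasurableSet] at h1
  show μ.real (A (t + 1)) < b
  linarith

end Towers

section Comparison

variable {X : Type*} [TopologicalSpace X] [CompactSpace X] [TopologicalSpace.MetrizableSpace X]
  [MeasurableSpace X] [BorelSpace X] {T : X ≃ₜ X} {μ : Measure X}

theorem exists_visits_le
    (hue : ∀ ν : Measure X, IsProbabilityMeasure ν → MeasurePreserving T ν ν → ν = μ)
    {A B : Set X} (hA : IsClopen A) (hB : IsClopen B) (hAB : μ.real A < μ.real B) :
    ∃ H, ∀ n ≥ H, ∀ x, visits T A n x ≤ visits T B n x := by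
  by_contra hcon
  push Not at hcon
  choose n hn x hx using fun k : ℕ => hcon (k + 1)
  obtain ⟨F, ν, hF, -, hν, hTν, hlim⟩ := exists_limit_of_empirical T x (fun k => n k - 1)
    (tendsto_atTop_mono (fun k => Nat.le_sub_one_of_lt (hn k)) tendsto_id)
  obtain rfl := hue ν hν hTν
  refine absurd (le_of_tendsto_of_tendsto (hlim B hB) (hlim A hA) (Eventually.of_forall fun k => ?_))
    (not_le.2 hAB)
  have hk : n k - 1 + 1 = n k := Nat.sub_add_cancel (by have := hn k; omega)
  have := (hx k).le
  dsimp only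
  rw [hk]
  gcongr

theorem exists_fullGroup_image_subset [TotallyDisconnectedSpace X] [Infinite X]
    (hT : IsMinimalAct (zAct T))
    (hue : ∀ ν : Measure X, IsProbabilityMeasure ν → MeasurePreserving T ν ν → ν = μ)
    {A B : Set X} (hA : IsClopen A) (hB : IsClopen B) (hAB : μ.real A < μ.real B) :
    ∃ g ∈ fullGroup T, g '' A ⊆ B := by
  classical
  obtain ⟨H, hH⟩ := exists_visits_le hue hA hB hAB
  obtain ⟨C₀, -, hC₀⟩ := exists_castle hT H
  let f : X → Bool × Bool := fun x => (decide (x ∈ A), decide (x ∈ B))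
  have hloc : ∀ {D : Set X}, IsClopen D → IsLocallyConstant fun x => decide (x ∈ D) := by
    intro D hD
    refine (IsLocallyConstant.iff_eventually_eq _).2 fun x => ?_
    by_cases hx : x ∈ D
    · filter_upwards [hD.isOpen.mem_nhds hx] with y hy
      simp [hx, hy]
    · filter_upwards [hD.compl.isOpen.mem_nhds hx] with y hy
      have : y ∉ D := hy
      simp [hx, this]
  have hf : IsLocallyConstant f := (hloc hA).prodMk (hloc hB)
  let C := C₀.refine hf
  have hCf : ∀ x, f x = (C.loc x).1.2 (C.loc x).2 := C₀.refine_apply hf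
  have hvis : ∀ (D : Set X) (n : ℕ) (x : X), visits T D n x =
      (Finset.univ.filter fun j : Fin n => (T ^ ((j : ℕ) : ℤ)) x ∈ D).card := by
    intro D n x
    rw [visits, Finset.card_filter, Finset.card_filter]
    exact (Fin.sum_univ_eq_sum_range (fun j : ℕ => if (T ^ (j : ℤ)) x ∈ D then 1 else 0) n).symm
  have hρ : ∀ i : C.ι, ∃ ρ : Equiv.Perm (Fin (C.ht i + 1)), (C.base i).Nonempty →
      ∀ j, (i.2 j).1 = true → (i.2 (ρ j)).2 = true := by
    intro i
    by_cases hne : (C.base i).Nonempty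
    · obtain ⟨w, hw⟩ := hne
      have hle := hH (C.ht i + 1) (hC₀ i.1) w
      rw [hvis, hvis] at hle
      have hw' : ∀ j : Fin (C.ht i + 1), f ((T ^ ((j : ℕ) : ℤ)) w) = i.2 j := hw.2
      obtain ⟨ρ, hρ⟩ := exists_perm_mapsTo hle
      refine ⟨ρ, fun _ j hj => ?_⟩
      have h₁ := hρ j (Finset.mem_filter.2 ⟨Finset.mem_univ _, by
        rw [← hw' j] at hj; simpa [f] using hj⟩)
      rw [← hw' (ρ j)]
      simpa [f] using (Finset.mem_filter.1 h₁).2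
    · exact ⟨1, fun h => absurd h hne⟩
  choose ρ hρ using hρ
  refine ⟨C.permHom ρ, ?_, ?_⟩
  · exact C.permHom_mem_fullGroup ρ
  · rintro _ ⟨x, hx, rfl⟩
    have h₁ : (f x).1 = true := by simpa [f] using hx
    rw [hCf] at h₁
    have h₂ := hρ _ ⟨_, C.loc_mem x⟩ _ h₁
    have h₃ : (f (C.permHom ρ x)).2 = true := by
      rw [hCf, C.loc_permHom]; exact h₂
    simpa [f] using h₃

/-- A clopen subset `A` of `W` has `N` pairwise disjoint copies in `W` if `N μ(A) < μ(W)`. -/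
theorem exists_disjoint_copies [TotallyDisconnectedSpace X] [Infinite X]
    [IsProbabilityMeasure μ] (hT : IsMinimalAct (zAct T)) (hμ : MeasurePreserving T μ μ)
    (hue : ∀ ν : Measure X, IsProbabilityMeasure ν → MeasurePreserving T ν ν → ν = μ)
    {A W : Set X} (hA : IsClopen A) (hW : IsClopen W) (hAW : A ⊆ W) (N : ℕ)
    (hN : N * μ.real A < μ.real W) :
    ∃ g : ℕ → X ≃ₜ X, g 0 = 1 ∧ (∀ i, g i ∈ fullGroup T) ∧ (∀ i < N, g i '' A ⊆ W) ∧
      ∀ i < N, ∀ j < N, i ≠ j → Disjoint (g i '' A) (g j '' A) := by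
  classical
  induction N with
  | zero => exact ⟨fun _ => 1, rfl, fun _ => one_mem _, by simp, by simp⟩
  | succ N ih =>
    push_cast at hN
    have hA0 : 0 ≤ μ.real A := measureReal_nonneg
    obtain ⟨g, hg0, hg, hgW, hgd⟩ := ih (by linarith)
    rcases Nat.eq_zero_or_pos N with rfl | hpos
    · refine ⟨g, hg0, hg, fun i hi => ?_, fun i hi j hj hij => by omega⟩
      obtain rfl : i = 0 := by omega
      rw [hg0]; rintro _ ⟨x, hx, rfl⟩; exact hAW hx
    let D : Set X := ⋃ i ∈ Finset.range N, g i '' A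
    have hgA : ∀ i, IsClopen (g i '' A) := fun i =>
      ⟨(g i).isClosed_image.2 hA.isClosed, (g i).isOpen_image.2 hA.isOpen⟩
    have hD : IsClopen D := isClopen_biUnion_finset fun i _ => hgA i
    have hDμ : μ.real D ≤ N * μ.real A := by
      refine (measureReal_biUnion_finset_le _ _).trans ?_
      have : ∀ i ∈ Finset.range N, μ.real (g i '' A) = μ.real A := fun i _ => by
        rw [measureReal_def, measure_image_eq (measurePreserving_of_mem_fullGroup hμ (hg i))]; rfl
      rw [Finset.sum_congr rfl this]
      simp
    have hlt : μ.real A < μ.real (W \ D) := by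
      have := measureReal_mono (μ := μ) (subset_sdiff_union W D)
      have := this.trans (measureReal_union_le _ _)
      linarith
    obtain ⟨g', hg', hsub⟩ := exists_fullGroup_image_subset hT hue hA (hW.diff hD) hlt
    have hdisj : ∀ i < N, Disjoint (g i '' A) (g' '' A) := fun i hi =>
      disjoint_left.2 fun x hx hx' => (hsub hx').2 (mem_iUnion₂.2 ⟨i, Finset.mem_range.2 hi, hx⟩)
    refine ⟨Function.update g N g', ?_, fun i => ?_, fun i hi => ?_, fun i hi j hj hij => ?_⟩
    · rw [Function.update_of_ne hpos.ne, hg0]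
    · by_cases h : i = N
      · subst h; simpa using hg'
      · rw [Function.update_of_ne h]; exact hg i
    · by_cases h : i = N
      · subst h; rw [Function.update_self]; exact hsub.trans sdiff_subset
      · rw [Function.update_of_ne h]; exact hgW i (by omega)
    · by_cases h : i = N
      · subst h
        rw [Function.update_self, Function.update_of_ne hij.symm]
        exact (hdisj j (by omega)).symm
      · rw [Function.update_of_ne h]
        by_cases h' : j = N
        · subst h'; rw [Function.update_self]; exact hdisj i (by omega)
        · rw [Function.update_of_ne h']; exact hgd i (by omega) j (by omega) hij

end Comparison

section Arithmetic

theorem one_lt_add_of_tower_bounds {L M q H δ w t : ℝ} (hL : 1 ≤ L) (hM : 0 ≤ M)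
    (hq : 8 * M + 1 ≤ q) (hδ : 0 < δ) (hδL : δ * L = 1 / 20) (hH : H = L * (q + 2 * M) + 2 * M)
    (hw : 1 - δ ≤ H * w) (ht : (1 - 2 * δ) * w < t) :
    1 < t * (L * (q + 2 * M)) + 2 / 3 * q * t := by
  have hδ1 : δ ≤ 1 / 20 := by nlinarith
  have hLM : M ≤ L * M := le_mul_of_one_le_left hM hL
  have hLq : q ≤ L * q := le_mul_of_one_le_left (by linarith) hL
  have hH0 : 0 < H := by rw [hH]; linarith
  have hK : H ≤ (1 - 3 * δ) * (L * (q + 2 * M) + 2 / 3 * q) := by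
    have e₁ : 3 * δ * (L * (q + 2 * M)) = 3 / 20 * (q + 2 * M) := by
      linear_combination (3 * (q + 2 * M)) * hδL
    have e₂ : δ * q ≤ 1 / 20 * q := mul_le_mul_of_nonneg_right hδ1 (by linarith)
    linarith
  have h₁ : 1 - 3 * δ < t * H := by
    have h₂ : (1 - 2 * δ) * (1 - δ) ≤ (1 - 2 * δ) * (H * w) :=
      mul_le_mul_of_nonneg_left hw (by linarith)
    have h₃ : (1 - 2 * δ) * w * H < t * H := mul_lt_mul_of_pos_right ht hH0
    linarith [sq_nonneg δ]
  have hK0 : 0 < L * (q + 2 * M) + 2 / 3 * q := by linarith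
  have h₂ := mul_lt_mul_of_pos_right h₁ hK0
  have h₃ : 1 * H < t * (L * (q + 2 * M) + 2 / 3 * q) * H := by linarith
  have := lt_of_mul_lt_mul_right h₃ hH0.le
  linarith

theorem boundary_lt_of_tower_bounds {L M q δ : ℝ} (hM : 0 ≤ M)
    (hq : 40 * L ^ 2 * M < q) (hδ : 0 < δ) (hδL : δ * L = 1 / 20) :
    2 * (L * M) < (q + 2 * M) * δ := by
  have h₁ : 40 * L ^ 2 * M * δ < q * δ := mul_lt_mul_of_pos_right hq hδ
  have h₂ : 40 * L ^ 2 * M * δ = 2 * (L * M) := by linear_combination (40 * L * M) * hδL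
  have h₃ : 0 ≤ M * δ := by positivity
  linarith

end Arithmetic

section Array

variable {X : Type*} [TopologicalSpace X]

/-- A square array of partial towers for `T`: the towers `⋃ j ∈ J, T ^ j (g p (A))` over
translates of a clopen set `A`, with inner levels `I ⊆ J` that remain in `J` under displacements
by at most `M`, and with the comparison properties required for square divisibility. -/
structure SquareArray (T : X ≃ₜ X) (O₁ O₂ : Set X) (M : ℕ) where
  m : ℕ
  H : ℕ
  J : Finset ℕ
  I : Finset ℕ
  A : Set X
  g : Fin (m + 1) × Fin (m + 1) → X ≃ₜ X
  isClopen_A : IsClopen A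
  g_zero : g (0, 0) = 1
  g_mem : ∀ p, g p ∈ fullGroup T
  unique : ∀ x, ∀ j < H, ∀ k < H, ∀ p q, (T ^ (-(j : ℤ))) x ∈ g p '' A →
    (T ^ (-(k : ℤ))) x ∈ g q '' A → j = k ∧ p = q
  subset : I ⊆ J
  margin : ∀ j ∈ J, M ≤ j ∧ j + M < H
  inner : ∀ j ∈ I, ∀ k : ℤ, k.natAbs ≤ M → ∃ l ∈ J, (l : ℤ) = j + k
  column : ∀ i, ∃ h ∈ fullGroup T, h '' tower T J (g (i, 0) '' A) ⊆
    O₁ ∩ ⋃ j ∈ {j | j ≠ 0}, tower T I (g (i, j) '' A)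
  rest : ∃ h ∈ fullGroup T, h '' (⋃ p, tower T J (g p '' A))ᶜ ⊆
    O₂ ∩ ⋃ i, ⋃ j ∈ {j | j ≠ 0}, tower T I (g (i, j) '' A)
  boundary : ∃ h ∈ fullGroup T, h '' (⋃ p, tower T (J \ I) (g p '' A)) ⊆
    O₂ ∩ (⋃ p, tower T J (g p '' A))ᶜ

theorem isClopen_image {A : Set X} (hA : IsClopen A) (g : X ≃ₜ X) : IsClopen (g '' A) :=
  ⟨g.isClosed_image.2 hA.isClosed, g.isOpen_image.2 hA.isOpen⟩

variable [CompactSpace X] [TopologicalSpace.MetrizableSpace X] [TotallyDisconnectedSpace X]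
  [Infinite X] [MeasurableSpace X] [BorelSpace X] {T : X ≃ₜ X} {μ : Measure X}
  [IsProbabilityMeasure μ]

omit [CompactSpace X] [TopologicalSpace.MetrizableSpace X] [TotallyDisconnectedSpace X]
  [Infinite X] in
theorem measureReal_biUnion_tower_ge (hμ : MeasurePreserving T μ μ) {ι : Type*} {W : ι → Set X}
    {H L M q : ℕ} {v : ℝ} {O : Set X} (hW : ∀ p, IsClopen (W p)) (hv : ∀ p, μ.real (W p) = v)
    (hu : ∀ x, ∀ j < H, ∀ k < H, ∀ p q, (T ^ (-(j : ℤ))) x ∈ W p → (T ^ (-(k : ℤ))) x ∈ W q →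
      j = k ∧ p = q)
    (hO : IsClopen O) (hL : ∀ x, ∃ j < L, (T ^ (j : ℤ)) x ∈ O) (hH : M + L * q ≤ H)
    (S : Finset ι) :
    S.card * (q * v) ≤
      μ.real (⋃ p ∈ S, tower T (Finset.Ico M (M + L * q)) (W p) ∩ O) := by
  rw [measureReal_biUnion_finset]
  · rw [← nsmul_eq_mul, ← Finset.sum_const]
    refine Finset.sum_le_sum fun p _ => ?_
    rw [← hv p]
    exact mul_measureReal_le_tower_inter hμ
      (fun x j hj k hk h₁ h₂ => (hu x j hj k hk p p h₁ h₂).1) (hW p) hO hL hH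
  · intro p _ r _ hpr
    refine disjoint_left.2 ?_
    rintro x ⟨⟨j, hj, h₁⟩, -⟩ ⟨⟨k, hk, h₂⟩, -⟩
    have := Finset.mem_Ico.1 hj
    have := Finset.mem_Ico.1 hk
    exact hpr (hu x j (by omega) k (by omega) p r h₁ h₂).2
  · intro p _
    exact ((isClopen_tower _ (hW p)).inter hO).isOpen.measurableSet

theorem exists_squareArray (hT : IsMinimalAct (zAct T)) (hμ : MeasurePreserving T μ μ)
    (hue : ∀ ν : Measure X, IsProbabilityMeasure ν → MeasurePreserving T ν ν → ν = μ)
    {O₁ O₂ : Set X} (hO₁ : IsClopen O₁) (hO₂ : IsClopen O₂) (hne₁ : O₁.Nonempty)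
    (hne₂ : O₂.Nonempty) (M : ℕ) : Nonempty (SquareArray T O₁ O₂ M) := by
  classical
  obtain ⟨L, hL1, hL₁, hL₂⟩ : ∃ L : ℕ, 1 ≤ L ∧ (∀ x, ∃ j < L, (T ^ (j : ℤ)) x ∈ O₁) ∧
      ∀ x, ∃ j < L, (T ^ (j : ℤ)) x ∈ O₂ := by
    obtain ⟨K₁, hK₁⟩ := exists_return_bound hT hO₁.isOpen hne₁
    obtain ⟨K₂, hK₂⟩ := exists_return_bound hT hO₂.isOpen hne₂
    refine ⟨max 1 (max K₁ K₂), by simp, fun x => ?_, fun x => ?_⟩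
    · obtain ⟨j, hj, h⟩ := (hK₁ x).1
      exact ⟨j, hj.trans_le (by simp), h⟩
    · obtain ⟨j, hj, h⟩ := (hK₂ x).1
      exact ⟨j, hj.trans_le (by simp), h⟩
  let q' := 40 * L ^ 2 * M + 1 + 8 * M
  let q := q' + 2 * M
  let H := L * q + 2 * M
  have hHpos : 0 < H := by
    have : 0 < L * q := Nat.mul_pos hL1 (by omega)
    omega
  have hL1' : (1 : ℝ) ≤ L := by exact_mod_cast hL1
  set δ : ℝ := 1 / (20 * L) with hδ
  have hδL : δ * L = 1 / 20 := by rw [hδ]; field_simp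
  have hδ0 : 0 < δ := by positivity
  have hδ1 : δ ≤ 1 / 20 := by nlinarith
  obtain ⟨W, hW, hWb, hWμ⟩ := exists_rokhlin hT hμ hHpos hδ0
  set w := μ.real W with hw
  have hH0 : (0 : ℝ) < H := by exact_mod_cast hHpos
  have hw0 : 0 < w := by
    by_contra hcon
    linarith [mul_nonpos_of_nonneg_of_nonpos hH0.le (not_lt.1 hcon)]
  let n := 2 * L + 1
  have hn0 : (0 : ℝ) < (n : ℝ) ^ 2 := by positivity
  have hn1 : (1 : ℝ) ≤ (n : ℝ) ^ 2 := by
    exact one_le_pow₀ (by exact_mod_cast (by omega : 1 ≤ n))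
  obtain ⟨A, hAW, hA, hv₁, hv₂⟩ := exists_clopen_subset_measureReal hT hμ hW
    (a := (1 - 2 * δ) * w / n ^ 2) (b := (1 - δ) * w / n ^ 2)
    (div_nonneg (mul_nonneg (by linarith) hw0.le) hn0.le)
    (div_lt_div_of_pos_right (mul_lt_mul_of_pos_right (by linarith) hw0) hn0)
    ((div_le_self (mul_nonneg (by linarith) hw0.le) hn1).trans
      (mul_le_of_le_one_left hw0.le (by linarith)))
  set v := μ.real A with hv
  rw [div_lt_iff₀ hn0] at hv₁
  rw [lt_div_iff₀ hn0] at hv₂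
  obtain ⟨g₀, hg₀, hgm, hgW, hgd⟩ := exists_disjoint_copies hT hμ hue hA hW hAW (n * n) (by
    push_cast
    rw [← sq, mul_comm]
    exact hv₂.trans_le (mul_le_of_le_one_left hw0.le (by linarith)))
  let idx : Fin (2 * L + 1) × Fin (2 * L + 1) → Fin ((2 * L + 1) * (2 * L + 1)) :=
    finProdFinEquiv
  let g : Fin (2 * L + 1) × Fin (2 * L + 1) → X ≃ₜ X := fun p => g₀ (idx p)
  have hgA : ∀ p, IsClopen (g p '' A) := fun p => isClopen_image hA _
  have hgμ : ∀ p, μ.real (g p '' A) = v := fun p => by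
    rw [measureReal_def, measure_image_eq (measurePreserving_of_mem_fullGroup hμ (hgm _))]; rfl
  have hgW' : ∀ p, g p '' A ⊆ W := fun p => hgW _ (idx p).2
  have hu : ∀ x, ∀ j < H, ∀ k < H, ∀ p r, (T ^ (-(j : ℤ))) x ∈ g p '' A →
      (T ^ (-(k : ℤ))) x ∈ g r '' A → j = k ∧ p = r := by
    intro x j hj k hk p r h₁ h₂
    have hjk := hWb x j hj k hk (hgW' p h₁) (hgW' r h₂)
    subst hjk
    refine ⟨rfl, ?_⟩
    by_contra hpr
    refine disjoint_left.1 (hgd _ (idx p).2 _ (idx r).2 fun h => hpr ?_) h₁ h₂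
    exact finProdFinEquiv.injective (Fin.ext h)
  let J := Finset.Ico M (M + L * q)
  let I := Finset.Ico (2 * M) (2 * M + L * q')
  have hLM : M ≤ L * M := Nat.le_mul_of_pos_left M hL1
  have hLq : L * q = L * q' + 2 * (L * M) := by simp only [q]; ring
  have hIJ : I ⊆ J := by
    intro j hj
    have := Finset.mem_Ico.1 hj
    exact Finset.mem_Ico.2 ⟨by omega, by omega⟩
  have hJH : ∀ j ∈ J, j < H := fun j hj => by have := Finset.mem_Ico.1 hj; omega
  have htower : ∀ (K : Finset ℕ), K ⊆ J → ∀ p, μ.real (tower T K (g p '' A)) = K.card * v := by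
    intro K hK p
    rw [measureReal_tower hμ (H := H) (fun x j hj k hk h₁ h₂ => (hu x j hj k hk p p h₁ h₂).1)
      (hgA p) (fun j hj => hJH j (hK hj)), hgμ]
  have hdisj : ∀ (K : Finset ℕ), K ⊆ J → Pairwise fun p r =>
      Disjoint (tower T K (g p '' A)) (tower T K (g r '' A)) := by
    intro K hK p r hpr
    refine disjoint_left.2 ?_
    rintro x ⟨j, hj, h₁⟩ ⟨k, hk, h₂⟩
    exact hpr (hu x j (hJH j (hK hj)) k (hJH k (hK hk)) p r h₁ h₂).2
  have hunion : ∀ (K : Finset ℕ), K ⊆ J →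
      μ.real (⋃ p, tower T K (g p '' A)) = n ^ 2 * (K.card * v) := by
    intro K hK
    have := measureReal_biUnion_finset (μ := μ) (s := Finset.univ)
      (f := fun p => tower T K (g p '' A)) (fun p _ r _ hpr => hdisj K hK hpr)
      (fun p _ => (isClopen_tower _ (hgA p)).isOpen.measurableSet)
    simp only [Finset.mem_univ, iUnion_true] at this
    rw [this, Finset.sum_congr rfl fun p _ => htower K hK p]
    rw [Finset.sum_const, Finset.card_univ, Fintype.card_prod, Fintype.card_fin, nsmul_eq_mul]
    push_cast [n]
    ring
  have hunionc : ∀ K : Finset ℕ, IsClopen (⋃ p, tower T K (g p '' A)) := fun K =>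
    isClopen_iUnion_of_finite fun p => isClopen_tower _ (hgA p)
  have hlow : ∀ {O : Set X}, IsClopen O → (∀ x, ∃ j < L, (T ^ (j : ℤ)) x ∈ O) →
      ∀ S : Finset (Fin (2 * L + 1) × Fin (2 * L + 1)),
      S.card * (q' * v) ≤ μ.real (⋃ p ∈ S, tower T I (g p '' A) ∩ O) := by
    intro O hO hLO S
    exact measureReal_biUnion_tower_ge hμ hgA hgμ hu hO hLO (by omega) S
  have hJc : J.card = L * q := by simp [J]
  have hDc : (J \ I).card = 2 * (L * M) := by
    rw [Finset.card_sdiff_of_subset hIJ, hJc, hLq]; simp [I]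
  have hq'M : (8 : ℝ) * M + 1 ≤ q' := by
    have : 8 * M + 1 ≤ q' := by simp only [q']; omega
    exact_mod_cast this
  have hq'M2 : (40 : ℝ) * L ^ 2 * M < q' := by
    have : 40 * L ^ 2 * M < q' := by simp only [q']; omega
    exact_mod_cast this
  have hqq : (q : ℝ) = q' + 2 * M := by simp [q]
  have hM0 : (0 : ℝ) ≤ M := Nat.cast_nonneg M
  have hv0 : 0 < v := by
    refine pos_of_mul_pos_left (lt_trans (mul_pos ?_ hw0) hv₁) hn0.le
    linarith
  have hnn : (n : ℝ) = 2 * L + 1 := by simp [n]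
  have hHH : (H : ℝ) = L * q + 2 * M := by simp [H]
  refine ⟨⟨2 * L, H, J, I, A, g, hA, ?_, fun p => hgm _, hu, hIJ, ?_, ?_, fun i => ?_, ?_, ?_⟩⟩
  · show g₀ _ = 1
    rw [← hg₀]
    simp [idx, finProdFinEquiv]
  · intro j hj
    have := Finset.mem_Ico.1 hj
    exact ⟨this.1, by omega⟩
  · intro j hj k hk
    have := Finset.mem_Ico.1 hj
    exact ⟨(j + k).toNat, Finset.mem_Ico.2 ⟨by omega, by omega⟩, by omega⟩
  · refine exists_fullGroup_image_subset hT hue (isClopen_tower _ (hgA _))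
      (hO₁.inter ((toFinite _).isClopen_biUnion fun j _ => isClopen_tower _ (hgA _))) ?_
    have h := hlow hO₁ hL₁ (({i} : Finset _) ×ˢ Finset.univ.erase 0)
    rw [Finset.card_product, Finset.card_singleton, Finset.card_erase_of_mem (Finset.mem_univ _),
      Finset.card_univ, Fintype.card_fin, one_mul, Nat.add_sub_cancel] at h
    rw [htower J subset_rfl, hJc]
    refine lt_of_lt_of_le ?_ (h.trans (measureReal_mono ?_ (measure_ne_top _ _)))
    · push_cast
      rw [hqq, ← mul_assoc]
      refine mul_lt_mul_of_pos_right ?_ hv0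
      have : (L : ℝ) * (4 * M) < L * q' := mul_lt_mul_of_pos_left (by linarith) (by linarith)
      have : 0 ≤ (L : ℝ) * M := by positivity
      linarith
    · refine iUnion₂_subset fun p hp x hx => ⟨hx.2, ?_⟩
      rw [Finset.mem_product, Finset.mem_singleton, Finset.mem_erase] at hp
      refine mem_iUnion₂.2 ⟨p.2, hp.2.1, ?_⟩
      rw [← hp.1]
      exact hx.1
  · refine exists_fullGroup_image_subset hT hue (hunionc J).compl
      (hO₂.inter (isClopen_iUnion_of_finite fun i =>
        (toFinite _).isClopen_biUnion fun j _ => isClopen_tower _ (hgA _))) ?_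
    have h := hlow hO₂ hL₂ (Finset.univ ×ˢ Finset.univ.erase 0)
    rw [Finset.card_product, Finset.card_erase_of_mem (Finset.mem_univ _),
      Finset.card_univ, Fintype.card_fin, Nat.add_sub_cancel] at h
    rw [probReal_compl_eq_one_sub (hunionc J).isOpen.measurableSet, hunion J subset_rfl, hJc]
    refine lt_of_lt_of_le ?_ (h.trans (measureReal_mono ?_ (measure_ne_top _ _)))
    · push_cast
      rw [← hnn]
      have ht := one_lt_add_of_tower_bounds hL1' hM0 hq'M hδ0 hδL (hHH.trans (by rw [hqq])) hWμ
        hv₁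
      have hnb : 2 / 3 * (n : ℝ) ^ 2 ≤ n * (2 * L) := by rw [hnn]; linarith [mul_nonneg (sub_nonneg.2 hL1') (sub_nonneg.2 hL1')]
      have := mul_le_mul_of_nonneg_right hnb (mul_nonneg (Nat.cast_nonneg q') hv0.le)
      rw [hqq]
      linarith
    · refine iUnion₂_subset fun p hp x hx => ⟨hx.2, ?_⟩
      rw [Finset.mem_product, Finset.mem_erase] at hp
      exact mem_iUnion.2 ⟨p.1, mem_iUnion₂.2 ⟨p.2, hp.2.1, hx.1⟩⟩
  · refine exists_fullGroup_image_subset hT hue (hunionc _)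
      (hO₂.inter (hunionc J).compl) ?_
    have hW' : IsClopen (W \ ⋃ p, g p '' A) :=
      hW.diff (isClopen_iUnion_of_finite hgA)
    have hWμ' : w - n ^ 2 * v ≤ μ.real (W \ ⋃ p, g p '' A) := by
      have h1 : μ.real (⋃ p, g p '' A) ≤ n ^ 2 * v := by
        refine (measureReal_iUnion_fintype_le _).trans ?_
        simp [hgμ, n]
        exact le_of_eq (by ring)
      have := (measureReal_mono (μ := μ) (subset_sdiff_union W (⋃ p, g p '' A))
        (measure_ne_top _ _)).trans (measureReal_union_le _ _)
      linarith
    have h := mul_measureReal_le_tower_inter hμ (hWb.mono sdiff_subset) hW' hO₂ hL₂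
      (M := M) (q := q) (by omega)
    rw [hunion _ Finset.sdiff_subset, hDc]
    refine lt_of_lt_of_le ?_ (h.trans (measureReal_mono ?_ (measure_ne_top _ _)))
    · refine lt_of_lt_of_le ?_ (mul_le_mul_of_nonneg_left hWμ' (Nat.cast_nonneg q))
      push_cast
      have h1 : δ * w ≤ w - n ^ 2 * v := by linarith
      have h2 : (q : ℝ) * (δ * w) ≤ q * (w - n ^ 2 * v) := by gcongr
      refine lt_of_lt_of_le ?_ h2
      have h3 : (n : ℝ) ^ 2 * (2 * (L * M) * v) ≤ 2 * (L * M) * w := by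
        have : (n : ℝ) ^ 2 * v ≤ w := by linarith [mul_pos hδ0 hw0]
        have := mul_le_mul_of_nonneg_left this (by positivity : (0 : ℝ) ≤ 2 * (L * M))
        linarith
      refine lt_of_le_of_lt h3 ?_
      rw [← mul_assoc (q : ℝ)]
      refine mul_lt_mul_of_pos_right ?_ hw0
      rw [hqq]
      exact boundary_lt_of_tower_bounds hM0 hq'M2 hδ0 hδL
    · rintro x ⟨⟨j, hj, hx⟩, hxO⟩
      refine ⟨hxO, fun hmem => ?_⟩
      obtain ⟨p, k, hk, hxk⟩ := mem_iUnion.1 hmem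
      have hjk := hWb x j (hJH j hj) k (hJH k hk) hx.1 (hgW' p hxk)
      subst hjk
      exact hx.2 (mem_iUnion.2 ⟨p, hxk⟩)

end Array

section Pullback

variable {G X Z : Type*} [Group G] [TopologicalSpace X] [TopologicalSpace Z] {α : Act G X}
  {β : Act G Z} {p : Z → X}

theorem Subequiv.mono {A A' B B' : Set Z} (h : Subequiv β A B) (hA : A' ⊆ A) (hB : B ⊆ B') :
    Subequiv β A' B' := by
  obtain ⟨n, U, s, hU, hcov, hsub, hd⟩ := h
  exact ⟨n, U, s, hU, hA.trans hcov, fun i => (hsub i).trans hB, hd⟩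

theorem subequiv_of_fullGroup [CompactSpace X] (hp : Continuous p)
    (hequi : ∀ s z, p (β s z) = α s (p z)) {a : G} {g : X ≃ₜ X} (hg : g ∈ fullGroup (α a))
    {A B : Set X} (hA : IsOpen A) (hAB : g '' A ⊆ B) : Subequiv β (p ⁻¹' A) (p ⁻¹' B) := by
  obtain ⟨c, hc, hgc⟩ := hg
  have hfin : (range c).Finite := hc.range_finite
  have := hfin.fintype
  let e := (Fintype.equivFin (range c)).symm
  have himg : ∀ i z, c (p z) = (e i : ℤ) → p (β (a ^ (e i : ℤ)) z) = g (p z) := by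
    intro i z hz
    rw [hequi, map_zpow, hgc, hz]
  refine ⟨Fintype.card (range c), fun i => p ⁻¹' (A ∩ c ⁻¹' {(e i : ℤ)}), fun i => a ^ (e i : ℤ),
    fun i => (hA.inter (hc _)).preimage hp, fun z hz => ?_, fun i => ?_, fun i j hij => ?_⟩
  · refine mem_iUnion.2 ⟨e.symm ⟨c (p z), mem_range_self _⟩, hz, ?_⟩
    simp
  · rintro _ ⟨z, ⟨hz, hzc⟩, rfl⟩
    rw [mem_preimage, himg i z hzc]
    exact hAB ⟨_, hz, rfl⟩
  · refine disjoint_left.2 ?_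
    rintro _ ⟨z, ⟨hz, hzc⟩, rfl⟩ ⟨z', ⟨hz', hzc'⟩, he⟩
    have := congrArg p he
    rw [himg i z hzc, himg j z' hzc'] at this
    have := g.injective this
    have hzc₁ : c (p z) = (e i : ℤ) := hzc
    have hzc₂ : c (p z') = (e j : ℤ) := hzc'
    rw [← this, hzc₂] at hzc₁
    exact hij (e.injective (Subtype.ext hzc₁)).symm

theorem pairwiseEquivalent_of_fintype {ι κ : Type*} [Fintype κ] {m₀ : ι} {V : ι → Set Z}
    (C : κ → Set Z) (s : κ → ι → G) (hC : ∀ k, IsClopen (C k)) (hs : ∀ k, s k m₀ = 1)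
    (hV : ∀ m, V m = ⋃ k, β (s k m) '' C k)
    (hd : ∀ k l m n z, z ∈ β (s k m) '' C k → z ∈ β (s l n) '' C l → k = l ∧ m = n) :
    PairwiseEquivalent β m₀ V := by
  let e := (Fintype.equivFin κ).symm
  refine ⟨Fintype.card κ, fun k => C (e k), fun k => s (e k), fun k => ?_, fun k => hs _, ?_,
    fun m => ?_, fun q r hqr => ?_⟩
  · exact MeasurableSpace.measurableSet_generateFrom (hC _).isOpen
  · rw [hV m₀, ← e.surjective.iUnion_comp]
    refine iUnion_congr fun k => ?_
    rw [hs, map_one]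
    exact image_id _
  · rw [hV m, ← e.surjective.iUnion_comp]
  · show Disjoint (closure (β (s (e q.1) q.2) '' C (e q.1)))
      (closure (β (s (e r.1) r.2) '' C (e r.1)))
    rw [(isClopen_image (hC _) _).isClosed.closure_eq,
      (isClopen_image (hC _) _).isClosed.closure_eq]
    refine disjoint_left.2 fun z h₁ h₂ => hqr ?_
    obtain ⟨h, h'⟩ := hd _ _ _ _ z h₁ h₂
    exact Prod.ext (e.injective h) h'

theorem SquareArray.squarelyDivisibleBy [CompactSpace X] (hp : Continuous p)
    (hequi : ∀ s z, p (β s z) = α s (p z)) {a : G} {O₁ O₂ : Set X} {M : ℕ}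
    (S : SquareArray (α a) O₁ O₂ M) {E : Finset G}
    (hE : ∀ s ∈ E, ∀ x, ∃ k : ℤ, k.natAbs ≤ M ∧ α s x = (α a ^ k) x) :
    SquarelyDivisibleBy β (p ⁻¹' O₁) (p ⁻¹' O₂) E := by
  classical
  let W : Fin (S.m + 1) × Fin (S.m + 1) → Set X := fun q => S.g q '' S.A
  have hW : ∀ q, IsClopen (W q) := fun q => isClopen_image S.isClopen_A _
  have hVc : ∀ K q, IsClopen (p ⁻¹' tower (α a) K (W q)) := fun K q =>
    (isClopen_tower K (hW q)).preimage hp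
  have hJ : ∀ j ∈ S.J, j < S.H := fun j hj => by have := S.margin j hj; omega
  have hpow : ∀ (k : ℤ) z, p (β (a ^ k) z) = (α a ^ k) (p z) := fun k z => by
    rw [hequi, map_zpow]
  -- the whole array
  have hVall : (⋃ i, ⋃ j, p ⁻¹' tower (α a) S.J (W (i, j))) =
      p ⁻¹' ⋃ q, tower (α a) S.J (W q) := by
    rw [preimage_iUnion, iUnion_prod']
  have hVallc : IsClopen (⋃ i, ⋃ j, p ⁻¹' tower (α a) S.J (W (i, j))) :=
    isClopen_iUnion_of_finite fun i => isClopen_iUnion_of_finite fun j => hVc _ _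
  have hcol : ∀ K, (⋃ i, ⋃ j ∈ {j : Fin (S.m + 1) | j ≠ 0}, p ⁻¹' tower (α a) K (W (i, j))) =
      p ⁻¹' ⋃ i, ⋃ j ∈ {j : Fin (S.m + 1) | j ≠ 0}, tower (α a) K (W (i, j)) := by
    intro K; simp only [preimage_iUnion]
  refine ⟨S.m, fun i j => p ⁻¹' tower (α a) S.J (W (i, j)), ∅, fun i j => (hVc _ _).isOpen,
    ?_, ?_, ?_⟩
  · choose c hc hgc using fun q => mem_fullGroup.1 (S.g_mem q)
    let d : X → Fin (S.m + 1) × Fin (S.m + 1) → ℤ := fun x q => if q = (0, 0) then 0 else c q x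
    have hd : IsLocallyConstant d := by
      refine (IsLocallyConstant.iff_eventually_eq _).2 fun x => ?_
      have : ∀ᶠ y in 𝓝 x, ∀ q, c q y = c q x :=
        eventually_all.2 fun q => (IsLocallyConstant.iff_eventually_eq _).1 (hc q) x
      filter_upwards [this] with y hy
      funext q
      simp only [d, hy]
    have hgd : ∀ q x, S.g q x = (α a ^ d x q) x := by
      intro q x
      by_cases hq : q = (0, 0)
      · subst hq; simp [d, S.g_zero]
      · simp only [d, if_neg hq]; exact hgc q x
    have hfin : (range d).Finite := hd.range_finite
    have := hfin.fintype
    have hmem : ∀ (k : S.J × range d) q z,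
        z ∈ β (a ^ ((k.2 : Fin (S.m + 1) × Fin (S.m + 1) → ℤ) q)) ''
          (p ⁻¹' ((α a ^ (-((k.1 : ℕ) : ℤ))) ⁻¹' (S.A ∩ d ⁻¹' {(k.2 : _ → ℤ)}))) ↔
        ∃ y ∈ S.A, d y = k.2 ∧ (α a ^ (-((k.1 : ℕ) : ℤ))) (p z) = S.g q y := by
      intro k q z
      constructor
      · rintro ⟨z', ⟨h₁, h₂⟩, rfl⟩
        refine ⟨_, h₁, h₂, ?_⟩
        have h₂' : d ((α a ^ (-((k.1 : ℕ) : ℤ))) (p z')) = k.2 := h₂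
        rw [hgd, h₂', hpow, ← zpow_add_apply, ← zpow_add_apply, add_comm]
      · rintro ⟨y, hy, hdy, he⟩
        refine ⟨β (a ^ (-((k.2 : Fin (S.m + 1) × Fin (S.m + 1) → ℤ) q))) z, ?_, ?_⟩
        · have : (α a ^ (-((k.1 : ℕ) : ℤ)))
              (p (β (a ^ (-((k.2 : Fin (S.m + 1) × Fin (S.m + 1) → ℤ) q))) z)) = y := by
            rw [hpow, ← zpow_add_apply, add_comm, zpow_add_apply, he, hgd, hdy, ← zpow_add_apply]
            simp
          rw [mem_preimage, mem_preimage, this]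
          exact ⟨hy, hdy⟩
        · rw [← Homeomorph.mul_apply, ← map_mul, ← zpow_add]
          simp
    refine pairwiseEquivalent_of_fintype (κ := S.J × range d)
      (fun k => p ⁻¹' ((α a ^ (-((k.1 : ℕ) : ℤ))) ⁻¹' (S.A ∩ d ⁻¹' {(k.2 : _ → ℤ)})))
      (fun k q => a ^ ((k.2 : Fin (S.m + 1) × Fin (S.m + 1) → ℤ) q)) (fun k => ?_) (fun k => ?_)
      (fun q => ?_) ?_
    · exact ((S.isClopen_A.inter (hd.isClopen_fiber _)).preimage
        (Homeomorph.continuous _)).preimage hp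
    · obtain ⟨_, _, y, rfl⟩ := k
      simp [d]
    · ext z
      simp only [mem_iUnion, hmem]
      constructor
      · rintro ⟨j, hj, y, hy, he⟩
        exact ⟨⟨⟨j, hj⟩, ⟨d y, mem_range_self _⟩⟩, y, hy, rfl, he.symm⟩
      · rintro ⟨k, y, hy, -, he⟩
        exact ⟨k.1, k.1.2, y, hy, he.symm⟩
    · intro k l q r z h₁ h₂
      rw [hmem] at h₁ h₂
      obtain ⟨y, hy, hdy, he⟩ := h₁
      obtain ⟨y', hy', hdy', he'⟩ := h₂
      obtain ⟨hkl, hqr⟩ := S.unique (p z) k.1 (hJ _ k.1.2) l.1 (hJ _ l.1.2) q r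
        ⟨y, hy, he.symm⟩ ⟨y', hy', he'.symm⟩
      refine ⟨Prod.ext (Subtype.ext hkl) (Subtype.ext ?_), hqr⟩
      subst hqr
      rw [hkl, he'] at he
      rw [← hdy, ← hdy', (S.g q).injective he]
  · intro q r hqr
    refine disjoint_left.2 ?_
    have key : ∀ q z, z ∈ ⋃ s ∈ E, β s '' closure (p ⁻¹' tower (α a) S.J (W (q.1, q.2))) →
        ∃ j < S.H, (α a ^ (-(j : ℤ))) (p z) ∈ W q := by
      intro q z hz
      obtain ⟨s, hs, z', hz', rfl⟩ := mem_iUnion₂.1 hz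
      rw [(hVc _ _).isClosed.closure_eq] at hz'
      obtain ⟨j, hj, hjW⟩ := hz'
      obtain ⟨k, hk, hsk⟩ := hE s hs (p z')
      have := S.margin j hj
      refine ⟨(j + k).toNat, by omega, ?_⟩
      rw [hequi, hsk, ← zpow_add_apply, Int.toNat_of_nonneg (by omega)]
      have e : -((j : ℤ) + k) + k = -j := by ring
      rwa [e]
    intro z h₁ h₂
    obtain ⟨j, hj, h₁⟩ := key q z h₁
    obtain ⟨k, hk, h₂⟩ := key r z h₂
    exact hqr (S.unique (p z) j hj k hk q r h₁ h₂).2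
  · -- the boundary is contained in the outer levels
    have hB : closure (⋃ i, ⋃ j, p ⁻¹' tower (α a) S.J (W (i, j))) ∩
        (core β E ((⋃ i, ⋃ j, p ⁻¹' tower (α a) S.J (W (i, j))) ∩ (closure ∅)ᶜ))ᶜ ⊆
        p ⁻¹' ⋃ q, tower (α a) (S.J \ S.I) (W q) := by
      rw [hVallc.isClosed.closure_eq, closure_empty, compl_empty, inter_univ, hVall]
      rintro z ⟨hz, hcore⟩
      obtain ⟨q, j, hj, hjW⟩ := mem_iUnion.1 hz
      refine mem_iUnion.2 ⟨q, j, Finset.mem_sdiff.2 ⟨hj, fun hjI => hcore ?_⟩, hjW⟩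
      refine mem_iInter₂.2 fun s hs => ?_
      obtain ⟨k, hk, hsk⟩ := hE s hs (p z)
      obtain ⟨l, hl, hlk⟩ := S.inner j hjI k hk
      refine mem_iUnion.2 ⟨q, l, hl, ?_⟩
      rw [hequi, hsk, ← zpow_add_apply]
      have e : -(l : ℤ) + k = -j := by omega
      rwa [e]
    -- inner levels avoid the outer levels
    have hIout : ∀ q z, p z ∈ tower (α a) S.I (W q) →
        p z ∉ ⋃ q, tower (α a) (S.J \ S.I) (W q) := by
      rintro q z ⟨j, hj, hjW⟩ hz
      obtain ⟨r, k, hk, hkW⟩ := mem_iUnion.1 hz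
      have hk' := Finset.mem_sdiff.1 hk
      have := (S.unique (p z) j (hJ j (S.subset hj)) k (hJ k hk'.1) q r hjW hkW).1
      subst this
      exact hk'.2 hj
    have hIJ : ∀ q, tower (α a) S.I (W q) ⊆ tower (α a) S.J (W q) := by
      rintro q x ⟨j, hj, hjW⟩
      exact ⟨j, S.subset hj, hjW⟩
    refine ⟨isOpen_empty, ?_, fun i => ?_, ?_, ?_⟩
    · rw [hVallc.frontier_eq]
    · rw [(hVc _ _).isClosed.closure_eq]
      obtain ⟨h, hh, hsub⟩ := S.column i
      refine (subequiv_of_fullGroup hp hequi hh (isClopen_tower _ (hW _)).isOpen hsub).mono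
        subset_rfl ?_
      rintro z ⟨hz₁, hz₂⟩
      obtain ⟨j, hj, hz₂⟩ := mem_iUnion₂.1 hz₂
      exact ⟨⟨hz₁, mem_iUnion₂.2 ⟨j, hj, hIJ _ hz₂⟩⟩, fun hb => hIout _ z hz₂ (hB hb)⟩
    · obtain ⟨h, hh, hsub⟩ := S.rest
      rw [hVall] at hB ⊢
      refine (subequiv_of_fullGroup hp hequi hh (isClopen_iUnion_of_finite fun q =>
        isClopen_tower _ (hW q)).compl.isOpen hsub).mono subset_rfl ?_
      rintro z ⟨hz₁, hz₂⟩
      obtain ⟨i, hz₂⟩ := mem_iUnion.1 hz₂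
      obtain ⟨j, hj, hz₂⟩ := mem_iUnion₂.1 hz₂
      refine ⟨⟨hz₁, mem_iUnion.2 ⟨(i, j), hIJ _ hz₂⟩⟩, ?_⟩
      rintro (hV₁ | hb)
      · obtain ⟨i', k, hk, hkW⟩ := mem_iUnion.1 hV₁
        obtain ⟨l, hl, hlW⟩ := hz₂
        have := (S.unique (p z) k (hJ k hk) l (hJ l (S.subset hl)) _ _ hkW hlW).2
        exact hj (congrArg Prod.snd this).symm
      · exact hIout _ z hz₂ (hB hb)
    · obtain ⟨h, hh, hsub⟩ := S.boundary
      refine (subequiv_of_fullGroup hp hequi hh (isClopen_iUnion_of_finite fun q =>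
        isClopen_tower _ (hW q)).isOpen hsub).mono ?_ ?_
      · refine union_subset hB ?_
        rw [closure_empty, empty_inter]
        exact empty_subset _
      · rw [union_empty, hVallc.isClosed.closure_eq, hVall]
        exact subset_rfl

end Pullback

section Divisible

variable {G X Z : Type*} [Group G] [TopologicalSpace X] [TopologicalSpace Z] {α : Act G X}
  {β : Act G Z} {p : Z → X}

theorem exists_shift_bound [CompactSpace X] {T : X ≃ₜ X} (E : Finset G)
    (hα : ∀ s, α s ∈ fullGroup T) :
    ∃ M : ℕ, ∀ s ∈ E, ∀ x, ∃ k : ℤ, k.natAbs ≤ M ∧ α s x = (T ^ k) x := by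
  choose c hc hgc using fun s => mem_fullGroup.1 (hα s)
  have hfin : ∀ s, (range (c s)).Finite := fun s => (hc s).range_finite
  refine ⟨E.sup fun s => (hfin s).toFinset.sup Int.natAbs, fun s hs x => ⟨c s x, ?_, hgc s x⟩⟩
  exact (Finset.le_sup (f := Int.natAbs)
    ((hfin s).mem_toFinset.2 (mem_range_self x))).trans
    (Finset.le_sup (f := fun s => (hfin s).toFinset.sup Int.natAbs) hs)

/-- An action is squarely divisible if one of its elements `a` acts minimally and uniquely
ergodically on a zero-dimensional space, and there is a factor on which every element acts by
an element of the topological full group of `a`. -/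
theorem squarelyDivisible_of_factor [CompactSpace X] [TopologicalSpace.MetrizableSpace X]
    [TotallyDisconnectedSpace X] [Infinite X] [MeasurableSpace X] [BorelSpace X]
    [CompactSpace Z] [TopologicalSpace.MetrizableSpace Z]
    [TotallyDisconnectedSpace Z] [Infinite Z] [MeasurableSpace Z] [BorelSpace Z]
    (hp : Continuous p) (hequi : ∀ s z, p (β s z) = α s (p z)) {a : G}
    (hα : ∀ s, α s ∈ fullGroup (α a)) (hX : StrictlyErgodic (zAct (α a)))
    (hZ : StrictlyErgodic (zAct (β a))) : SquarelyDivisible β := by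
  obtain ⟨hXmin, -⟩ := id hX
  obtain ⟨hZmin, ν, hν, hνu⟩ := hZ
  obtain ⟨hνp, hνT⟩ := mem_invMeasures_zAct.1 hν
  have hμp : IsProbabilityMeasure (ν.map p) := Measure.isProbabilityMeasure_map hp.aemeasurable
  have hμT : MeasurePreserving (α a) (ν.map p) (ν.map p) := by
    refine ⟨(α a).continuous.measurable, ?_⟩
    rw [Measure.map_map (α a).continuous.measurable hp.measurable]
    have : (α a) ∘ p = p ∘ β a := by funext z; exact (hequi a z).symm
    rw [this, ← Measure.map_map hp.measurable (β a).continuous.measurable, hνT.map_eq]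
  have hμu : ∀ κ : Measure X, IsProbabilityMeasure κ → MeasurePreserving (α a) κ κ →
      κ = ν.map p := fun κ h₁ h₂ =>
    hX.2.unique (mem_invMeasures_zAct.2 ⟨h₁, h₂⟩) (mem_invMeasures_zAct.2 ⟨hμp, hμT⟩)
  intro O hO hne
  obtain ⟨z, hz⟩ := hne
  obtain ⟨x₁, hx₁⟩ := exists_ne (p z)
  obtain ⟨x₂, hx₂⟩ : ∃ x₂, x₂ ∉ ({p z, x₁} : Set X) := (toFinite _).infinite_compl.nonempty
  have hx₂' : x₂ ≠ p z ∧ x₂ ≠ x₁ := by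
    constructor <;> rintro rfl <;> simp at hx₂
  -- separate the three points by clopen sets
  obtain ⟨N, hN, hzN, hNsub⟩ := compact_exists_isClopen_in_isOpen
    (toFinite ({x₁, x₂} : Set X)).isClosed.isOpen_compl (x := p z)
    (by simp [hx₁.symm, hx₂'.1.symm])
  have hN₁ : x₁ ∉ N := fun h => hNsub h (by simp)
  have hN₂ : x₂ ∉ N := fun h => hNsub h (by simp)
  obtain ⟨N₁, hN₁c, hx₁N, hN₁sub⟩ := compact_exists_isClopen_in_isOpen
    (hN.compl.isOpen.sdiff (isClosed_singleton (x := x₂))) (x := x₁) ⟨hN₁, hx₂'.2.symm⟩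
  have hN₁₂ : x₂ ∉ N₁ := fun h => (hN₁sub h).2 rfl
  obtain ⟨O₀, hO₀, hzO₀, hO₀sub⟩ := compact_exists_isClopen_in_isOpen
    (hO.inter (hN.isOpen.preimage hp)) (x := z) ⟨hz, hzN⟩
  have hpos : 0 < ν.real O₀ := ENNReal.toReal_pos
    (measure_pos_of_minimal hZmin hνT hO₀.isOpen ⟨z, hzO₀⟩).ne' (measure_ne_top _ _)
  have small : ∀ {D : Set X}, IsClopen D → D.Nonempty →
      ∃ D' ⊆ D, IsClopen D' ∧ D'.Nonempty ∧ (ν.map p).real D' < ν.real O₀ / 2 := by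
    intro D hD hDne
    have hDpos : 0 < (ν.map p).real D := ENNReal.toReal_pos
      (measure_pos_of_minimal hXmin hμT hD.isOpen hDne).ne' (measure_ne_top _ _)
    obtain ⟨D', hsub, hc, h₁, h₂⟩ := exists_clopen_subset_measureReal hXmin hμT hD le_rfl
      (b := min (ν.real O₀ / 2) ((ν.map p).real D)) (lt_min (half_pos hpos) hDpos)
      (min_le_right _ _)
    refine ⟨D', hsub, hc, ?_, h₂.trans_le (min_le_left _ _)⟩
    rw [nonempty_iff_ne_empty]
    rintro rfl
    simp at h₁
  obtain ⟨O₁, hO₁sub, hO₁, hO₁ne, hO₁μ⟩ := small hN₁c ⟨x₁, hx₁N⟩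
  obtain ⟨O₂, hO₂sub, hO₂, hO₂ne, hO₂μ⟩ := small ((hN.compl).diff hN₁c) ⟨x₂, hN₂, hN₁₂⟩
  have hreal : ∀ {D : Set X}, IsClopen D → ν.real (p ⁻¹' D) = (ν.map p).real D := fun hD => by
    rw [map_measureReal_apply hp.measurable hD.isOpen.measurableSet]
  have hsurj : ∀ {D : Set X}, IsClopen D → D.Nonempty → (p ⁻¹' D).Nonempty := by
    intro D hD hDne
    have h := measure_pos_of_minimal hXmin hμT hD.isOpen hDne
    rw [Measure.map_apply hp.measurable hD.isOpen.measurableSet] at h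
    exact nonempty_of_measure_ne_zero h.ne'
  have hc₁ := hO₁.preimage hp
  have hc₂ := hO₂.preimage hp
  refine ⟨O₀, p ⁻¹' O₁, p ⁻¹' O₂, ⟨hO₀.isOpen, hc₁.isOpen, hc₂.isOpen⟩,
    ⟨⟨z, hzO₀⟩, hsurj hO₁ hO₁ne, hsurj hO₂ hO₂ne⟩, fun y hy => (hO₀sub hy).1, ?_, ?_, ?_⟩
  · rw [hO₀.isClosed.closure_eq, hc₁.isClosed.closure_eq, hc₂.isClosed.closure_eq]
    refine ⟨disjoint_left.2 fun y hy hy' => ?_, disjoint_left.2 fun y hy hy' => ?_,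
      disjoint_left.2 fun y hy hy' => ?_⟩
    · exact (hN₁sub (hO₁sub hy')).1 (hO₀sub hy).2
    · exact (hO₂sub hy').1 (hO₀sub hy).2
    · exact (hO₂sub hy').2 (hO₁sub hy)
  · rw [hc₁.isClosed.closure_eq, hc₂.isClosed.closure_eq]
    have hlt : ν.real (p ⁻¹' O₁ ∪ p ⁻¹' O₂) < ν.real O₀ := by
      refine (measureReal_union_le _ _).trans_lt ?_
      rw [hreal hO₁, hreal hO₂]
      linarith
    obtain ⟨g, hg, hsub⟩ := exists_fullGroup_image_subset hZmin (fun κ h₁ h₂ =>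
      hνu κ (mem_invMeasures_zAct.2 ⟨h₁, h₂⟩)) (hc₁.union hc₂) hO₀ hlt
    exact subequiv_of_fullGroup (α := β) continuous_id (fun _ _ => rfl) hg
      (hc₁.union hc₂).isOpen hsub
  · intro E _
    obtain ⟨M, hM⟩ := exists_shift_bound E hα
    obtain ⟨S⟩ := exists_squareArray hXmin hμT hμu hO₁ hO₂ hO₁ne hO₂ne M
    exact S.squarelyDivisibleBy hp hequi hM

end Divisible

section TowerPermutation

variable {X : Type*} [TopologicalSpace X] {T : X ≃ₜ X}

theorem zpow_apply_self (T : X ≃ₜ X) (k : ℤ) (x : X) : (T ^ k) (T x) = (T ^ (k + 1)) x := by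
  rw [zpow_add_apply, zpow_one]

namespace Castle

variable (C : Castle T)

theorem loc_apply_of_lt {x : X} (h : ((C.loc x).2 : ℕ) + 1 < C.ht (C.loc x).1 + 1) :
    C.loc (T x) = ⟨(C.loc x).1, ⟨((C.loc x).2 : ℕ) + 1, h⟩⟩ := by
  refine C.loc_eq ?_
  have e : (T ^ (-((((C.loc x).2 : ℕ) + 1 : ℕ) : ℤ))) (T x) =
      (T ^ (-(((C.loc x).2 : ℕ) : ℤ))) x := by
    rw [zpow_apply_self]
    congr 2
    push_cast; ring
  show (T ^ (-((((C.loc x).2 : ℕ) + 1 : ℕ) : ℤ))) (T x) ∈ C.base (C.loc x).1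
  rw [e]
  exact C.loc_mem x

theorem loc_apply_of_last {x : X} (h : (C.loc x).2 = Fin.last _) : ((C.loc (T x)).2 : ℕ) = 0 := by
  by_contra hne
  have hlt : ((C.loc (T x)).2 : ℕ) - 1 < C.ht (C.loc (T x)).1 + 1 := by
    have := (C.loc (T x)).2.2; omega
  have hx : C.loc x = ⟨(C.loc (T x)).1, ⟨((C.loc (T x)).2 : ℕ) - 1, hlt⟩⟩ := by
    refine C.loc_eq ?_
    have e : (T ^ (-((((C.loc (T x)).2 : ℕ) - 1 : ℕ) : ℤ))) x =
        (T ^ (-(((C.loc (T x)).2 : ℕ) : ℤ))) (T x) := by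
      rw [zpow_apply_self]
      congr 2
      omega
    show (T ^ (-((((C.loc (T x)).2 : ℕ) - 1 : ℕ) : ℤ))) x ∈ C.base (C.loc (T x)).1
    rw [e]
    exact C.loc_mem _
  have h' : ((C.loc x).2 : ℕ) = C.ht (C.loc x).1 := by rw [h]; rfl
  rw [hx] at h'
  have := (C.loc (T x)).2.2
  simp only at h'
  omega

theorem permHom_inv_apply (ρ : ∀ i, Equiv.Perm (Fin (C.ht i + 1))) (x : X) :
    (C.permHom ρ).symm x =
      (T ^ ((((ρ (C.loc x).1).symm (C.loc x).2 : ℕ) : ℤ) - ((C.loc x).2 : ℕ))) x := rfl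

theorem loc_permHom_symm (ρ : ∀ i, Equiv.Perm (Fin (C.ht i + 1))) (x : X) :
    C.loc ((C.permHom ρ).symm x) = ⟨(C.loc x).1, (ρ (C.loc x).1).symm (C.loc x).2⟩ :=
  C.loc_permFun ρ⁻¹ x

/-- Conjugating `T` by a level permutation `ρ` that intertwines the successor map with `π`. -/
theorem conj_apply_of_ne_last {ρ π : ∀ i, Equiv.Perm (Fin (C.ht i + 1))}
    (hlast : ∀ i, ρ i (Fin.last _) = Fin.last _)
    (hsucc : ∀ i (j : ℕ) (h : j + 1 < C.ht i + 1),
      ρ i ⟨j + 1, h⟩ = π i (ρ i ⟨j, Nat.lt_of_succ_lt h⟩))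
    {y : X} (hy : (C.loc y).2 ≠ Fin.last _) :
    (C.permHom ρ * T * (C.permHom ρ)⁻¹) y =
      (T ^ (((π (C.loc y).1 (C.loc y).2 : ℕ) : ℤ) - ((C.loc y).2 : ℕ))) y := by
  rw [Homeomorph.mul_apply, Homeomorph.mul_apply, Homeomorph.inv_apply]
  set x := (C.permHom ρ).symm y with hx
  have hloc := C.loc_permHom_symm ρ y
  rw [← hx] at hloc
  obtain ⟨i, j, hij⟩ : ∃ i j, C.loc y = ⟨i, j⟩ := ⟨_, _, rfl⟩
  have hxy := C.permHom_inv_apply ρ y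
  rw [← hx] at hxy
  rw [hij] at hloc hxy hy
  simp only at hloc hxy hy
  set j' := (ρ i).symm j with hj'
  have hj : j = ρ i j' := by rw [hj']; simp
  have hne : j' ≠ Fin.last _ := by
    rintro h
    rw [h, hlast] at hj
    exact hy hj
  have hlt : (j' : ℕ) + 1 < C.ht i + 1 := by
    have := j'.2
    have : (j' : ℕ) ≠ C.ht i := fun h => hne (Fin.ext h)
    omega
  have hTx : C.loc (T x) = ⟨i, ⟨(j' : ℕ) + 1, hlt⟩⟩ := by
    have key : ∀ q : (i : C.ι) × Fin (C.ht i + 1), C.loc x = q →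
        ∀ h : (q.2 : ℕ) + 1 < C.ht q.1 + 1, C.loc (T x) = ⟨q.1, ⟨(q.2 : ℕ) + 1, h⟩⟩ := by
      rintro q rfl h
      exact C.loc_apply_of_lt h
    exact key ⟨i, j'⟩ hloc hlt
  rw [C.permHom_apply, hTx, hij]
  simp only
  rw [hsucc i j' hlt, hxy]
  have e : T ((T ^ (((j' : ℕ) : ℤ) - (j : ℕ))) y) = (T ^ (1 + (((j' : ℕ) : ℤ) - (j : ℕ)))) y := by
    rw [zpow_add_apply, zpow_one]
  rw [e, ← zpow_add_apply]
  have e' : (⟨(j' : ℕ), Nat.lt_of_succ_lt hlt⟩ : Fin (C.ht i + 1)) = j' := rfl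
  rw [e', ← hj]
  congr 2
  push_cast
  ring

theorem conj_apply_of_last {ρ : ∀ i, Equiv.Perm (Fin (C.ht i + 1))}
    (hzero : ∀ i, ρ i 0 = 0) (hlast : ∀ i, ρ i (Fin.last _) = Fin.last _)
    {y : X} (hy : (C.loc y).2 = Fin.last _) :
    (C.permHom ρ * T * (C.permHom ρ)⁻¹) y = T y := by
  rw [Homeomorph.mul_apply, Homeomorph.mul_apply, Homeomorph.inv_apply]
  have hxy : (C.permHom ρ).symm y = y := by
    rw [C.permHom_inv_apply, hy]
    have : (ρ (C.loc y).1).symm (Fin.last _) = Fin.last _ := by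
      rw [Equiv.symm_apply_eq, hlast]
    rw [this]
    simp
  rw [hxy, C.permHom_apply]
  have h0 : (C.loc (T y)).2 = 0 := Fin.ext (C.loc_apply_of_last hy)
  rw [h0, hzero]
  simp

end Castle

theorem exists_perm_of_isCycleOn {n : ℕ} {π : Equiv.Perm (Fin (n + 1))}
    (hπ : π.IsCycleOn univ) (hlast : π (Fin.last n) = 0) :
    ∃ ρ : Equiv.Perm (Fin (n + 1)), ρ 0 = 0 ∧ ρ (Fin.last n) = Fin.last n ∧
      ∀ (j : ℕ) (h : j + 1 < n + 1), ρ ⟨j + 1, h⟩ = π (ρ ⟨j, Nat.lt_of_succ_lt h⟩) := by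
  have hπ' : π.IsCycleOn ((Finset.univ : Finset (Fin (n + 1))) : Set (Fin (n + 1))) := by
    rwa [Finset.coe_univ]
  have hinj : Function.Injective fun j : Fin (n + 1) => (π ^ (j : ℕ)) 0 := by
    intro j k hjk
    have := (hπ'.pow_apply_eq_pow_apply (Finset.mem_univ 0)).1 hjk
    rw [Finset.card_univ, Fintype.card_fin] at this
    exact Fin.ext (Nat.ModEq.eq_of_lt_of_lt this j.2 k.2)
  refine ⟨Equiv.ofBijective _ (Finite.injective_iff_bijective.1 hinj), ?_, ?_, fun j h => ?_⟩
  · simp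
  · refine π.injective ?_
    rw [hlast]
    show π ((π ^ n) 0) = 0
    rw [← Equiv.Perm.mul_apply, ← pow_succ']
    have := (hπ'.pow_apply_eq (Finset.mem_univ 0) (n := n + 1)).2 (by simp)
    exact this
  · show (π ^ (j + 1)) 0 = π ((π ^ j) 0)
    rw [pow_succ', Equiv.Perm.mul_apply]

/-- A tower permutation of `T` is conjugate to `T` by an element of the topological full group. -/
theorem IsTowerPermutation.exists_conj {S : X ≃ₜ X} (h : IsTowerPermutation T S) :
    ∃ φ ∈ fullGroup T, S = φ * T * φ⁻¹ := by
  obtain ⟨k, B, ht, π, hB, hdisj, hcov, hπ, hS, hSlast⟩ := h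
  let C : Castle T :=
    { ι := Fin k
      fintype := inferInstance
      base := B
      ht := ht
      isClopen_base := fun i => (hB i).1
      existsUnique := fun x => by
        obtain ⟨p, hp⟩ := mem_iUnion.1 (hcov.symm ▸ mem_univ x : x ∈ ⋃ p, _)
        refine ⟨p, (mem_image_pow_iff T _ _ _).1 hp, fun q hq => ?_⟩
        by_contra hqp
        exact disjoint_left.1 (hdisj hqp) ((mem_image_pow_iff T _ _ _).2 hq) hp }
  choose ρ hρ0 hρl hρs using fun i => exists_perm_of_isCycleOn (hπ i).1 (hπ i).2
  refine ⟨C.permHom ρ, C.permHom_mem_fullGroup ρ, ?_⟩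
  ext y
  have hy : y ∈ (T ^ ((C.loc y).2 : ℕ)) '' B (C.loc y).1 :=
    C.loc_eq_iff_mem_image.1 rfl
  by_cases hl : (C.loc y).2 = Fin.last _
  · rw [C.conj_apply_of_last hρ0 hρl hl]
    refine hSlast (C.loc y).1 y ?_
    rw [hl] at hy
    exact hy
  · rw [C.conj_apply_of_ne_last (π := π) hρl hρs hl]
    exact hS _ _ hl y hy

end TowerPermutation

section Conjugation

variable {G X Y : Type*} [Group G] [TopologicalSpace X] [TopologicalSpace Y] {α : Act G X}

theorem conjAct_apply (h : X ≃ₜ Y) (s : G) (y : Y) : conjAct h α s y = h (α s (h.symm y)) := rfl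

theorem zAct_conjAct (h : X ≃ₜ Y) (s : G) : zAct (conjAct h α s) = conjAct h (zAct (α s)) := by
  apply MonoidHom.ext_mint
  ext y
  simp [conjAct_apply]

theorem zAct_conj (φ T : X ≃ₜ X) : zAct (φ * T * φ⁻¹) = conjAct φ (zAct T) := by
  apply MonoidHom.ext_mint
  ext y
  simp [conjAct_apply]

theorem IsMinimalAct.conjAct (hα : IsMinimalAct α) (h : X ≃ₜ Y) : IsMinimalAct (conjAct h α) := by
  intro C hC hinv
  have hinv' : ∀ s, α s '' (h ⁻¹' C) ⊆ h ⁻¹' C := by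
    rintro s _ ⟨x, hx, rfl⟩
    refine hinv s ⟨h x, hx, ?_⟩
    rw [conjAct_apply, h.symm_apply_apply]
  rcases hα (h ⁻¹' C) (hC.preimage h.continuous) hinv' with h0 | h1
  · left
    rw [← h.image_preimage C, h0, image_empty]
  · right
    rw [← h.image_preimage C, h1, image_univ, h.range_coe]

theorem TopFree.conjAct (hα : TopFree α) (h : X ≃ₜ Y) : TopFree (conjAct h α) := by
  refine (h.surjective.denseRange.dense_image h.continuous hα).mono ?_
  rintro _ ⟨x, hx, rfl⟩ s hs
  refine hx s (h.injective ?_)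
  rwa [conjAct_apply, h.symm_apply_apply] at hs

theorem TopWeaklyMixing.conjAct (hα : TopWeaklyMixing α) (h : X ≃ₜ Y) :
    TopWeaklyMixing (conjAct h α) := by
  intro U₁ U₂ V₁ V₂ hU₁ hU₂ hV₁ hV₂ nU₁ nU₂ nV₁ nV₂
  have hne : ∀ {U : Set Y}, U.Nonempty → (h ⁻¹' U).Nonempty := fun hU =>
    hU.preimage h.surjective
  obtain ⟨s, ⟨_, ⟨x, hx, rfl⟩, hx'⟩, _, ⟨y, hy, rfl⟩, hy'⟩ := hα _ _ _ _
    (hU₁.preimage h.continuous) (hU₂.preimage h.continuous) (hV₁.preimage h.continuous)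
    (hV₂.preimage h.continuous) (hne nU₁) (hne nU₂) (hne nV₁) (hne nV₂)
  refine ⟨s, ⟨_, ⟨h x, hx, rfl⟩, ?_⟩, _, ⟨h y, hy, rfl⟩, ?_⟩
  · rw [conjAct_apply, h.symm_apply_apply]; exact hx'
  · rw [conjAct_apply, h.symm_apply_apply]; exact hy'

variable [MeasurableSpace X] [BorelSpace X] [MeasurableSpace Y] [BorelSpace Y]

theorem map_mem_invMeasures {μ : Measure X} (hμ : μ ∈ invMeasures α) (h : X ≃ₜ Y) :
    μ.map h ∈ invMeasures (conjAct h α) := by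
  have := hμ.1
  refine ⟨Measure.isProbabilityMeasure_map h.continuous.aemeasurable, fun s =>
    ⟨(conjAct h α s).continuous.measurable, ?_⟩⟩
  rw [Measure.map_map (conjAct h α s).continuous.measurable h.continuous.measurable]
  have : conjAct h α s ∘ h = h ∘ α s := by
    funext x; simp [conjAct_apply]
  rw [this, ← Measure.map_map h.continuous.measurable (α s).continuous.measurable,
    (hμ.2 s).map_eq]

theorem map_symm_mem_invMeasures {ν : Measure Y} (h : X ≃ₜ Y) (hν : ν ∈ invMeasures (conjAct h α)) :
    ν.map h.symm ∈ invMeasures α := by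
  have := map_mem_invMeasures hν h.symm
  convert this
  ext s x
  simp [conjAct_apply]

theorem map_map_symm (h : X ≃ₜ Y) (ν : Measure Y) : (ν.map h.symm).map h = ν := by
  rw [Measure.map_map h.continuous.measurable h.symm.continuous.measurable]
  simp

theorem StrictlyErgodic.conjAct (hα : StrictlyErgodic α) (h : X ≃ₜ Y) :
    StrictlyErgodic (conjAct h α) := by
  refine ⟨hα.1.conjAct h, ?_⟩
  obtain ⟨μ, hμ, hu⟩ := hα.2
  refine ⟨μ.map h, map_mem_invMeasures hμ h, fun ν hν => ?_⟩
  rw [← hu _ (map_symm_mem_invMeasures h hν), map_map_symm]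

theorem invMeasures_zAct_conj {T φ : X ≃ₜ X}
    (hφ : φ ∈ fullGroup T) : invMeasures (zAct (φ * T * φ⁻¹)) = invMeasures (zAct T) := by
  have hφm : ∀ μ ∈ invMeasures (zAct T), MeasurePreserving φ μ μ := fun μ hμ =>
    measurePreserving_of_mem_fullGroup (mem_invMeasures_zAct.1 hμ).2 hφ
  rw [zAct_conj]
  ext ν
  constructor
  · intro hν
    have h := map_symm_mem_invMeasures φ hν
    have h' := (hφm _ h).map_eq
    rw [map_map_symm] at h'
    rwa [h']
  · intro hν
    have := map_mem_invMeasures hν φ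
    rwa [(hφm ν hν).map_eq] at this

end Conjugation

section Single

variable {G X : Type*} [Group G] [TopologicalSpace X] {α : Act G X}

theorem apply_ofAdd_zpow (s : G) (k : Multiplicative ℤ) : zAct (α s) k = α (s ^ k.toAdd) := by
  rw [zAct_apply, map_zpow]

theorem isMinimalAct_of_zAct {s : G} (h : IsMinimalAct (zAct (α s))) : IsMinimalAct α :=
  fun C hC hinv => h C hC fun k => by rw [apply_ofAdd_zpow]; exact hinv _

theorem topWeaklyMixing_of_zAct {s : G} (h : TopWeaklyMixing (zAct (α s))) :
    TopWeaklyMixing α := by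
  intro U₁ U₂ V₁ V₂ hU₁ hU₂ hV₁ hV₂ nU₁ nU₂ nV₁ nV₂
  obtain ⟨k, hk⟩ := h U₁ U₂ V₁ V₂ hU₁ hU₂ hV₁ hV₂ nU₁ nU₂ nV₁ nV₂
  rw [apply_ofAdd_zpow] at hk
  exact ⟨_, hk⟩

/-- A topologically weakly mixing homeomorphism is spectrally aperiodic. -/
theorem TopWeaklyMixing.spectrallyAperiodic [Nonempty X] {T : X ≃ₜ X}
    (h : TopWeaklyMixing (zAct T)) : SpectrallyAperiodic T := by
  rintro ⟨A, n, hA, hn, hdisj, hcov⟩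
  have huniq : ∀ x, ∀ i ≤ n, ∀ j ≤ n, (T ^ (-(i : ℤ))) x ∈ A → (T ^ (-(j : ℤ))) x ∈ A →
      i = j := by
    intro x i hi j hj h₁ h₂
    by_contra hij
    refine disjoint_left.1 (hdisj (i := ⟨i, by omega⟩) (j := ⟨j, by omega⟩) ?_)
      ((mem_image_pow_iff T i A x).2 h₁) ((mem_image_pow_iff T j A x).2 h₂)
    simpa using hij
  have hex : ∀ x, ∃ i ≤ n, (T ^ (-(i : ℤ))) x ∈ A := by
    intro x
    obtain ⟨i, hi⟩ := mem_iUnion.1 (hcov.symm ▸ mem_univ x : x ∈ ⋃ i, _)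
    exact ⟨i, by omega, (mem_image_pow_iff T _ _ _).1 hi⟩
  have hne : A.Nonempty := by
    obtain ⟨i, -, hi⟩ := hex (Classical.arbitrary X)
    exact ⟨_, hi⟩
  -- `A` is invariant under `T ^ (n + 1)`
  have hstep : ∀ x, x ∈ A ↔ (T ^ ((n + 1 : ℕ) : ℤ)) x ∈ A := by
    have key : ∀ x, (T ^ (-((n + 1 : ℕ) : ℤ))) x ∈ A → x ∈ A := by
      intro x hx
      obtain ⟨i, hi, hiA⟩ := hex x
      rcases Nat.eq_zero_or_pos i with rfl | hpos
      · simpa using hiA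
      · have := huniq ((T ^ (-1 : ℤ)) x) n le_rfl (i - 1) (by omega) (by
          rw [← zpow_add_apply]
          have e : -(n : ℤ) + -1 = -((n + 1 : ℕ) : ℤ) := by push_cast; ring
          rwa [e]) (by
          rw [← zpow_add_apply]
          have e : -((i - 1 : ℕ) : ℤ) + -1 = -(i : ℤ) := by omega
          rwa [e])
        omega
    have key' : ∀ x, x ∈ A → (T ^ (-((n + 1 : ℕ) : ℤ))) x ∈ A := by
      intro x hx
      obtain ⟨i, hi, hiA⟩ := hex ((T ^ (-1 : ℤ)) x)
      rcases Nat.lt_or_ge i n with hlt | hge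
      · have := huniq x 0 (by omega) (i + 1) (by omega) (by simpa using hx) (by
          rw [← zpow_add_apply] at hiA
          have e : -(i : ℤ) + -1 = -((i + 1 : ℕ) : ℤ) := by push_cast; ring
          rwa [← e])
        omega
      · obtain rfl : i = n := by omega
        rw [← zpow_add_apply] at hiA
        have e : -(i : ℤ) + -1 = -((i + 1 : ℕ) : ℤ) := by push_cast; ring
        rwa [← e]
    intro x
    constructor
    · intro hx
      refine key _ ?_
      rw [← zpow_add_apply]
      simpa using hx
    · intro hx
      have := key' _ hx
      rw [← zpow_add_apply] at this
      simpa using this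
  have hmul : ∀ (m : ℤ) x, x ∈ A ↔ (T ^ (((n + 1 : ℕ) : ℤ) * m)) x ∈ A := by
    intro m
    induction m using Int.induction_on with
    | zero => intro x; simp
    | succ m ih => intro x; rw [mul_add, zpow_add_apply, mul_one, ← ih, ← hstep]
    | pred m ih =>
      intro x
      rw [mul_sub, sub_eq_add_neg, zpow_add_apply, mul_one, ← ih,
        hstep ((T ^ (-((n + 1 : ℕ) : ℤ))) x), ← zpow_add_apply]
      simp
  obtain ⟨s, ⟨_, ⟨x, hx, rfl⟩, hxA⟩, _, ⟨y, hy, rfl⟩, hyA⟩ := h A A A (T '' A) hA.isOpen hA.isOpen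
    hA.isOpen (T.isOpen_image.2 hA.isOpen) hne hne hne (hne.image _)
  set k := s.toAdd
  have hpos : (0 : ℤ) < ((n + 1 : ℕ) : ℤ) := by positivity
  have hr0 : 0 ≤ k % ((n + 1 : ℕ) : ℤ) := Int.emod_nonneg _ hpos.ne'
  have hrn : k % ((n + 1 : ℕ) : ℤ) < ((n + 1 : ℕ) : ℤ) := Int.emod_lt_of_pos _ hpos
  obtain ⟨r, hr⟩ := Int.eq_ofNat_of_zero_le hr0
  have hk : ∀ z, z ∈ A → (T ^ (-(r : ℤ))) ((T ^ k) z) ∈ A := by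
    intro z hz
    rw [← zpow_add_apply]
    have e : -(r : ℤ) + k = ((n + 1 : ℕ) : ℤ) * (k / ((n + 1 : ℕ) : ℤ)) := by
      have := Int.mul_ediv_add_emod k ((n + 1 : ℕ) : ℤ)
      omega
    rw [e, ← hmul]
    exact hz
  have h₁ := huniq ((T ^ k) x) r (by omega) 0 (by omega) (hk x hx) (by
    have : (T ^ k) x ∈ A := hxA
    simpa using this)
  have h₂ := huniq ((T ^ k) y) r (by omega) 1 hn (hk y hy) (by
    have : (T ^ k) y ∈ T '' A := hyA
    have := (mem_image_pow_iff T 1 A _).1 (by simpa using this)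
    exact this)
  omega

end Single

theorem zAct_piCongrRight {ι : Type*} {X : ι → Type*} [∀ i, TopologicalSpace (X i)]
    (T : ∀ i, X i ≃ₜ X i) :
    zAct (Homeomorph.piCongrRight T) = diagAct fun i => zAct (T i) := by
  apply MonoidHom.ext_mint
  ext x i
  simp [diagAct, Homeomorph.piCongrRight]

theorem zpow_piCongrRight_apply {ι : Type*} {X : ι → Type*} [∀ i, TopologicalSpace (X i)]
    (T : ∀ i, X i ≃ₜ X i) (k : ℤ) (x : ∀ i, X i) (i : ι) :
    (Homeomorph.piCongrRight T ^ k) x i = (T i ^ k) (x i) := by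
  have := DFunLike.congr_fun (zAct_piCongrRight T) (Multiplicative.ofAdd k)
  have h := congrArg (fun g => g x i) this
  exact h

theorem exists_box {ι : Type*} {X : ι → Type*} [∀ i, TopologicalSpace (X i)] {U : Set (∀ i, X i)}
    (hU : IsOpen U) (hne : U.Nonempty) :
    ∃ (I : Finset ι) (u : ∀ i, Set (X i)), (∀ i, IsOpen (u i) ∧ (u i).Nonempty) ∧
      (I : Set ι).pi u ⊆ U := by
  classical
  obtain ⟨f, hf⟩ := hne
  obtain ⟨I, u, hu, hsub⟩ := isOpen_pi_iff.1 hU f hf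
  refine ⟨I, fun i => if i ∈ I then u i else univ, fun i => ?_, fun g hg => hsub fun i hi => ?_⟩
  · by_cases hi : i ∈ I
    · simp only [if_pos hi]; exact ⟨(hu i hi).1, f i, (hu i hi).2⟩
    · simp only [if_neg hi]; exact ⟨isOpen_univ, f i, mem_univ _⟩
  · have := hg i hi
    simpa only [if_pos (Finset.mem_coe.1 hi)] using this

section WeakMixing

variable {X : Type*} [TopologicalSpace X]

theorem topWeaklyMixing_of_measure [CompactSpace X] [MeasurableSpace X] [BorelSpace X] {T : X ≃ₜ X}
    {μ : Measure X} [IsProbabilityMeasure μ] (hT : IsMinimalAct (zAct T))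
    (hμ : MeasurePreserving T μ μ) (hwm : MeasureWeaklyMixing (zAct T) μ) :
    TopWeaklyMixing (zAct T) := by
  intro U₁ U₂ V₁ V₂ hU₁ hU₂ hV₁ hV₂ nU₁ nU₂ nV₁ nV₂
  have hpos : ∀ {U : Set X}, IsOpen U → U.Nonempty → 0 < μ.real U := fun hU hne =>
    ENNReal.toReal_pos (measure_pos_of_minimal hT hμ hU hne).ne' (measure_ne_top _ _)
  have h₁ := mul_pos (hpos hU₁ nU₁) (hpos hU₂ nU₂)
  have h₂ := mul_pos (hpos hV₁ nV₁) (hpos hV₂ nV₂)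
  obtain ⟨s, hs⟩ := hwm {U₁, U₂, V₁, V₂} (toFinite _) (by
    rintro A (rfl | rfl | rfl | rfl) <;> exact IsOpen.measurableSet (by assumption)) _
    (lt_min h₁ h₂)
  have key : ∀ {A B : Set X}, 0 < μ.real (zAct T s '' A ∩ B) →
      (zAct T s '' A ∩ B).Nonempty := fun h => by
    rw [nonempty_iff_ne_empty]
    intro h0
    rw [h0, measureReal_empty] at h
    exact lt_irrefl _ h
  refine ⟨s, key ?_, key ?_⟩
  · have := (abs_lt.1 ((hs U₁ (by simp) U₂ (by simp)).trans_le (min_le_left _ _))).1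
    linarith
  · have := (abs_lt.1 ((hs V₁ (by simp) V₂ (by simp)).trans_le (min_le_right _ _))).1
    linarith

/-- Furstenberg's intersection lemma. -/
theorem TopWeaklyMixing.exists_inter {T : X ≃ₜ X} (h : TopWeaklyMixing (zAct T))
    {U₁ U₂ V₁ V₂ : Set X} (hU₁ : IsOpen U₁) (hU₂ : IsOpen U₂) (hV₁ : IsOpen V₁) (hV₂ : IsOpen V₂)
    (nU₁ : U₁.Nonempty) (nU₂ : U₂.Nonempty) (nV₁ : V₁.Nonempty) (nV₂ : V₂.Nonempty) :
    ∃ W W' : Set X, IsOpen W ∧ IsOpen W' ∧ W.Nonempty ∧ W'.Nonempty ∧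
      ∀ (k : ℤ), (∃ x ∈ W, (T ^ k) x ∈ W') →
        (∃ x ∈ U₁, (T ^ k) x ∈ U₂) ∧ ∃ x ∈ V₁, (T ^ k) x ∈ V₂ := by
  obtain ⟨s, ⟨_, ⟨x, hx, rfl⟩, hx'⟩, _, ⟨y, hy, rfl⟩, hy'⟩ :=
    h U₁ V₁ U₂ V₂ hU₁ hV₁ hU₂ hV₂ nU₁ nV₁ nU₂ nV₂
  refine ⟨U₁ ∩ zAct T s ⁻¹' V₁, U₂ ∩ zAct T s ⁻¹' V₂,
    hU₁.inter (hV₁.preimage (Homeomorph.continuous _)),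
    hU₂.inter (hV₂.preimage (Homeomorph.continuous _)), ⟨x, hx, hx'⟩, ⟨y, hy, hy'⟩, ?_⟩
  rintro k ⟨z, ⟨hz₁, hz₂⟩, hz₃, hz₄⟩
  refine ⟨⟨z, hz₁, hz₃⟩, zAct T s z, hz₂, ?_⟩
  have e : (T ^ k) (zAct T s z) = zAct T s ((T ^ k) z) := by
    rw [zAct_apply, ← zpow_add_apply, ← zpow_add_apply, add_comm]
  rw [e]
  exact hz₄

theorem topWeaklyMixing_piCongrRight {ι : Type*} {X : ι → Type*} [∀ i, TopologicalSpace (X i)]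
    {T : ∀ i, X i ≃ₜ X i} (hwm : ∀ i, TopWeaklyMixing (zAct (T i)))
    (hmin : IsMinimalAct (zAct (Homeomorph.piCongrRight T))) :
    TopWeaklyMixing (zAct (Homeomorph.piCongrRight T)) := by
  classical
  intro U₁ U₂ V₁ V₂ hU₁ hU₂ hV₁ hV₂ nU₁ nU₂ nV₁ nV₂
  obtain ⟨I₁, u₁, hu₁, hs₁⟩ := exists_box hU₁ nU₁
  obtain ⟨I₂, u₂, hu₂, hs₂⟩ := exists_box hU₂ nU₂
  obtain ⟨J₁, v₁, hv₁, ht₁⟩ := exists_box hV₁ nV₁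
  obtain ⟨J₂, v₂, hv₂, ht₂⟩ := exists_box hV₂ nV₂
  choose W W' hW hW' nW nW' key using fun i => (hwm i).exists_inter (hu₁ i).1 (hu₂ i).1 (hv₁ i).1
    (hv₂ i).1 (hu₁ i).2 (hu₂ i).2 (hv₁ i).2 (hv₂ i).2
  let I := I₁ ∪ I₂ ∪ (J₁ ∪ J₂)
  choose w hw using nW
  choose w' hw' using nW'
  obtain ⟨k, hk⟩ := isMinimalAct_zAct_iff.1 hmin ((I : Set ι).pi W')
    (isOpen_set_pi I.finite_toSet fun i _ => hW' i) ⟨w', fun i _ => hw' i⟩ w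
  have hk' : ∀ i ∈ I, (∃ x ∈ u₁ i, (T i ^ k) x ∈ u₂ i) ∧ ∃ x ∈ v₁ i, (T i ^ k) x ∈ v₂ i := by
    intro i hi
    refine key i k ⟨w i, hw i, ?_⟩
    rw [← zpow_piCongrRight_apply]
    exact hk i hi
  have hx : ∀ i, ∃ x, i ∈ I → x ∈ u₁ i ∧ (T i ^ k) x ∈ u₂ i := fun i => by
    by_cases hi : i ∈ I
    · obtain ⟨x, h⟩ := (hk' i hi).1; exact ⟨x, fun _ => h⟩
    · exact ⟨w i, fun h => absurd h hi⟩
  have hy : ∀ i, ∃ x, i ∈ I → x ∈ v₁ i ∧ (T i ^ k) x ∈ v₂ i := fun i => by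
    by_cases hi : i ∈ I
    · obtain ⟨x, h⟩ := (hk' i hi).2; exact ⟨x, fun _ => h⟩
    · exact ⟨w i, fun h => absurd h hi⟩
  choose x hx using hx
  choose y hy using hy
  refine ⟨Multiplicative.ofAdd k, ⟨_, ⟨x, hs₁ fun i hi => ?_, rfl⟩, hs₂ fun i hi => ?_⟩,
    _, ⟨y, ht₁ fun i hi => ?_, rfl⟩, ht₂ fun i hi => ?_⟩
  · exact (hx i (by simp [I, Finset.mem_coe.1 hi])).1
  · rw [zAct_apply, toAdd_ofAdd, zpow_piCongrRight_apply]
    exact (hx i (by simp [I, Finset.mem_coe.1 hi])).2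
  · exact (hy i (by simp [I, Finset.mem_coe.1 hi])).1
  · rw [zAct_apply, toAdd_ofAdd, zpow_piCongrRight_apply]
    exact (hy i (by simp [I, Finset.mem_coe.1 hi])).2

end WeakMixing

section Product

variable {X : Type*} [TopologicalSpace X] [MeasurableSpace X] [BorelSpace X]
  {μ : ℕ → Measure X} [∀ n, IsProbabilityMeasure (μ n)]

theorem infinitePi_pos (hμ : ∀ n, ∀ U : Set X, IsOpen U → U.Nonempty → 0 < μ n U)
    {U : Set (ℕ → X)} (hU : IsOpen U) (hne : U.Nonempty) : 0 < Measure.infinitePi μ U := by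
  obtain ⟨I, u, hu, hsub⟩ := exists_box hU hne
  refine lt_of_lt_of_le ?_ (measure_mono hsub)
  rw [Measure.infinitePi_pi μ (fun i _ => (hu i).1.measurableSet)]
  exact CanonicallyOrderedAdd.prod_pos.2 fun i _ => hμ i _ (hu i).1 (hu i).2

theorem measurePreserving_piCongrRight {T : ℕ → X ≃ₜ X}
    (hμ : ∀ n, MeasurePreserving (T n) (μ n) (μ n)) :
    MeasurePreserving (Homeomorph.piCongrRight T) (Measure.infinitePi μ)
      (Measure.infinitePi μ) := by
  have hm : Measurable fun (x : ℕ → X) i => T i (x i) :=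
    measurable_pi_lambda _ fun i => (T i).continuous.measurable.comp (measurable_pi_apply i)
  refine ⟨hm, ?_⟩
  have := Measure.infinitePi_map_pi (μ := μ) (f := fun i => T i)
    fun i => (T i).continuous.measurable
  simp only [(hμ _).map_eq] at this
  exact this

variable [SecondCountableTopology X]

theorem eq_infinitePi_of_disjointFamily {T : ℕ → X ≃ₜ X}
    (hT : ∀ n, StrictlyErgodic (zAct (T n))) (hμ : ∀ n, μ n ∈ invMeasures (zAct (T n)))
    (hdisj : DisjointFamily (fun n => zAct (T n)) μ) {ν : Measure (ℕ → X)}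
    (hν : ν ∈ invMeasures (zAct (Homeomorph.piCongrRight T))) : ν = Measure.infinitePi μ := by
  refine hdisj ν (by rwa [← zAct_piCongrRight]) fun i => ?_
  obtain ⟨hp, hinv⟩ := mem_invMeasures_zAct.1 hν
  refine (hT i).2.unique (mem_invMeasures_zAct.2 ⟨?_, ?_⟩) (hμ i)
  · exact Measure.isProbabilityMeasure_map (measurable_pi_apply i).aemeasurable
  · refine ⟨(T i).continuous.measurable, ?_⟩
    rw [Measure.map_map (T i).continuous.measurable (measurable_pi_apply i)]
    have : (T i ∘ fun x : ℕ → X => x i) = (fun x => x i) ∘ Homeomorph.piCongrRight T := rfl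
    rw [this, ← Measure.map_map (measurable_pi_apply i)
      (Homeomorph.continuous _).measurable, hinv.map_eq]

theorem isMinimalAct_of_uniquelyErgodic {Y : Type*} [TopologicalSpace Y] [CompactSpace Y]
    [TopologicalSpace.MetrizableSpace Y] [TotallyDisconnectedSpace Y] [MeasurableSpace Y]
    [BorelSpace Y] {T : Y ≃ₜ Y} {μ : Measure Y}
    (hue : ∀ ν : Measure Y, IsProbabilityMeasure ν → MeasurePreserving T ν ν → ν = μ)
    (hpos : ∀ U : Set Y, IsOpen U → U.Nonempty → 0 < μ U) : IsMinimalAct (zAct T) := by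
  classical
  refine isMinimalAct_zAct_iff.2 fun U hU hne x => ?_
  by_contra hcon
  push Not at hcon
  obtain ⟨y, hy⟩ := hne
  obtain ⟨A, hA, hyA, hAU⟩ := compact_exists_isClopen_in_isOpen hU hy
  obtain ⟨F, ν, hF, -, hν, hTν, hlim⟩ := exists_limit_of_empirical T (fun _ => x) id tendsto_id
  obtain rfl := hue ν hν hTν
  have hv : ∀ n, visits T A n x = 0 := fun n => by
    rw [visits, Finset.card_eq_zero, Finset.filter_eq_empty_iff]
    exact fun j _ h => hcon j (hAU h)
  have h := hlim A hA
  simp only [hv, Nat.cast_zero, zero_div] at h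
  have h0 := tendsto_nhds_unique h tendsto_const_nhds
  exact (ENNReal.toReal_pos (hpos A hA.isOpen ⟨y, hyA⟩).ne' (measure_ne_top _ _)).ne' h0

theorem strictlyErgodic_piCongrRight [CompactSpace X] [TopologicalSpace.MetrizableSpace X]
    [TotallyDisconnectedSpace X] {T : ℕ → X ≃ₜ X}
    (hT : ∀ n, StrictlyErgodic (zAct (T n))) (hμ : ∀ n, μ n ∈ invMeasures (zAct (T n)))
    (hdisj : DisjointFamily (fun n => zAct (T n)) μ) :
    StrictlyErgodic (zAct (Homeomorph.piCongrRight T)) := by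
  have hinv : ∀ n, MeasurePreserving (T n) (μ n) (μ n) := fun n =>
    (mem_invMeasures_zAct.1 (hμ n)).2
  have hue := fun ν hν => eq_infinitePi_of_disjointFamily hT hμ hdisj (ν := ν) hν
  refine ⟨isMinimalAct_of_uniquelyErgodic (μ := Measure.infinitePi μ)
    (fun ν h₁ h₂ => hue ν (mem_invMeasures_zAct.2 ⟨h₁, h₂⟩)) fun U hU hne =>
    infinitePi_pos (fun n U hU hne => measure_pos_of_minimal (hT n).1 (hinv n) hU hne) hU hne,
    Measure.infinitePi μ, mem_invMeasures_zAct.2 ⟨inferInstance,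
      measurePreserving_piCongrRight hinv⟩, hue⟩

omit [SecondCountableTopology X] in
theorem topFree_diagAct [T2Space X] {G : Type*} [Group G] [Countable G] {α : ℕ → Act G X}
    (hpos : ∀ n, ∀ U : Set X, IsOpen U → U.Nonempty → 0 < μ n U)
    (hfree : ∀ s : G, s ≠ 1 → Tendsto (fun n => μ n {x | α n s x = x}) atTop (𝓝 0)) :
    TopFree (diagAct α) := by
  have hnull : ∀ s : G, s ≠ 1 → Measure.infinitePi μ {x | diagAct α s x = x} = 0 := by
    intro s hs
    have hle : ∀ n, Measure.infinitePi μ {x | diagAct α s x = x} ≤ μ n {x | α n s x = x} := by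
      intro n
      have hm : MeasurableSet {x | α n s x = x} :=
        (isClosed_eq (α n s).continuous continuous_id).measurableSet
      rw [← Measure.infinitePi_map_eval μ n, Measure.map_apply (measurable_pi_apply n) hm]
      exact measure_mono fun x hx => congrFun hx n
    exact le_antisymm (ge_of_tendsto (hfree s hs) (Eventually.of_forall hle)) zero_le
  have hall : Measure.infinitePi μ (⋃ s : {s : G // s ≠ 1}, {x | diagAct α s x = x}) = 0 :=
    measure_iUnion_null fun s => hnull s s.2
  refine dense_iff_inter_open.2 fun U hU hne => ?_
  by_contra hcon
  rw [not_nonempty_iff_eq_empty] at hcon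
  refine (infinitePi_pos hpos hU hne).ne' (measure_mono_null (fun x hx => ?_) hall)
  by_contra hx'
  have : x ∈ U ∩ {x | ∀ s, diagAct α s x = x → s = 1} := by
    refine ⟨hx, fun s hs => ?_⟩
    by_contra h1
    exact hx' (mem_iUnion.2 ⟨⟨s, h1⟩, hs⟩)
  rw [hcon] at this
  exact this

end Product

section FiniteModels

/-- Free groups are residually finite. -/
theorem FreeGroup.exists_perm_ne_one {α : Type} {w : FreeGroup α} (hw : w ≠ 1) :
    ∃ (B : Type) (_ : Finite B) (f : FreeGroup α →* Equiv.Perm B), f w ≠ 1 := by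
  classical
  let S : Set (FreeGroup α) := FreeGroup.mk '' {L | L <:+ w.toWord}
  have hS : S.Finite := by
    refine Set.Finite.image _ ((w.toWord.tails.toFinset.finite_toSet).subset fun L hL => ?_)
    simpa using hL
  have := hS.to_subtype
  let e : ∀ i : α, {x : S // FreeGroup.of i * x.1 ∈ S} ≃ {y : S // (FreeGroup.of i)⁻¹ * y.1 ∈ S} :=
    fun i =>
    { toFun := fun x => ⟨⟨_, x.2⟩, by simp⟩
      invFun := fun y => ⟨⟨_, y.2⟩, by simp⟩
      left_inv := fun x => by ext; simp
      right_inv := fun y => by ext; simp }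
  let σ : α → Equiv.Perm S := fun i => (e i).extendSubtype
  have hσ : ∀ i (x : S), FreeGroup.of i * x.1 ∈ S → (σ i x : FreeGroup α) = FreeGroup.of i * x :=
    fun i x hx => by
      have := (e i).extendSubtype_apply_of_mem x hx
      exact congrArg Subtype.val this
  have hσ' : ∀ i (x : S), (FreeGroup.of i)⁻¹ * x.1 ∈ S →
      ((σ i)⁻¹ x : FreeGroup α) = (FreeGroup.of i)⁻¹ * x := fun i x hx => by
    have h : σ i ⟨_, hx⟩ = x := Subtype.ext (by
      rw [hσ _ _ (by rw [mul_inv_cancel_left]; exact x.2), mul_inv_cancel_left])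
    have h' : (σ i)⁻¹ x = ⟨_, hx⟩ := Equiv.Perm.inv_eq_iff_eq.2 h.symm
    rw [h']
  have hone : (1 : FreeGroup α) ∈ S := ⟨[], List.nil_suffix, rfl⟩
  have key : ∀ L, L <:+ w.toWord →
      ((FreeGroup.lift σ (FreeGroup.mk L)) ⟨1, hone⟩ : FreeGroup α) = FreeGroup.mk L := by
    intro L
    induction L with
    | nil => intro _; rfl
    | cons a L ih =>
      intro hL
      have hL' : L <:+ w.toWord := (List.suffix_cons a L).trans hL
      obtain ⟨i, b⟩ := a
      have hm : FreeGroup.mk ((i, b) :: L) = FreeGroup.mk [(i, b)] * FreeGroup.mk L := by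
        rw [FreeGroup.mul_mk]; rfl
      have hmem : FreeGroup.mk ((i, b) :: L) ∈ S := ⟨_, hL, rfl⟩
      rw [hm] at hmem ⊢
      rw [map_mul, Equiv.Perm.mul_apply]
      have hx : (FreeGroup.lift σ (FreeGroup.mk L)) ⟨1, hone⟩ = ⟨FreeGroup.mk L, L, hL', rfl⟩ :=
        Subtype.ext (ih hL')
      rw [hx]
      cases b with
      | true =>
        have : FreeGroup.mk [(i, true)] = FreeGroup.of i := rfl
        rw [this] at hmem ⊢
        rw [FreeGroup.lift_apply_of]
        exact hσ i _ hmem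
      | false =>
        have : FreeGroup.mk [(i, false)] = (FreeGroup.of i)⁻¹ := rfl
        rw [this] at hmem ⊢
        rw [map_inv, FreeGroup.lift_apply_of]
        exact hσ' i _ hmem
  refine ⟨S, inferInstance, FreeGroup.lift σ, fun h => hw ?_⟩
  have := key w.toWord List.suffix_rfl
  rw [FreeGroup.mk_toWord, h] at this
  exact this.symm

/-- Finite quotients of a free group in which finitely many elements survive, of every order
that is a multiple of some number. -/
theorem FreeGroup.exists_finite_quotients {α : Type} (F : Finset (FreeGroup α))
    (hF : ∀ w ∈ F, w ≠ 1) :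
    ∃ q : ℕ, 0 < q ∧ ∀ k : ℕ, 0 < k → ∃ (P : Type) (_ : Group P) (_ : Fintype P)
      (f : FreeGroup α →* P), Fintype.card P = k * q ∧ ∀ w ∈ F, f w ≠ 1 := by
  classical
  choose B hB f hf using fun w : F => FreeGroup.exists_perm_ne_one (hF w.1 w.2)
  let Q := ∀ w : F, Equiv.Perm (B w)
  let g : FreeGroup α →* Q := MonoidHom.pi f
  refine ⟨Nat.card Q, Nat.card_pos, fun k hk => ?_⟩
  have : NeZero k := ⟨hk.ne'⟩
  have := Fintype.ofFinite Q
  refine ⟨Multiplicative (ZMod k) × Q, inferInstance, inferInstance,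
    MonoidHom.prod 1 g, ?_, fun w hw h => ?_⟩
  · rw [Fintype.card_prod, Nat.card_eq_fintype_card, Fintype.card_multiplicative, ZMod.card]
  · have h' : g w = 1 := congrArg Prod.snd h
    exact hf ⟨w, hw⟩ (congrFun h' ⟨w, hw⟩)

/-- A finite group can be enumerated in such a way that right multiplication by `x` is the
successor map except on a proportion of at most `1 / orderOf x`. -/
theorem exists_enumeration {P : Type*} [Group P] [Fintype P] (x : P) :
    ∃ e : P ≃ Fin (Fintype.card P),
      (Finset.univ.filter fun g => (e (g * x) : ℕ) ≠ e g + 1).card * orderOf x ≤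
        Fintype.card P := by
  classical
  set d := orderOf x with hd
  have hd0 : 0 < d := orderOf_pos x
  let H := Subgroup.zpowers x
  let m : (P ⧸ H) × Fin d → P := fun p => p.1.out * x ^ (p.2 : ℕ)
  have hcoset : ∀ p, (m p : P ⧸ H) = p.1 := fun p => by
    have : (m p : P ⧸ H) = (p.1.out : P ⧸ H) := by
      rw [QuotientGroup.eq]
      simp [m, H]
    rw [this, QuotientGroup.out_eq']
  have hinj : Function.Injective m := by
    intro p p' h
    have h₁ : p.1 = p'.1 := by rw [← hcoset p, h, hcoset p']
    have h₂ : x ^ (p.2 : ℕ) = x ^ (p'.2 : ℕ) := by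
      have : p.1.out * x ^ (p.2 : ℕ) = p'.1.out * x ^ (p'.2 : ℕ) := h
      rw [h₁] at this
      exact mul_left_cancel this
    exact Prod.ext h₁ (Fin.ext (pow_injOn_Iio_orderOf p.2.2 p'.2.2 h₂))
  have hcard : Nat.card P = Nat.card (P ⧸ H) * d := by
    rw [Subgroup.card_eq_card_quotient_mul_card_subgroup H, Nat.card_zpowers]
  have hbij : Function.Bijective m := hinj.bijective_of_nat_card_le (by
    rw [Nat.card_prod, Nat.card_fin, hcard])
  let M := Equiv.ofBijective m hbij
  have hcard' : Fintype.card (P ⧸ H) * d = Fintype.card P := by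
    rw [← Nat.card_eq_fintype_card, ← Nat.card_eq_fintype_card, hcard]
  let e : P ≃ Fin (Fintype.card P) := (M.symm.trans
    ((Fintype.equivFin (P ⧸ H)).prodCongr (Equiv.refl _))).trans
    (finProdFinEquiv.trans (finCongr hcard'))
  have he : ∀ p, (e (m p) : ℕ) = p.2 + d * (Fintype.equivFin (P ⧸ H) p.1 : ℕ) := by
    intro p
    have : M.symm (m p) = p := M.symm_apply_apply p
    simp only [e, Equiv.trans_apply, this]
    rfl
  refine ⟨e, ?_⟩
  refine le_trans ?_ hcard'.le
  refine Nat.mul_le_mul_right d ?_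
  refine (Finset.card_le_card (t := Finset.univ.image fun c : P ⧸ H => m (c, ⟨d - 1, by omega⟩))
    fun g hg => ?_).trans Finset.card_image_le
  obtain ⟨⟨c, y⟩, rfl⟩ := hbij.2 g
  refine Finset.mem_image.2 ⟨c, Finset.mem_univ _, ?_⟩
  by_contra hne
  have hy : (y : ℕ) + 1 < d := by
    by_contra hy
    refine hne (congrArg m (Prod.ext rfl (Fin.ext ?_)))
    show d - 1 = (y : ℕ)
    omega
  refine (Finset.mem_filter.1 hg).2 ?_
  have : m (c, y) * x = m (c, ⟨(y : ℕ) + 1, hy⟩) := by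
    simp only [m, pow_succ, mul_assoc]
  rw [this, he, he]
  show (y : ℕ) + 1 + d * (Fintype.equivFin (P ⧸ H) c : ℕ) =
    (y : ℕ) + d * (Fintype.equivFin (P ⧸ H) c : ℕ) + 1
  omega

/-- Right multiplication by inverses, as an action of a group mapping to `P`. -/
def rightMulHom {G P : Type*} [Group G] [Group P] (f : G →* P) : G →* Equiv.Perm P where
  toFun s := Equiv.mulRight (f s)⁻¹
  map_one' := by ext; simp
  map_mul' s t := by ext; simp [mul_assoc]

theorem exists_level_model_of_group {P : Type} [Group P] [Fintype P]
    (f : FreeGroup (Fin 2) →* P) {n K : ℕ} (hn : Fintype.card P + 2 ≤ n + 1)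
    (hK : ∀ i, K ≤ orderOf (f (FreeGroup.of i))) :
    ∃ (Ψ : FreeGroup (Fin 2) →* Equiv.Perm (Fin (n + 1))) (ℓ : Equiv.Perm (Fin (n + 1))),
      ℓ 0 = 0 ∧ ℓ (Fin.last n) = Fin.last n ∧ (∀ s, Ψ s (Fin.last n) = Fin.last n) ∧
      (∃ a, (Finset.univ.filter fun j => Ψ (FreeGroup.of 0) j ≠ finRotate (n + 1) j).card ≤
        (n + 1 - Fintype.card P) + a ∧ a * K ≤ Fintype.card P) ∧
      (∃ a, (Finset.univ.filter fun j =>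
        Ψ (FreeGroup.of 1) j ≠ (ℓ * finRotate (n + 1) * ℓ⁻¹) j).card ≤
        (n + 1 - Fintype.card P) + a ∧ a * K ≤ Fintype.card P) ∧
      ∀ s, f s ≠ 1 → (Finset.univ.filter fun j => Ψ s j = j).card ≤ n + 1 - Fintype.card P := by
  classical
  choose e he using fun i : Fin 2 => exists_enumeration (f (FreeGroup.of i))⁻¹
  -- positions of the group elements among the levels
  let ι : Fin 2 → P ↪ Fin (n + 1) := fun i =>
    ⟨fun g => ⟨(e i g : ℕ) + 1, by have := (e i g).2; omega⟩, fun g h hgh => by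
      have := congrArg Fin.val hgh
      simp only [Nat.add_right_cancel_iff] at this
      exact (e i).injective (Fin.ext this)⟩
  have hι : ∀ i g, (ι i g : ℕ) = e i g + 1 := fun i g => rfl
  have hrange : ∀ i j, j ∈ range (ι i) ↔ 0 < (j : ℕ) ∧ (j : ℕ) ≤ Fintype.card P := by
    intro i j
    constructor
    · rintro ⟨g, rfl⟩
      have := (e i g).2
      rw [hι]
      omega
    · rintro ⟨h₁, h₂⟩
      refine ⟨(e i).symm ⟨(j : ℕ) - 1, by omega⟩, Fin.ext ?_⟩
      rw [hι, Equiv.apply_symm_apply]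
      show (j : ℕ) - 1 + 1 = j
      omega
  let θ : Equiv.Perm P := (e 1).trans (e 0).symm
  let ℓ : Equiv.Perm (Fin (n + 1)) := Equiv.Perm.viaEmbedding θ⁻¹ (ι 0)
  have hθ : ∀ g, ι 0 (θ g) = ι 1 g := fun g => Fin.ext (by simp [hι, θ])
  have hℓ : ∀ g, ℓ (ι 1 g) = ι 0 g := fun g => by
    rw [← hθ, Equiv.Perm.viaEmbedding_apply]; simp
  let Ψ : FreeGroup (Fin 2) →* Equiv.Perm (Fin (n + 1)) :=
    (Equiv.Perm.viaEmbeddingHom (ι 0)).comp (rightMulHom f)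
  have hΨ : ∀ s g, Ψ s (ι 0 g) = ι 0 (g * (f s)⁻¹) := fun s g =>
    Equiv.Perm.viaEmbedding_apply _ _ _
  have hrot : ∀ i g, (e i (g * (f (FreeGroup.of i))⁻¹) : ℕ) = e i g + 1 →
      finRotate (n + 1) (ι i g) = ι i (g * (f (FreeGroup.of i))⁻¹) := fun i g hg => by
    have hne : ι i g ≠ Fin.last n := fun h => by
      have h₁ := congrArg Fin.val h
      have := (e i g).2
      rw [hι, Fin.val_last] at h₁
      omega
    refine Fin.ext ?_
    rw [coe_finRotate_of_ne_last hne, hι, hι, hg]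
  have hcompl : (Finset.univ.filter fun j => j ∉ range (ι 0)).card = n + 1 - Fintype.card P := by
    have h₁ : (Finset.univ.filter fun j => j ∉ range (ι 0)) = (Finset.univ.map (ι 0))ᶜ := by
      ext j; simp
    rw [h₁, Finset.card_compl, Finset.card_map, Fintype.card_fin, Finset.card_univ]
  have hbad : ∀ (i : Fin 2) (Q : Fin (n + 1) → Prop) [DecidablePred Q],
      (∀ g, (e i (g * (f (FreeGroup.of i))⁻¹) : ℕ) = e i g + 1 → ¬ Q (ι 0 g)) →
      ∃ a, (Finset.univ.filter Q).card ≤ (n + 1 - Fintype.card P) + a ∧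
        a * K ≤ Fintype.card P := by
    intro i Q _ hQ
    refine ⟨(Finset.univ.filter fun g => (e i (g * (f (FreeGroup.of i))⁻¹) : ℕ) ≠
      e i g + 1).card, ?_, ?_⟩
    · rw [← hcompl, ← Finset.card_map (ι 0)]
      refine (Finset.card_le_card fun j hj => ?_).trans (Finset.card_union_le _ _)
      rw [Finset.mem_union, Finset.mem_filter, Finset.mem_map]
      by_cases hr : j ∈ range (ι 0)
      · obtain ⟨g, rfl⟩ := hr
        exact Or.inr ⟨g, Finset.mem_filter.2 ⟨Finset.mem_univ _, fun h =>
          hQ g h (Finset.mem_filter.1 hj).2⟩, rfl⟩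
      · exact Or.inl ⟨Finset.mem_univ _, hr⟩
    · refine (Nat.mul_le_mul_left _ ?_).trans (he i)
      rw [orderOf_inv]
      exact hK i
  have hlast : Fin.last n ∉ range (ι 0) := fun h => by
    rw [hrange, Fin.val_last] at h
    omega
  refine ⟨Ψ, ℓ, ?_, Equiv.Perm.viaEmbedding_apply_of_notMem _ _ _ hlast,
    fun s => Equiv.Perm.viaEmbedding_apply_of_notMem _ _ _ hlast, hbad 0 _ fun g hg => ?_, hbad 1 _ fun g hg => ?_, fun s hs => ?_⟩
  · refine Equiv.Perm.viaEmbedding_apply_of_notMem _ _ _ fun h => ?_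
    simp [hrange] at h
  · rw [not_not, hΨ, hrot 0 g hg]
  · have hinv : ℓ⁻¹ (ι 0 g) = ι 1 g := by rw [Equiv.Perm.inv_eq_iff_eq, hℓ]
    rw [not_not, hΨ, Equiv.Perm.mul_apply, Equiv.Perm.mul_apply, hinv, hrot 1 g hg, hℓ]
  · rw [← hcompl]
    refine Finset.card_le_card fun j hj => Finset.mem_filter.2 ⟨Finset.mem_univ _, ?_⟩
    rintro ⟨g, rfl⟩
    have h := (Finset.mem_filter.1 hj).2
    rw [hΨ] at h
    have := (ι 0).injective h
    exact hs (by simpa using this)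

/-- For all sufficiently large `n` there is an action of the free group on `n + 1` levels that is
almost free on a given finite set, and whose generators almost agree with the cyclic shift and
with a conjugate of the cyclic shift. -/
theorem exists_level_model (F : Finset (FreeGroup (Fin 2))) (hF : ∀ w ∈ F, w ≠ 1) {ε : ℝ}
    (hε : 0 < ε) :
    ∃ N : ℕ, ∀ n : ℕ, N ≤ n + 1 →
      ∃ (Ψ : FreeGroup (Fin 2) →* Equiv.Perm (Fin (n + 1))) (ℓ : Equiv.Perm (Fin (n + 1))),
      ℓ 0 = 0 ∧ ℓ (Fin.last n) = Fin.last n ∧ (∀ s, Ψ s (Fin.last n) = Fin.last n) ∧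
      ((Finset.univ.filter fun j => Ψ (FreeGroup.of 0) j ≠ finRotate (n + 1) j).card : ℝ) ≤
        ε * (n + 1) ∧
      ((Finset.univ.filter fun j =>
        Ψ (FreeGroup.of 1) j ≠ (ℓ * finRotate (n + 1) * ℓ⁻¹) j).card : ℝ) ≤ ε * (n + 1) ∧
      ∀ s ∈ F, ((Finset.univ.filter fun j => Ψ s j = j).card : ℝ) ≤ ε * (n + 1) := by
  classical
  obtain ⟨K, hK⟩ := exists_nat_gt (2 / ε)
  have hK0 : (0 : ℝ) < K := (by positivity : (0 : ℝ) < 2 / ε).trans hK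
  let F' := F ∪ (Finset.univ ×ˢ Finset.Ioo 0 K).image fun p : Fin 2 × ℕ => FreeGroup.of p.1 ^ p.2
  have hpow : ∀ (i : Fin 2) (k : ℕ), 0 < k → FreeGroup.of i ^ k ≠ 1 := by
    intro i k hk h
    rw [pow_eq_one_iff_left hk.ne'] at h
    exact FreeGroup.of_ne_one i h
  have hF' : ∀ w ∈ F', w ≠ 1 := by
    intro w hw
    rcases Finset.mem_union.1 hw with h | h
    · exact hF w h
    · obtain ⟨p, hp, rfl⟩ := Finset.mem_image.1 h
      exact hpow _ _ (Finset.mem_Ioo.1 (Finset.mem_product.1 hp).2).1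
  obtain ⟨q, hq, hquot⟩ := FreeGroup.exists_finite_quotients F' hF'
  obtain ⟨N, hN⟩ := exists_nat_gt ((q + 1) * (2 / ε))
  refine ⟨max N (q + 2), fun n hn => ?_⟩
  have hn₁ : N ≤ n + 1 := (le_max_left _ _).trans hn
  have hn₂ : q + 2 ≤ n + 1 := (le_max_right _ _).trans hn
  have hk : 0 < (n - 1) / q := Nat.div_pos (by omega) hq
  obtain ⟨P, _, _, f, hcard, hf⟩ := hquot _ hk
  have hdm := Nat.div_add_mod (n - 1) q
  have hmod := Nat.mod_lt (n - 1) hq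
  rw [mul_comm] at hdm
  have hord : ∀ i, K ≤ orderOf (f (FreeGroup.of i)) := by
    intro i
    by_contra hlt
    refine hf (FreeGroup.of i ^ orderOf (f (FreeGroup.of i))) (Finset.mem_union_right _
      (Finset.mem_image.2 ⟨(i, _), Finset.mem_product.2 ⟨Finset.mem_univ _,
        Finset.mem_Ioo.2 ⟨orderOf_pos _, not_le.1 hlt⟩⟩, rfl⟩)) ?_
    rw [map_pow, pow_orderOf_eq_one]
  obtain ⟨Ψ, ℓ, h₀, h₁, h₂, ⟨a, ha, haK⟩, ⟨b, hb, hbK⟩, hfix⟩ :=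
    exists_level_model_of_group f (n := n) (by omega) hord
  have hrest : ((n + 1 - Fintype.card P : ℕ) : ℝ) ≤ ε / 2 * (n + 1) := by
    have e₁ : n + 1 - Fintype.card P ≤ q + 1 := by omega
    have e₂ : ((n + 1 - Fintype.card P : ℕ) : ℝ) ≤ q + 1 := by exact_mod_cast e₁
    have e₃ : (N : ℝ) ≤ n + 1 := by exact_mod_cast hn₁
    have e₄ : ((q : ℝ) + 1) * (2 / ε) ≤ n + 1 := hN.le.trans e₃
    rw [mul_div_assoc', div_le_iff₀ hε] at e₄
    linarith
  have hcyc : ∀ c : ℕ, c * K ≤ Fintype.card P → (c : ℝ) ≤ ε / 2 * (n + 1) := by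
    intro c hc
    have e₁ : (c : ℝ) * K ≤ n + 1 := by exact_mod_cast hc.trans (by omega)
    rw [div_lt_iff₀ hε] at hK
    have e₂ : (c : ℝ) * 2 ≤ c * (K * ε) := mul_le_mul_of_nonneg_left hK.le (Nat.cast_nonneg c)
    have e₃ := mul_le_mul_of_nonneg_right e₁ hε.le
    linarith
  refine ⟨Ψ, ℓ, h₀, h₁, h₂, ?_, ?_, fun s hs => ?_⟩
  · refine (Nat.cast_le.2 ha).trans ?_
    rw [Nat.cast_add]
    linarith [hcyc a haK]
  · refine (Nat.cast_le.2 hb).trans ?_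
    rw [Nat.cast_add]
    linarith [hcyc b hbK]
  · refine (Nat.cast_le.2 (hfix s (hf s (Finset.mem_union_left _ hs)))).trans (hrest.trans ?_)
    have : (0 : ℝ) ≤ n + 1 := by positivity
    nlinarith

end FiniteModels

section Existence

variable {X : Type*} [TopologicalSpace X] {T : X ≃ₜ X}

theorem finRotate_isCycleOn (n : ℕ) : (finRotate (n + 1)).IsCycleOn univ := by
  cases n with
  | zero =>
    refine ⟨bijOn_univ.2 (finRotate 1).bijective, fun x _ y _ => ?_⟩
    obtain rfl : x = y := Fin.ext (by lia)
    exact Equiv.Perm.SameCycle.refl _ _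
  | succ n =>
    have h := (isCycle_finRotate (n := n)).isCycleOn
    have hs : {x | finRotate (n + 2) x ≠ x} = univ := by
      ext x
      simp only [mem_ofPred_eq, mem_univ, iff_true]
      exact Equiv.Perm.mem_support.1 (support_finRotate ▸ Finset.mem_univ x)
    rwa [hs] at h

theorem conj_finRotate_apply {n : ℕ} (σ : Equiv.Perm (Fin (n + 1))) (j : ℕ) (h : j + 1 < n + 1) :
    σ ⟨j + 1, h⟩ = (σ * finRotate (n + 1) * σ⁻¹) (σ ⟨j, Nat.lt_of_succ_lt h⟩) := by
  have hσ : σ⁻¹ (σ ⟨j, Nat.lt_of_succ_lt h⟩) = ⟨j, Nat.lt_of_succ_lt h⟩ :=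
    Equiv.Perm.inv_eq_iff_eq.2 rfl
  rw [Equiv.Perm.mul_apply, Equiv.Perm.mul_apply, hσ, finRotate_of_lt (Nat.lt_of_succ_lt_succ h)]

/-- Conjugating by a level permutation that fixes the bottom and top levels gives a tower
permutation. -/
theorem Castle.isTowerPermutation_conj (C : Castle T) (hne : ∀ i, (C.base i).Nonempty)
    {ρ : ∀ i, Equiv.Perm (Fin (C.ht i + 1))} (hzero : ∀ i, ρ i 0 = 0)
    (hlast : ∀ i, ρ i (Fin.last _) = Fin.last _) :
    IsTowerPermutation T (C.permHom ρ * T * (C.permHom ρ)⁻¹) := by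
  let e := (Fintype.equivFin C.ι).symm
  have hinv : ∀ i, (ρ i)⁻¹ (Fin.last _) = Fin.last _ := fun i => by
    rw [Equiv.Perm.inv_eq_iff_eq, hlast]
  have hloc : ∀ (i : Fin (Fintype.card C.ι)) (j : Fin (C.ht (e i) + 1)) (x : X),
      x ∈ (T ^ (j : ℕ)) '' C.base (e i) → C.loc x = ⟨e i, j⟩ := fun i j x hx =>
    C.loc_eq_iff_mem_image.2 hx
  refine ⟨Fintype.card C.ι, fun i => C.base (e i), fun i => C.ht (e i),
    fun i => ρ (e i) * finRotate (C.ht (e i) + 1) * (ρ (e i))⁻¹,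
    fun i => ⟨C.isClopen_base _, hne _⟩, fun p q hpq => disjoint_left.2 fun x hx hx' => ?_,
    eq_univ_of_forall fun x => ?_, fun i => ⟨?_, ?_⟩, fun i j hj x hx => ?_, fun i x hx => ?_⟩
  · have h := (hloc p.1 p.2 x hx).symm.trans (hloc q.1 q.2 x hx')
    obtain ⟨i, j⟩ := p
    obtain ⟨i', j'⟩ := q
    obtain rfl : i = i' := e.injective (congrArg Sigma.fst h)
    simp only [Sigma.mk.injEq, heq_eq_eq, true_and] at h
    exact hpq (by rw [h])
  · obtain ⟨i, hi⟩ := e.surjective (C.loc x).1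
    have h : ∀ k, k = (C.loc x).1 → ∃ j : Fin (C.ht k + 1), x ∈ (T ^ (j : ℕ)) '' C.base k := by
      rintro _ rfl
      exact ⟨(C.loc x).2, C.loc_eq_iff_mem_image.1 rfl⟩
    obtain ⟨j, hj⟩ := h _ hi
    exact mem_iUnion.2 ⟨⟨i, j⟩, hj⟩
  · have h := (finRotate_isCycleOn (C.ht (e i))).conj (g := ρ (e i))
    rwa [image_univ, (ρ (e i)).range_eq_univ] at h
  · rw [Equiv.Perm.mul_apply, Equiv.Perm.mul_apply, hinv, finRotate_last, hzero]
  · have h := hloc i j x hx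
    have key := C.conj_apply_of_ne_last (ρ := ρ) (y := x)
      (π := fun i => ρ i * finRotate (C.ht i + 1) * (ρ i)⁻¹) hlast
      (fun i => conj_finRotate_apply (ρ i)) (by rw [h]; exact hj)
    rw [h] at key
    exact key
  · have h := hloc i (Fin.last _) x hx
    exact C.conj_apply_of_last hzero hlast (by rw [h])

variable [CompactSpace X] [T2Space X] [TotallyDisconnectedSpace X] [Infinite X]
  [MeasurableSpace X] [BorelSpace X] {μ : Measure X} [IsProbabilityMeasure μ]

/-- Tower permutations that are almost free on a finite set, approximated by an action `β`. -/
theorem exists_towerPermutation_approx (hT : IsMinimalAct (zAct T)) (hμ : MeasurePreserving T μ μ)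
    (F : Finset (FreeGroup (Fin 2))) (hF : ∀ w ∈ F, w ≠ 1) {ε : ℝ} (hε : 0 < ε) :
    ∃ (S : X ≃ₜ X) (β : Act (FreeGroup (Fin 2)) X), IsTowerPermutation T S ∧
      μ.real {x | T x ≠ β (FreeGroup.of 0) x} ≤ ε ∧
      μ.real {x | S x ≠ β (FreeGroup.of 1) x} ≤ ε ∧
      ∀ s ∈ F, μ.real {x | β s x = x} ≤ ε := by
  classical
  obtain ⟨N, hN⟩ := exists_level_model F hF hε
  obtain ⟨C, hne, hC⟩ := exists_castle hT (max N 2)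
  choose Ψ ℓ hzero hlast hΨ ha hb hfix using fun i => hN (C.ht i) ((le_max_left _ _).trans (hC i))
  have hht : ∀ i, (0 : Fin (C.ht i + 1)) ≠ Fin.last _ := fun i h => by
    have h₁ := congrArg Fin.val h
    have h₂ := (le_max_right N 2).trans (hC i)
    simp at h₁
    omega
  let β : Act (FreeGroup (Fin 2)) X := C.permHom.comp (MonoidHom.pi Ψ)
  have hβ : ∀ s x, β s x =
      (T ^ (((Ψ (C.loc x).1 s (C.loc x).2 : ℕ) : ℤ) - ((C.loc x).2 : ℕ))) x := fun s x =>
    C.permHom_apply _ x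
  have hinv : ∀ i, (ℓ i)⁻¹ (Fin.last _) = Fin.last _ := fun i => by
    rw [Equiv.Perm.inv_eq_iff_eq, hlast]
  refine ⟨_, β, C.isTowerPermutation_conj hne hzero hlast, ?_, ?_, fun s hs => ?_⟩
  · refine (measureReal_mono (fun x hx => ?_) (measure_ne_top _ _)).trans
      (C.measureReal_levels_le hμ _ ha)
    refine mem_ofPred.2 (Finset.mem_filter.2 ⟨Finset.mem_univ _, fun h => hx ?_⟩)
    have hl : (C.loc x).2 ≠ Fin.last _ := fun hl => by
      rw [hl, hΨ, finRotate_last] at h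
      exact hht _ h.symm
    rw [hβ, h, coe_finRotate_of_ne_last hl]
    simp
  · refine (measureReal_mono (fun x hx => ?_) (measure_ne_top _ _)).trans
      (C.measureReal_levels_le hμ _ hb)
    refine mem_ofPred.2 (Finset.mem_filter.2 ⟨Finset.mem_univ _, fun h => hx ?_⟩)
    have hl : (C.loc x).2 ≠ Fin.last _ := fun hl => by
      rw [hl, hΨ, Equiv.Perm.mul_apply, Equiv.Perm.mul_apply, hinv, finRotate_last, hzero] at h
      exact hht _ h.symm
    rw [hβ, h]
    exact C.conj_apply_of_ne_last (π := fun i => ℓ i * finRotate _ * (ℓ i)⁻¹) hlast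
      (fun i => conj_finRotate_apply (ℓ i)) hl
  · refine (measureReal_mono (fun x hx => ?_) (measure_ne_top _ _)).trans
      (C.measureReal_levels_le hμ _ fun i => hfix i s hs)
    refine mem_ofPred.2 (Finset.mem_filter.2 ⟨Finset.mem_univ _, ?_⟩)
    have h := C.loc_permHom (fun i => Ψ i s) x
    have hx' : C.permHom (fun i => Ψ i s) x = x := hx
    rw [hx'] at h
    have key : ∀ p q : (i : C.ι) × Fin (C.ht i + 1), p = q → ∀ h : p.1 = q.1,
        h ▸ p.2 = q.2 := by rintro p q rfl h; rfl
    exact (key _ _ h rfl).symm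

end Existence

section FullGroup

variable {X : Type*} [TopologicalSpace X]

theorem IsTowerPermutation.mem_fullGroup {T S : X ≃ₜ X} (h : IsTowerPermutation T S) :
    S ∈ fullGroup T := by
  obtain ⟨φ, hφ, rfl⟩ := h.exists_conj
  exact mul_mem (mul_mem hφ (self_mem_fullGroup _)) (inv_mem hφ)

theorem f2Act_mem_fullGroup {T S : X ≃ₜ X} (h : S ∈ fullGroup T) (s : FreeGroup (Fin 2)) :
    f2Act T S s ∈ fullGroup T :=
  map_mem_of_generators _ _ (by rw [f2Act_of_zero]; exact self_mem_fullGroup _)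
    (by rwa [f2Act_of_one]) s

end FullGroup

section Limit

variable {X : Type*} [TopologicalSpace X] [MeasurableSpace X] [BorelSpace X] [T2Space X]

theorem tendsto_measure_ne {G : Type*} [Group G] {μ : ℕ → Measure X} {α β : ℕ → Act G X}
    (hα : ∀ n s, MeasurePreserving (α n s) (μ n) (μ n)) {A : Set G}
    (hA : Subgroup.closure A = ⊤)
    (h : ∀ s ∈ A, Tendsto (fun n => μ n {x | α n s x ≠ β n s x}) atTop (𝓝 0)) (s : G) :
    Tendsto (fun n => μ n {x | α n s x ≠ β n s x}) atTop (𝓝 0) := by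
  have hmeas : ∀ n s, MeasurableSet {x | α n s x ≠ β n s x} := fun n s =>
    (isClosed_eq (α n s).continuous (β n s).continuous).isOpen_compl.measurableSet
  have hs : s ∈ Subgroup.closure A := hA ▸ Subgroup.mem_top s
  induction hs using Subgroup.closure_induction with
  | mem s hs => exact h s hs
  | one => simp
  | mul s t _ _ hs ht =>
    have hsum := hs.add ht
    rw [add_zero] at hsum
    refine tendsto_of_tendsto_of_tendsto_of_le_of_le tendsto_const_nhds hsum
      (fun _ => zero_le) fun n => ?_
    have hsub : {x | α n (s * t) x ≠ β n (s * t) x} ⊆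
        α n t ⁻¹' {x | α n s x ≠ β n s x} ∪ {x | α n t x ≠ β n t x} := by
      intro x hx
      by_contra hcon
      simp only [mem_union, mem_preimage, mem_ofPred_eq, not_or, not_not] at hcon
      refine hx ?_
      rw [map_mul, map_mul, Homeomorph.mul_apply, Homeomorph.mul_apply, hcon.1, hcon.2]
    refine (measure_mono hsub).trans ((measure_union_le _ _).trans ?_)
    rw [(hα n t).measure_preimage (hmeas n s).nullMeasurableSet]
  | inv s _ hs =>
    refine tendsto_of_tendsto_of_tendsto_of_le_of_le tendsto_const_nhds hs
      (fun _ => zero_le) fun n => ?_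
    have hsub : {x | α n s⁻¹ x ≠ β n s⁻¹ x} ⊆ α n s⁻¹ ⁻¹' {x | α n s x ≠ β n s x} := by
      intro x hx
      by_contra hcon
      simp only [mem_preimage, mem_ofPred_eq, not_not] at hcon
      refine hx ?_
      rw [← Homeomorph.mul_apply, ← map_mul, mul_inv_cancel, map_one, Homeomorph.one_apply] at hcon
      conv_rhs => rw [hcon]
      rw [← Homeomorph.mul_apply, ← map_mul, inv_mul_cancel, map_one, Homeomorph.one_apply]
    refine (measure_mono hsub).trans ?_
    rw [(hα n s⁻¹).measure_preimage (hmeas n s).nullMeasurableSet]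

theorem exists_asymptoticallyFree [CompactSpace X] [TotallyDisconnectedSpace X] [Infinite X]
    {T : ℕ → X ≃ₜ X} {μ : ℕ → Measure X} [∀ n, IsProbabilityMeasure (μ n)]
    (hT : ∀ n, IsMinimalAct (zAct (T n))) (hμ : ∀ n, MeasurePreserving (T n) (μ n) (μ n)) :
    ∃ S : ℕ → X ≃ₜ X, (∀ n, IsTowerPermutation (T n) (S n)) ∧ AsymptoticallyFree T S μ := by
  classical
  obtain ⟨u, hu⟩ := exists_surjective_nat (FreeGroup (Fin 2))
  let F : ℕ → Finset (FreeGroup (Fin 2)) := fun n =>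
    ((Finset.range n).image u).filter fun s => s ≠ 1
  choose S β hS ha hb hfix using fun n : ℕ => exists_towerPermutation_approx (hT n) (hμ n) (F n)
    (fun w hw => (Finset.mem_filter.1 hw).2) (ε := 1 / ((n : ℝ) + 1)) (by positivity)
  have hlim : Tendsto (fun n : ℕ => ENNReal.ofReal (1 / ((n : ℝ) + 1))) atTop (𝓝 0) := by
    rw [← ENNReal.ofReal_zero]
    exact ENNReal.tendsto_ofReal tendsto_one_div_add_atTop_nhds_zero_nat
  have hle : ∀ n (A : Set X), (μ n).real A ≤ 1 / ((n : ℝ) + 1) →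
      μ n A ≤ ENNReal.ofReal (1 / ((n : ℝ) + 1)) := fun n A h => by
    rw [← ofReal_measureReal]
    exact ENNReal.ofReal_le_ofReal h
  refine ⟨S, hS, fun s hs => ?_⟩
  have hpres : ∀ n s, MeasurePreserving (f2Act (T n) (S n) s) (μ n) (μ n) := fun n s =>
    measurePreserving_of_mem_fullGroup (hμ n) (f2Act_mem_fullGroup (hS n).mem_fullGroup s)
  have hne := tendsto_measure_ne (α := fun n => f2Act (T n) (S n)) (β := β) hpres
    (FreeGroup.closure_range_of (Fin 2)) (by
      rintro _ ⟨i, rfl⟩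
      refine tendsto_of_tendsto_of_tendsto_of_le_of_le tendsto_const_nhds hlim
        (fun _ => zero_le) fun n => hle n _ ?_
      fin_cases i
      · simpa using ha n
      · simpa using hb n) s
  have hsum := hne.add hlim
  rw [add_zero] at hsum
  obtain ⟨k, hk⟩ := hu s
  refine tendsto_of_tendsto_of_tendsto_of_le_of_le' tendsto_const_nhds hsum
    (Eventually.of_forall fun _ => zero_le) ?_
  filter_upwards [eventually_gt_atTop k] with n hn
  have hsF : s ∈ F n := Finset.mem_filter.2 ⟨Finset.mem_image.2 ⟨k, Finset.mem_range.2 hn, hk⟩, hs⟩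
  have hsub : {x | f2Act (T n) (S n) s x = x} ⊆
      {x | f2Act (T n) (S n) s x ≠ β n s x} ∪ {x | β n s x = x} := by
    intro x hx
    by_cases h : f2Act (T n) (S n) s x = β n s x
    · exact Or.inr (h.symm.trans hx)
    · exact Or.inl h
  exact (measure_mono hsub).trans ((measure_union_le _ _).trans
    (add_le_add le_rfl (hle n _ (hfix n s hsF))))

end Limit

section Diagonal

variable {X : Type*} [TopologicalSpace X] {T S : ℕ → X ≃ₜ X}

theorem diagAct_f2Act_of_zero :
    diagAct (fun n => f2Act (T n) (S n)) (FreeGroup.of 0) = Homeomorph.piCongrRight T := by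
  ext x i
  simp [diagAct]

theorem diagAct_f2Act_of_one :
    diagAct (fun n => f2Act (T n) (S n)) (FreeGroup.of 1) = Homeomorph.piCongrRight S := by
  ext x i
  simp [diagAct]

theorem invMeasures_f2Act [MeasurableSpace X] [BorelSpace X] {T S : X ≃ₜ X}
    (h : S ∈ fullGroup T) : invMeasures (f2Act T S) = invMeasures (zAct T) := by
  ext ν
  rw [mem_invMeasures_f2, mem_invMeasures_zAct, f2Act_of_zero, f2Act_of_one]
  exact ⟨fun hν => ⟨hν.1, hν.2.1⟩,
    fun hν => ⟨hν.1, hν.2, measurePreserving_of_mem_fullGroup hν.2 h⟩⟩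

theorem piCongrRight_conj {φ : ℕ → X ≃ₜ X} (h : ∀ n, S n = φ n * T n * (φ n)⁻¹) :
    Homeomorph.piCongrRight S = Homeomorph.piCongrRight φ * Homeomorph.piCongrRight T *
      (Homeomorph.piCongrRight φ)⁻¹ := by
  ext x i
  simp only [Homeomorph.piCongrRight_apply, h]
  rfl

end Diagonal

section FreeActions

variable {Y : Type*} [TopologicalSpace Y] {α : Act (FreeGroup (Fin 2)) Y}

theorem mem_WA_of_zAct [MeasurableSpace Y] {s : FreeGroup (Fin 2)} (hfree : TopFree α)
    (hmin : IsMinimalAct (zAct (α s))) (hwm : TopWeaklyMixing (zAct (α s)))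
    (hne : (invMeasures α).Nonempty) : α ∈ WA (FreeGroup (Fin 2)) Y :=
  ⟨isMinimalAct_of_zAct hmin, hfree, topWeaklyMixing_of_zAct hwm, hne⟩

theorem mem_Astar_of_weaklyMixing [Nonempty Y] [MeasurableSpace Y] (hfree : TopFree α)
    (hne : (invMeasures α).Nonempty)
    (h : ∀ i, StrictlyErgodic (zAct (α (FreeGroup.of i))) ∧
      TopWeaklyMixing (zAct (α (FreeGroup.of i)))) : α ∈ Astar Y 2 :=
  ⟨hfree, hne, fun i => ⟨(h i).1, (h i).2.spectrallyAperiodic⟩⟩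

end FreeActions

end SqDiv

end

theorem proposition12 {X : Type*} [TopologicalSpace X] [CompactSpace X]
    [TopologicalSpace.MetrizableSpace X] [TotallyDisconnectedSpace X] [PerfectSpace X]
    [Nonempty X] [MeasurableSpace X] [BorelSpace X]
    (T : ℕ → X ≃ₜ X) (μ : ℕ → Measure X) [∀ n, IsProbabilityMeasure (μ n)]
    (hT : ∀ n, StrictlyErgodic (zAct (T n)))
    (hμ : ∀ n, μ n ∈ invMeasures (zAct (T n)))
    (hwm : ∀ n, MeasureWeaklyMixing (zAct (T n)) (μ n))
    (hdisj : DisjointFamily (fun n => zAct (T n)) μ) :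
    -- suitable tower permutations exist
    (∃ S : ℕ → X ≃ₜ X, (∀ n, IsTowerPermutation (T n) (S n)) ∧ AsymptoticallyFree T S μ) ∧
    -- and all of them have the stated properties
    ∀ S : ℕ → X ≃ₜ X, (∀ n, IsTowerPermutation (T n) (S n)) → AsymptoticallyFree T S μ →
      (∀ n, invMeasures (f2Act (T n) (S n)) = invMeasures (zAct (T n)) ∧
        invMeasures (zAct (S n)) = invMeasures (zAct (T n))) ∧
      (TopFree (diagAct fun n => f2Act (T n) (S n)) ∧
        TopWeaklyMixing (diagAct fun n => f2Act (T n) (S n)) ∧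
        StrictlyErgodic (diagAct fun n => f2Act (T n) (S n))) ∧
      (StrictlyErgodic (zAct (Homeomorph.piCongrRight T)) ∧
        TopWeaklyMixing (zAct (Homeomorph.piCongrRight T)) ∧
        StrictlyErgodic (zAct (Homeomorph.piCongrRight S)) ∧
        TopWeaklyMixing (zAct (Homeomorph.piCongrRight S))) ∧
      SquarelyDivisible (diagAct fun n => f2Act (T n) (S n)) ∧
      ∀ (Y : Type*) [TopologicalSpace Y] [MeasurableSpace Y] [BorelSpace Y]
        (h : (ℕ → X) ≃ₜ Y),
        conjAct h (diagAct fun n => f2Act (T n) (S n)) ∈ WA (FreeGroup (Fin 2)) Y ∧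
        conjAct h (diagAct fun n => f2Act (T n) (S n)) ∈ Astar Y 2 ∧
        SquarelyDivisible (conjAct h (diagAct fun n => f2Act (T n) (S n))) := by
  have hinv : ∀ n, MeasurePreserving (T n) (μ n) (μ n) := fun n =>
    (mem_invMeasures_zAct.1 (hμ n)).2
  have x₀ : X := Classical.arbitrary X
  have : (𝓝[≠] x₀).NeBot := perfectSpace_iff_forall_not_isolated.1 inferInstance x₀
  have : Infinite X := infinite_univ_iff.1 (infinite_of_mem_nhds x₀ univ_mem)
  refine ⟨exists_asymptoticallyFree (fun n => (hT n).1) hinv, fun S hS hfree => ?_⟩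
  choose φ hφ hconj using fun n => (hS n).exists_conj
  have hfull := fun n => (hS n).mem_fullGroup
  have hTerg := strictlyErgodic_piCongrRight hT hμ hdisj
  have hTmix := topWeaklyMixing_piCongrRight
    (fun n => topWeaklyMixing_of_measure (hT n).1 (hinv n) (hwm n)) hTerg.1
  have hS' : zAct (Homeomorph.piCongrRight S) =
      conjAct (Homeomorph.piCongrRight φ) (zAct (Homeomorph.piCongrRight T)) := by
    rw [piCongrRight_conj hconj, zAct_conj]
  have hSerg : StrictlyErgodic (zAct (Homeomorph.piCongrRight S)) := by
    rw [hS']; exact hTerg.conjAct _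
  have hSmix : TopWeaklyMixing (zAct (Homeomorph.piCongrRight S)) := by
    rw [hS']; exact hTmix.conjAct _
  set δ := diagAct fun n => f2Act (T n) (S n) with hδ
  have hδ₀ : δ (FreeGroup.of 0) = Homeomorph.piCongrRight T := diagAct_f2Act_of_zero
  have hδ₁ : δ (FreeGroup.of 1) = Homeomorph.piCongrRight S := diagAct_f2Act_of_one
  have hδfree : TopFree δ := topFree_diagAct
    (fun n U => measure_pos_of_minimal (hT n).1 (hinv n)) hfree
  have hδmix : TopWeaklyMixing δ :=
    topWeaklyMixing_of_zAct (s := FreeGroup.of 0) (by rwa [hδ₀])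
  have hδμ : Measure.infinitePi μ ∈ invMeasures δ := by
    rw [mem_invMeasures_f2, hδ₀, hδ₁]
    exact ⟨inferInstance, measurePreserving_piCongrRight hinv, measurePreserving_piCongrRight
      fun n => measurePreserving_of_mem_fullGroup (hinv n) (hfull n)⟩
  have hδerg : StrictlyErgodic δ := by
    refine ⟨isMinimalAct_of_zAct (s := FreeGroup.of 0) (by rw [hδ₀]; exact hTerg.1),
      _, hδμ, fun ν hν => eq_infinitePi_of_disjointFamily hT hμ hdisj ?_⟩
    obtain ⟨hp, h₀, -⟩ := mem_invMeasures_f2.1 hν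
    exact mem_invMeasures_zAct.2 ⟨hp, hδ₀ ▸ h₀⟩
  have hgen : ∀ i, StrictlyErgodic (zAct (δ (FreeGroup.of i))) ∧
      TopWeaklyMixing (zAct (δ (FreeGroup.of i))) := by
    intro i
    fin_cases i
    · change StrictlyErgodic (zAct (δ (FreeGroup.of 0))) ∧ TopWeaklyMixing (zAct (δ (FreeGroup.of 0)))
      rw [hδ₀]; exact ⟨hTerg, hTmix⟩
    · change StrictlyErgodic (zAct (δ (FreeGroup.of 1))) ∧ TopWeaklyMixing (zAct (δ (FreeGroup.of 1)))
      rw [hδ₁]; exact ⟨hSerg, hSmix⟩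
  have hα₀ : ∀ s, f2Act (T 0) (S 0) s ∈ fullGroup (f2Act (T 0) (S 0) (FreeGroup.of 0)) := by
    rw [f2Act_of_zero]; exact f2Act_mem_fullGroup (hfull 0)
  have hα₀erg : StrictlyErgodic (zAct (f2Act (T 0) (S 0) (FreeGroup.of 0))) := by
    rw [f2Act_of_zero]; exact hT 0
  refine ⟨fun n => ⟨invMeasures_f2Act (hfull n), ?_⟩, ⟨hδfree, hδmix, hδerg⟩,
    ⟨hTerg, hTmix, hSerg, hSmix⟩, squarelyDivisible_of_factor (α := f2Act (T 0) (S 0))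
      (continuous_apply 0) (fun s z => rfl) hα₀ hα₀erg (hgen 0).1, ?_⟩
  · rw [hconj n, invMeasures_zAct_conj (hφ n)]
  intro Y _ _ _ h
  have := h.compactSpace
  have := h.symm.isEmbedding.metrizableSpace
  have := h.totallyDisconnectedSpace
  have : Infinite Y := Infinite.of_injective h h.injective
  have hYgen : ∀ i, StrictlyErgodic (zAct (conjAct h δ (FreeGroup.of i))) ∧
      TopWeaklyMixing (zAct (conjAct h δ (FreeGroup.of i))) := fun i => by
    rw [zAct_conjAct]
    exact ⟨(hgen i).1.conjAct h, (hgen i).2.conjAct h⟩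
  have hYμ : (invMeasures (conjAct h δ)).Nonempty := ⟨_, map_mem_invMeasures hδμ h⟩
  refine ⟨mem_WA_of_zAct (hδfree.conjAct h) (hYgen 0).1.1 (hYgen 0).2 hYμ,
    mem_Astar_of_weaklyMixing (hδfree.conjAct h) hYμ hYgen,
    squarelyDivisible_of_factor (α := f2Act (T 0) (S 0)) (p := fun y => h.symm y 0)
      ((continuous_apply 0).comp h.symm.continuous) (fun s z => ?_) hα₀ hα₀erg (hYgen 0).1⟩
  rw [conjAct_apply, h.symm_apply_apply]
  rfl
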